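/- Let $I=(a,b)$ and $I'=(c,d)$ be bounded open intervals with $a<c<d<b$, let $\alpha>0$, $\beta\ge 0$ and $g\in L^\infty(I)$. For $u\in SBV(I)$ let $u'$ be its approximate derivative, $S_u\subset I$ its singular set, $u^l(x),u^r(x)$ its left and right traces, $u^-=\min(u^l,u^r)$, $u^+=\max(u^l,u^r)$, and put $$F(u)=\int_I |u'|^2\,dx+\beta\int_I |u-g|^2\,dx+\alpha\,\mathcal H^0(S_u)\in[0,+\infty].$$ The function $u\in SBV(I)$ is called a Dirichlet minimizer of $F$ in $I'$ if $F(u)\le F(v)$ for all $v\in SBV(I)$ with $v=u$ a.e. in $I\setminus I'$. Let $\Gamma_u$ be the $1$-dimensional rectifiable current in $I\times\mathbb R$ carried, with multiplicity $1$, by the extended graph $\{(x,t): x\in I,\ u^-(x)\le t\le u^+(x)\}$ and oriented by the unit tangent pointing to the right outside $S_u\times\mathbb R$ and pointing from $u^l(x)$ to $u^r(x)$ on the vertical segments over $x\in S_u$. Let $$C=\Big\{\sum_{i=1}^k\lambda_i\Gamma_{u_i}:\ k\in\mathbb N,\ \lambda_i>0,\ u_i\in SBV(I)\Big\},$$ and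 for $T\in C$, written as a rectifiable current $T=(\mathcal M,\theta,\xi)$ with multiplicity $\theta>0$ and unit tangent $\xi=(\xi^x,\xi^t)$, let $\nu_T=(\xi^t,-\xi^x)$ and $$G(T)=\sup_{\phi\in K}\int_{\mathcal M}\theta\,\langle\phi,\nu_T\rangle\,d\mathcal H^1\in[0,+\infty],$$ where $K$ is the set of Borel fields $\phi=(\phi^x,\phi^t):I\times\mathbb R\to\mathbb R^2$ such that, for all $x\in I$ and $t,t_1,t_2\in\mathbb R$, $$\phi^t(x,t)\ \ge\ \tfrac14|\phi^x(x,t)|^2-\beta\,(t-g(x))^2,\qquad \Big|\int_{t_1}^{t_2}\phi^x(x,s)\,ds\Big|\le\alpha .$$ For $S\in C$ put $$\psi_G(S)=\inf\{G(T):\ T\in C,\ T\llcorner((I\setminus I')\times\mathbb R)=S\llcorner((I\setminus I')\times\mathbb R)\}.$$ **Theorem.** If $u\in SBV(I)$ is a Dirichlet minimizer of $F$ in $I'$, then $\Gamma_u\in C$ and $$\psi_G(\Gamma_u)=G(\Gamma_u)=F(u),$$ that is, $\Gamma_u$ minimizes $G$ among all $T\in C$ that agree with $\Gamma_u$ on $(I\setminus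 I')\times\mathbb R$. -/

import Mathlib

open MeasureTheory Set Filter Topology
open scoped ENNReal NNReal

noncomputable section

namespace MumfordShah

/-! ### SBV functions of one variable -/

/-- `u ∈ L¹(a,b)` and the distributional derivative of `u` on `(a,b)` is the finite measure
`v dx + ∑ₓ J(x) δₓ` with `v ∈ L¹(a,b)`. -/
def HasSBVDerivative (a b : ℝ) (u v J : ℝ → ℝ) : Prop :=
  IntegrableOn u (Ioo a b) ∧ IntegrableOn v (Ioo a b) ∧
  Summable J ∧ (∀ x, x ∉ Ioo a b → J x = 0) ∧
  ∀ η : ℝ → ℝ, ContDiff ℝ ((⊤ : ℕ∞) : WithTop ℕ∞) η → HasCompactSupport η → tsupport η ⊆ Ioo a b →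
    ∫ x in Ioo a b, u x * deriv η x = -((∫ x in Ioo a b, v x * η x) + ∑' x, J x * η x)

/-- `u ∈ SBV(a,b)`: the distributional derivative is a finite measure without Cantor part,
that is, the sum of an absolutely continuous and a purely atomic measure. -/
def MemSBV (a b : ℝ) (u : ℝ → ℝ) : Prop :=
  ∃ v J : ℝ → ℝ, HasSBVDerivative a b u v J

open Classical in
/-- The approximate derivative `u'`: the density of the absolutely continuous part of the
distributional derivative, which is unique up to a null set (`0` if `u` is not in `SBV`). -/
def sbvDeriv (a b : ℝ) (u : ℝ → ℝ) : ℝ → ℝ :=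
  if h : MemSBV a b u then h.choose else 0

/-- The left trace `uˡ(x)`. -/
def leftTrace (u : ℝ → ℝ) (x : ℝ) : ℝ :=
  limUnder (𝓝[>] (0 : ℝ)) fun r => ⨍ y in Ioo (x - r) x, u y

/-- The right trace `uʳ(x)`. -/
def rightTrace (u : ℝ → ℝ) (x : ℝ) : ℝ :=
  limUnder (𝓝[>] (0 : ℝ)) fun r => ⨍ y in Ioo x (x + r), u y

/-- The singular set `S_u`: the points of `(a,b)` at which `u` has no approximate limit. -/
def singularSet (a b : ℝ) (u : ℝ → ℝ) : Set ℝ :=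
  {x | x ∈ Ioo a b ∧
    ¬ ∃ z : ℝ, Tendsto (fun r => ⨍ y in Ioo (x - r) (x + r), |u y - z|) (𝓝[>] (0 : ℝ)) (𝓝 0)}

/-- `F(u) = ∫ |u'|² dx + β ∫ |u - g|² dx + α ℋ⁰(S_u)`, the integrals being over `(a,b)`. -/
def energy (a b α β : ℝ) (g u : ℝ → ℝ) : ℝ≥0∞ :=
  (∫⁻ x in Ioo a b, ENNReal.ofReal (sbvDeriv a b u x ^ 2))
    + ENNReal.ofReal β * (∫⁻ x in Ioo a b, ENNReal.ofReal ((u x - g x) ^ 2))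
    + ENNReal.ofReal α * ((singularSet a b u).encard : ℝ≥0∞)

/-- `u ∈ SBV(a,b)` is a Dirichlet minimizer of `F` in `(c,d)`. -/
def IsDirichletMinimizer (a b c d α β : ℝ) (g u : ℝ → ℝ) : Prop :=
  MemSBV a b u ∧ ∀ v : ℝ → ℝ, MemSBV a b v →
    (∀ᵐ x ∂(volume.restrict (Ioo a b \ Ioo c d)), u x = v x) →
    energy a b α β g u ≤ energy a b α β g v

/-! ### One-dimensional rectifiable currents in `(a,b) × ℝ` -/

/-- The plane of points `(x,t)`, with `x` the coordinate `0` and `t` the coordinate `1`. -/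
abbrev Plane : Type := EuclideanSpace ℝ (Fin 2)

/-- The product `A × ℝ`. -/
def cylinder (A : Set ℝ) : Set Plane := {p | p 0 ∈ A}

/-- A triple `(𝓜, θ, ξ)` of a set, a multiplicity and a field of directions. -/
structure CurrentTriple where
  carrier : Set Plane
  mult : Plane → ℝ
  orient : Plane → Plane

namespace CurrentTriple

/-- The triple is a rectifiable current of finite mass in `(a,b) × ℝ` with positive real
multiplicity: the carrier is covered, up to an `ℋ¹`-null set, by countably many Lipschitz images
of subsets of the line, and the unit field `ξ` is almost everywhere tangent to these. -/
structure IsRectifiable (a b : ℝ) (T : CurrentTriple) : Prop where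
  measurableSet : MeasurableSet T.carrier
  subset : T.carrier ⊆ cylinder (Ioo a b)
  mult_pos : ∀ p ∈ T.carrier, 0 < T.mult p
  mult_integrable : IntegrableOn T.mult T.carrier (μH[1])
  orient_measurable : AEStronglyMeasurable T.orient ((μH[1] : Measure Plane).restrict T.carrier)
  orient_unit : ∀ᵐ p ∂((μH[1] : Measure Plane).restrict T.carrier), ‖T.orient p‖ = 1
  exists_cover : ∃ (f : ℕ → ℝ → Plane) (s : ℕ → Set ℝ) (L : ℕ → ℝ≥0),
    (∀ n, MeasurableSet (s n) ∧ LipschitzOnWith (L n) (f n) (s n) ∧ f n '' s n ⊆ T.carrier ∧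
      ∀ᵐ τ ∂(volume.restrict (s n)),
        derivWithin (f n) (s n) τ ∈ Submodule.span ℝ {T.orient (f n τ)}) ∧
    (μH[1] : Measure Plane) (T.carrier \ ⋃ n, f n '' s n) = 0

/-- The restriction `T ⌞ A`. -/
def restrict (T : CurrentTriple) (A : Set Plane) : CurrentTriple where
  carrier := T.carrier ∩ A
  mult := T.mult
  orient := T.orient

/-- The action `T(ω) = ∫_𝓜 ⟨ω, ξ⟩ θ dℋ¹` on a `1`-form `ω = ω₀ dx + ω₁ dt`, which is
identified with the vector field `(ω₀, ω₁)`. -/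
def action (T : CurrentTriple) (ω : Plane → Plane) : ℝ :=
  ∫ p in T.carrier, inner ℝ (ω p) (T.orient p) * T.mult p ∂(μH[1])

/-- The normal `ν_T = -⋆ξ`, where `⋆(ξ₀, ξ₁) = (-ξ₁, ξ₀)`. -/
def normal (T : CurrentTriple) (p : Plane) : Plane := !₂[T.orient p 1, -T.orient p 0]

end CurrentTriple

/-- Smooth `1`-forms with compact support in `(a,b) × ℝ`. -/
def IsTestForm (a b : ℝ) (ω : Plane → Plane) : Prop :=
  ContDiff ℝ ((⊤ : ℕ∞) : WithTop ℕ∞) ω ∧ HasCompactSupport ω ∧ tsupport ω ⊆ cylinder (Ioo a b)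

/-- Two triples define the same current in `(a,b) × ℝ`. -/
def SameCurrent (a b : ℝ) (S T : CurrentTriple) : Prop :=
  ∀ ω : Plane → Plane, IsTestForm a b ω → S.action ω = T.action ω

/-- The extended graph `{(x,t) : u⁻(x) ≤ t ≤ u⁺(x)}` of `u` over `(a,b)`. -/
def extendedGraph (a b : ℝ) (u : ℝ → ℝ) : Set Plane :=
  {p | p 0 ∈ Ioo a b ∧ min (leftTrace u (p 0)) (rightTrace u (p 0)) ≤ p 1 ∧
    p 1 ≤ max (leftTrace u (p 0)) (rightTrace u (p 0))}

open Classical in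
/-- The current `Γ_u`: the extended graph with multiplicity one, oriented by `(1, u')/√(1 + u'²)`
outside `S_u` and from `uˡ` towards `uʳ` on the vertical segments over `S_u`. -/
def graphCurrent (a b : ℝ) (u : ℝ → ℝ) : CurrentTriple where
  carrier := extendedGraph a b u
  mult := fun _ => 1
  orient := fun p =>
    if p 0 ∈ singularSet a b u then
      !₂[0, Real.sign (rightTrace u (p 0) - leftTrace u (p 0))]
    else
      (Real.sqrt (1 + sbvDeriv a b u (p 0) ^ 2))⁻¹ • !₂[1, sbvDeriv a b u (p 0)]

/-- The cone `C` of the finite positive combinations `∑ λᵢ Γ_{uᵢ}` of SBV graphs. -/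
def graphCone (a b : ℝ) : Set CurrentTriple :=
  {T | T.IsRectifiable a b ∧
    ∃ (k : ℕ) (lam : Fin k → ℝ) (u : Fin k → ℝ → ℝ),
      (∀ i, 0 < lam i) ∧ (∀ i, MemSBV a b (u i)) ∧
      ∀ ω : Plane → Plane, IsTestForm a b ω →
        T.action ω = ∑ i, lam i * (graphCurrent a b (u i)).action ω}

/-! ### The lifted functional -/

/-- The set `K` of the Borel fields `φ = (φˣ, φᵗ)` with
`φᵗ(x,t) ≥ |φˣ(x,t)|²/4 - β (t - g(x))²` and `|∫_{t₁}^{t₂} φˣ(x,t) dt| ≤ α` for all `x` in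
`(a,b)` and all real `t`, `t₁`, `t₂`. -/
def admissibleFields (a b α β : ℝ) (g : ℝ → ℝ) : Set (Plane → Plane) :=
  {φ | Measurable φ ∧
    (∀ x ∈ Ioo a b, ∀ t : ℝ,
      (φ !₂[x, t] 0) ^ 2 / 4 - β * (t - g x) ^ 2 ≤ φ !₂[x, t] 1) ∧
    ∀ x ∈ Ioo a b, ∀ t₁ t₂ : ℝ,
      IntervalIntegrable (fun t => φ !₂[x, t] 0) volume t₁ t₂ ∧
      |∫ t in t₁..t₂, φ !₂[x, t] 0| ≤ α}

/-- The integral `∫ f dμ` in the extended reals, as the integral of the positive part minus the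
integral of the negative part; it is `-∞` as soon as the latter is infinite, so that fields
without a meaningful integral do not contribute to a supremum. -/
def extIntegral (μ : Measure Plane) (f : Plane → ℝ) : EReal :=
  ((∫⁻ p, ENNReal.ofReal (f p) ∂μ : ℝ≥0∞) : EReal)
    - ((∫⁻ p, ENNReal.ofReal (-f p) ∂μ : ℝ≥0∞) : EReal)

/-- The lift `G(T) = sup_{φ ∈ K} ∫_𝓜 θ ⟨φ, ν_T⟩ dℋ¹`. -/
def lift (a b α β : ℝ) (g : ℝ → ℝ) (T : CurrentTriple) : EReal :=
  ⨆ φ ∈ admissibleFields a b α β g,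
    extIntegral ((μH[1] : Measure Plane).restrict T.carrier)
      fun p => T.mult p * inner ℝ (φ p) (T.normal p)

/-- `ψ_G(S)`, the infimum of `G` over the `T ∈ C` whose restriction to `((a,b) ∖ (c,d)) × ℝ`
is the same current as that of `S`. -/
def liftedMin (a b c d α β : ℝ) (g : ℝ → ℝ) (S : CurrentTriple) : EReal :=
  ⨅ T ∈ {T | T ∈ graphCone a b ∧
      SameCurrent a b (T.restrict (cylinder (Ioo a b \ Ioo c d)))
        (S.restrict (cylinder (Ioo a b \ Ioo c d)))},
    lift a b α β g T

end MumfordShah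

end

noncomputable section

namespace MumfordShah

/-! ### Good representatives of SBV functions -/

/-! The inequality G(Γ_u) ≤ F(u) is a calibration estimate. For φ in K, completing a square gives
φˣu' - φᵗ ≤ u'² + β(u-g)² along the graph, and each vertical segment contributes at most α
(`lift_graphCurrent_le`).

The substance is the converse, F(u) ≤ G(T) for every competitor T = ∑ λᵢ Γ_{uᵢ}. Agreement with Γ_u
over a set of positive measure, together with λᵢ > 0, forces ∑ λᵢ = 1 and uᵢ = u almost everywhere
on that set (`eq_of_sameCurrent`). It therefore suffices, whenever G(T) < C, to splice the uᵢ into a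
single W in SBV with F(W) ≤ C whose value at almost every x is one of the uᵢ(x): such a W is
admissible in the minimality of u.

Lower bounds for G(T) come from explicit fields. The finitely many graphs meet a vertical line in a
null set (up to jump segments), so φˣ = 2uᵢ' can be prescribed on the graphs without touching the
integral constraint. On finitely many vertical lines φˣ is instead the derivative in t of a
Lipschitz function with values in [0,α]. This yields (`exists_calibrating_field`,
`energy_add_potential_le`) ∑ᵢ λᵢ ∫ (uᵢ'² + β(uᵢ-g)²) + ∑ₓ ∑ᵢ λᵢ (f(x,uᵢʳ(x)) - f(x,uᵢˡ(x))) ≤ C for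
every finite set of points x and all potentials f(x,·) with values in [0,α], the dual form of a
transport problem in which every displacement costs α.

The left side depends only on the weighted point masses ∑ λᵢ δ_{uᵢ(x)} in each fibre, so the uᵢ may
be replaced by the quantiles of these masses (`exists_pathFamily`). Quantiles are ordered; hence
wherever one of them jumps a step function gains at least a fixed amount (`exists_potential`), and
they jump at finitely many points only (`finite_setOf_ne`). Between these points they are absolutely
continuous.

It remains to splice the quantiles at finitely many points, which is dynamic programming
(`exists_optimal_selections`). A path may change branch at a jump point and pays α if its value
jumps. The cheapest cost of reaching a point and leaving it at height t, minus its least possible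
part, lies in [0,α] and is used as the potential f. Each quantile is then replaced by a spliced path
whose energy is at most its own plus the increments of f. Averaging with weights of sum one gives a
spliced path of energy at most C (`PathFamily.exists_energy_le`). -/

/-- The primitive of `v` on `(a,b)`, extended by constants. -/
def acPart (a b : ℝ) (v : ℝ → ℝ) (x : ℝ) : ℝ := ∫ t in a..x, (Ioo a b).indicator v t

/-- The left-continuous pure jump function with jumps `J`. -/
def jumpLeft (J : ℝ → ℝ) (x : ℝ) : ℝ := ∑' z, (Iio x).indicator J z

/-- The right-continuous pure jump function with jumps `J`. -/
def jumpRight (J : ℝ → ℝ) (x : ℝ) : ℝ := ∑' z, (Iic x).indicator J z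

/-- The left-continuous function with derivative `v dx + ∑ J δ`. -/
def leftRep (a b C : ℝ) (v J : ℝ → ℝ) (x : ℝ) : ℝ := C + acPart a b v x + jumpLeft J x

/-- The right-continuous function with derivative `v dx + ∑ J δ`. -/
def rightRep (a b C : ℝ) (v J : ℝ → ℝ) (x : ℝ) : ℝ := C + acPart a b v x + jumpRight J x

/-- The total variation measure of the jump part. -/
def jumpMeasure (J : ℝ → ℝ) : Measure ℝ :=
  Measure.sum fun z => ENNReal.ofReal |J z| • Measure.dirac z

lemma jumpMeasure_apply (J : ℝ → ℝ) {s : Set ℝ} (hs : MeasurableSet s) :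
    jumpMeasure J s = ∑' z, ENNReal.ofReal (s.indicator (fun z => |J z|) z) := by
  rw [jumpMeasure, Measure.sum_apply _ hs]
  refine tsum_congr fun z => ?_
  by_cases hz : z ∈ s <;> simp [hs, hz]

lemma jumpMeasure_eq_ofReal {J : ℝ → ℝ} (hJ : Summable J) {s : Set ℝ} (hs : MeasurableSet s) :
    jumpMeasure J s = ENNReal.ofReal (∑' z, s.indicator (fun z => |J z|) z) := by
  rw [jumpMeasure_apply J hs, ENNReal.ofReal_tsum_of_nonneg]
  · exact fun z => indicator_nonneg (fun _ _ => abs_nonneg _) _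
  · exact hJ.abs.indicator s

lemma isFiniteMeasure_jumpMeasure {J : ℝ → ℝ} (hJ : Summable J) :
    IsFiniteMeasure (jumpMeasure J) :=
  ⟨by rw [jumpMeasure_eq_ofReal hJ MeasurableSet.univ]; exact ENNReal.ofReal_lt_top⟩

lemma jumpMeasure_real {J : ℝ → ℝ} (hJ : Summable J) {s : Set ℝ} (hs : MeasurableSet s) :
    (jumpMeasure J).real s = ∑' z, s.indicator (fun z => |J z|) z := by
  rw [Measure.real, jumpMeasure_eq_ofReal hJ hs, ENNReal.toReal_ofReal]
  exact tsum_nonneg fun z => indicator_nonneg (fun _ _ => abs_nonneg _) _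

lemma jumpMeasure_of_forall_eq_zero {J : ℝ → ℝ} {s : Set ℝ} (hs : MeasurableSet s)
    (h : ∀ x ∈ s, J x = 0) : jumpMeasure J s = 0 := by
  rw [jumpMeasure_apply J hs, ENNReal.tsum_eq_zero]
  intro z
  by_cases hz : z ∈ s <;> simp [hz, h]

lemma abs_tsum_indicator_le {J : ℝ → ℝ} (hJ : Summable J) {s : Set ℝ} (hs : MeasurableSet s) :
    |∑' z, s.indicator J z| ≤ (jumpMeasure J).real s := by
  rw [jumpMeasure_real hJ hs]
  have h : Summable fun z => ‖s.indicator J z‖ := (hJ.indicator s).norm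
  refine (norm_tsum_le_tsum_norm h).trans (le_of_eq (tsum_congr fun z => ?_))
  rw [norm_indicator_eq_indicator_norm]; rfl

lemma jumpLeft_sub_jumpLeft {J : ℝ → ℝ} (hJ : Summable J) {x y : ℝ} (hxy : x ≤ y) :
    jumpLeft J y - jumpLeft J x = ∑' z, (Ico x y).indicator J z := by
  rw [jumpLeft, jumpLeft, ← (hJ.indicator _).tsum_sub (hJ.indicator _)]
  refine tsum_congr fun z => ?_
  by_cases h1 : z < x
  · simp [indicator, h1, h1.trans_le hxy, not_le.2 h1]
  · by_cases h2 : z < y <;> simp [indicator, h1, h2, not_lt.1 h1]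

lemma jumpRight_sub_jumpLeft {J : ℝ → ℝ} (hJ : Summable J) (x : ℝ) :
    jumpRight J x - jumpLeft J x = J x := by
  rw [jumpLeft, jumpRight, ← (hJ.indicator _).tsum_sub (hJ.indicator _)]
  rw [tsum_eq_single x]
  · simp [indicator]
  · intro z hz
    rcases lt_or_gt_of_ne hz with h | h
    · simp [indicator, h, h.le]
    · simp [indicator, not_le.2 h, not_lt.2 h.le]

lemma tendsto_jumpLeft_left {J : ℝ → ℝ} (hJ : Summable J) (x : ℝ) :
    Tendsto (jumpLeft J) (𝓝[<] x) (𝓝 (jumpLeft J x)) := by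
  refine tendsto_tsum_of_dominated_convergence (bound := fun z => |J z|) hJ.abs ?_ ?_
  · intro z
    refine tendsto_const_nhds.congr' ?_
    by_cases hz : z < x
    · filter_upwards [Ioo_mem_nhdsLT hz] with y hy
      simp [indicator, hz, hy.1]
    · filter_upwards [self_mem_nhdsWithin] with y hy
      have : ¬ z < y := fun h => hz (h.trans hy)
      simp [indicator, hz, this]
  · filter_upwards with y z
    exact norm_indicator_le_norm_self _ _

lemma tendsto_jumpLeft_right {J : ℝ → ℝ} (hJ : Summable J) (x : ℝ) :
    Tendsto (jumpLeft J) (𝓝[>] x) (𝓝 (jumpRight J x)) := by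
  refine tendsto_tsum_of_dominated_convergence (bound := fun z => |J z|) hJ.abs ?_ ?_
  · intro z
    refine tendsto_const_nhds.congr' ?_
    by_cases hz : z ≤ x
    · filter_upwards [self_mem_nhdsWithin] with y hy
      have : z < y := hz.trans_lt hy
      simp [indicator, hz, this]
    · filter_upwards [Ioo_mem_nhdsGT (not_le.1 hz)] with y hy
      simp [indicator, hz, not_lt.2 hy.2.le]
  · filter_upwards with y z
    exact norm_indicator_le_norm_self _ _

lemma jumpLeft_mono {J : ℝ → ℝ} (hJ : Summable J) (h0 : ∀ x, 0 ≤ J x) : Monotone (jumpLeft J) := by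
  intro x y hxy
  have := jumpLeft_sub_jumpLeft hJ hxy
  have h2 : 0 ≤ ∑' z, (Ico x y).indicator J z :=
    tsum_nonneg fun z => indicator_nonneg (fun _ _ => h0 _) _
  linarith

lemma measurable_jumpLeft {J : ℝ → ℝ} (hJ : Summable J) : Measurable (jumpLeft J) := by
  have h1 : Summable fun z => J z + |J z| := hJ.add hJ.abs
  -- Both `J + |J|` and `|J|` are nonnegative, so this writes the jump function as a difference of
  -- monotone functions.
  have e : jumpLeft J = fun x => jumpLeft (fun z => J z + |J z|) x - jumpLeft (fun z => |J z|) x := by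
    funext x
    rw [jumpLeft, jumpLeft, jumpLeft, ← (h1.indicator _).tsum_sub (hJ.abs.indicator _)]
    refine tsum_congr fun z => ?_
    by_cases h : z < x <;> simp [indicator, h]
  rw [e]
  exact (jumpLeft_mono h1 fun x => by linarith [neg_abs_le (J x)]).measurable.sub
    (jumpLeft_mono hJ.abs fun x => abs_nonneg _).measurable

lemma integrable_indicator_Ioo {a b : ℝ} {v : ℝ → ℝ} (hv : IntegrableOn v (Ioo a b)) :
    Integrable ((Ioo a b).indicator v) := hv.integrable_indicator measurableSet_Ioo

lemma continuous_acPart {a b : ℝ} {v : ℝ → ℝ} (hv : IntegrableOn v (Ioo a b)) :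
    Continuous (acPart a b v) :=
  intervalIntegral.continuous_primitive
    (fun _ _ => (integrable_indicator_Ioo hv).intervalIntegrable) _

lemma acPart_sub {a b : ℝ} {v : ℝ → ℝ} (hv : IntegrableOn v (Ioo a b)) (x y : ℝ) :
    acPart a b v y - acPart a b v x = ∫ t in x..y, (Ioo a b).indicator v t :=
  intervalIntegral.integral_interval_sub_left
    (integrable_indicator_Ioo hv).intervalIntegrable (integrable_indicator_Ioo hv).intervalIntegrable

lemma tendsto_leftRep_left {a b C : ℝ} {v J : ℝ → ℝ} (hv : IntegrableOn v (Ioo a b))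
    (hJ : Summable J) (x : ℝ) :
    Tendsto (leftRep a b C v J) (𝓝[<] x) (𝓝 (leftRep a b C v J x)) :=
  ((((continuous_acPart hv).tendsto x).mono_left nhdsWithin_le_nhds).const_add C).add
    (tendsto_jumpLeft_left hJ x)

lemma tendsto_leftRep_right {a b C : ℝ} {v J : ℝ → ℝ} (hv : IntegrableOn v (Ioo a b))
    (hJ : Summable J) (x : ℝ) :
    Tendsto (leftRep a b C v J) (𝓝[>] x) (𝓝 (rightRep a b C v J x)) :=
  ((((continuous_acPart hv).tendsto x).mono_left nhdsWithin_le_nhds).const_add C).add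
    (tendsto_jumpLeft_right hJ x)

lemma rightRep_sub_leftRep {a b C : ℝ} {v J : ℝ → ℝ} (hJ : Summable J) (x : ℝ) :
    rightRep a b C v J x - leftRep a b C v J x = J x := by
  rw [rightRep, leftRep, ← jumpRight_sub_jumpLeft hJ x]; ring

lemma measurable_leftRep {a b C : ℝ} {v J : ℝ → ℝ} (hv : IntegrableOn v (Ioo a b))
    (hJ : Summable J) : Measurable (leftRep a b C v J) :=
  ((continuous_acPart hv).measurable.const_add C).add (measurable_jumpLeft hJ)

lemma countable_support_of_summable {J : ℝ → ℝ} (hJ : Summable J) : {x | J x ≠ 0}.Countable :=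
  hJ.countable_support

lemma measurable_of_summable {J : ℝ → ℝ} (hJ : Summable J) : Measurable J :=
  measurable_const.measurable_of_countable_ne (f := fun _ => (0 : ℝ))
    (by simpa [ne_comm] using countable_support_of_summable hJ)

lemma measurable_rightRep {a b C : ℝ} {v J : ℝ → ℝ} (hv : IntegrableOn v (Ioo a b))
    (hJ : Summable J) : Measurable (rightRep a b C v J) := by
  have e : rightRep a b C v J = fun x => leftRep a b C v J x + J x := by
    funext x; rw [← rightRep_sub_leftRep (a := a) (b := b) (C := C) (v := v) hJ x]; ring
  rw [e]
  exact (measurable_leftRep hv hJ).add (measurable_of_summable hJ)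

/-- Increments of the representative are controlled by the total variation measure. -/
lemma abs_leftRep_sub_le {a b C : ℝ} {v J : ℝ → ℝ} (hv : IntegrableOn v (Ioo a b))
    (hJ : Summable J) {x y : ℝ} (hxy : x ≤ y) :
    |leftRep a b C v J y - leftRep a b C v J x| ≤
      (∫ t in x..y, |(Ioo a b).indicator v t|) + (jumpMeasure J).real (Ico x y) := by
  have e : leftRep a b C v J y - leftRep a b C v J x =
      (acPart a b v y - acPart a b v x) + (jumpLeft J y - jumpLeft J x) := by
    rw [leftRep, leftRep]; ring
  rw [e, acPart_sub hv, jumpLeft_sub_jumpLeft hJ hxy]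
  refine (abs_add_le _ _).trans (add_le_add ?_ (abs_tsum_indicator_le hJ measurableSet_Ico))
  exact intervalIntegral.abs_integral_le_integral_abs hxy

lemma abs_leftRep_le {a b C : ℝ} {v J : ℝ → ℝ} (hv : IntegrableOn v (Ioo a b))
    (hJ : Summable J) (x : ℝ) :
    |leftRep a b C v J x| ≤ |C| + (∫ t, |(Ioo a b).indicator v t|) + (jumpMeasure J).real univ := by
  have := isFiniteMeasure_jumpMeasure hJ
  rw [leftRep]
  refine (abs_add_le _ _).trans (add_le_add ((abs_add_le _ _).trans (add_le_add le_rfl ?_)) ?_)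
  · rw [acPart, ← Real.norm_eq_abs]
    refine intervalIntegral.norm_integral_le_integral_norm_uIoc.trans ?_
    exact setIntegral_le_integral (integrable_indicator_Ioo hv).norm
      (Eventually.of_forall fun _ => norm_nonneg _)
  · exact (abs_tsum_indicator_le hJ measurableSet_Iio).trans (measureReal_mono (subset_univ _))

/-! ### Almost everywhere differentiability -/

/-- The jump measure lives on a countable set, so it is singular and its density with respect to
Lebesgue measure vanishes almost everywhere; Vitali differentiation along one-sided intervals gives
the limits. -/
lemma ae_tendsto_jumpMeasure_div {J : ℝ → ℝ} (hJ : Summable J) :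
    ∀ᵐ x, Tendsto (fun y => (jumpMeasure J).real (Icc x y) / (y - x)) (𝓝[>] x) (𝓝 0) ∧
      Tendsto (fun y => (jumpMeasure J).real (Icc y x) / (x - y)) (𝓝[<] x) (𝓝 0) := by
  have := isFiniteMeasure_jumpMeasure hJ
  have hs : jumpMeasure J ⟂ₘ volume := by
    refine ⟨{x | J x ≠ 0}ᶜ, (countable_support_of_summable hJ).measurableSet.compl, ?_, ?_⟩
    · exact jumpMeasure_of_forall_eq_zero
        (countable_support_of_summable hJ).measurableSet.compl (fun x hx => by simpa using hx)
    · rw [compl_compl]; exact (countable_support_of_summable hJ).measure_zero _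
  filter_upwards [VitaliFamily.ae_tendsto_rnDeriv
    (IsUnifLocDoublingMeasure.vitaliFamily (volume : Measure ℝ) 1) (jumpMeasure J),
    hs.rnDeriv_ae_eq_zero] with x hx hx0
  rw [hx0] at hx
  have key := (ENNReal.tendsto_toReal (by simp : (0 : ℝ → ℝ≥0∞) x ≠ ∞)).comp
    (hx.comp (Real.tendsto_Icc_vitaliFamily_right x))
  have key2 := (ENNReal.tendsto_toReal (by simp : (0 : ℝ → ℝ≥0∞) x ≠ ∞)).comp
    (hx.comp (Real.tendsto_Icc_vitaliFamily_left x))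
  constructor
  · refine key.congr' ?_
    filter_upwards [self_mem_nhdsWithin] with y hy
    simp only [Function.comp, ENNReal.toReal_div, Real.volume_Icc, Measure.real]
    rw [ENNReal.toReal_ofReal (by simpa using le_of_lt hy)]
  · refine key2.congr' ?_
    filter_upwards [self_mem_nhdsWithin] with y hy
    simp only [Function.comp, ENNReal.toReal_div, Real.volume_Icc, Measure.real]
    rw [ENNReal.toReal_ofReal (by simpa using le_of_lt hy)]

lemma ae_hasDerivAt_jumpLeft {J : ℝ → ℝ} (hJ : Summable J) :
    ∀ᵐ x, HasDerivAt (jumpLeft J) 0 x := by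
  have := isFiniteMeasure_jumpMeasure hJ
  filter_upwards [ae_tendsto_jumpMeasure_div hJ] with x hx
  rw [hasDerivAt_iff_tendsto_slope_left_right]
  constructor
  · refine squeeze_zero_norm' ?_ hx.2
    filter_upwards [self_mem_nhdsWithin] with y hy
    have hy' : y < x := hy
    rw [slope_def_field, norm_div, Real.norm_eq_abs, Real.norm_eq_abs, abs_sub_comm,
      abs_sub_comm y x, abs_of_pos (sub_pos.2 hy'), jumpLeft_sub_jumpLeft hJ hy'.le]
    have : 0 ≤ x - y := by linarith
    gcongr
    exact (abs_tsum_indicator_le hJ measurableSet_Ico).trans (measureReal_mono Ico_subset_Icc_self)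
  · refine squeeze_zero_norm' ?_ hx.1
    filter_upwards [self_mem_nhdsWithin] with y hy
    have hy' : x < y := hy
    rw [slope_def_field, norm_div, Real.norm_eq_abs, Real.norm_eq_abs,
      abs_of_pos (sub_pos.2 hy'), jumpLeft_sub_jumpLeft hJ hy'.le]
    have : 0 ≤ y - x := by linarith
    gcongr
    exact (abs_tsum_indicator_le hJ measurableSet_Ico).trans (measureReal_mono Ico_subset_Icc_self)

lemma ae_hasDerivAt_leftRep {a b C : ℝ} {v J : ℝ → ℝ} (hv : IntegrableOn v (Ioo a b))
    (hJ : Summable J) : ∀ᵐ x, x ∈ Ioo a b → HasDerivAt (leftRep a b C v J) (v x) x := by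
  filter_upwards [ae_hasDerivAt_jumpLeft hJ,
    _root_.LocallyIntegrable.ae_hasDerivAt_integral
      (integrable_indicator_Ioo hv).locallyIntegrable] with x h1 h2 hx
  have h := ((h2 a).const_add C).add h1
  rw [indicator_of_mem hx, add_zero] at h
  exact h

/-! ### The distributional derivative of the representatives -/

lemma eq_zero_of_tsupport_subset_Ioo {a b : ℝ} {η : ℝ → ℝ} (h : tsupport η ⊆ Ioo a b) {x : ℝ}
    (hx : x ∉ Ioo a b) : η x = 0 :=
  image_eq_zero_of_notMem_tsupport fun hx' => hx (h hx')

lemma integral_acPart_mul_deriv {a b : ℝ} (hab : a < b) {v : ℝ → ℝ}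
    (hv : IntegrableOn v (Ioo a b)) {η : ℝ → ℝ}
    (hη : ContDiff ℝ ((⊤ : ℕ∞) : WithTop ℕ∞) η) (hs : tsupport η ⊆ Ioo a b) :
    ∫ x in Ioo a b, acPart a b v x * deriv η x = -∫ x in Ioo a b, v x * η x := by
  have hi := (integrable_indicator_Ioo hv).intervalIntegrable (a := a) (b := b)
  have h1 : AbsolutelyContinuousOnInterval (acPart a b v) a b :=
    hi.absolutelyContinuousOnInterval_intervalIntegral (by simp)
  have h2 : AbsolutelyContinuousOnInterval η a b :=
    (hη.of_le (by exact_mod_cast le_top)).contDiffOn.absolutelyContinuousOnInterval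
  have h := h1.integral_mul_deriv_eq_deriv_mul h2
  rw [eq_zero_of_tsupport_subset_Ioo hs (x := a) (by simp),
    eq_zero_of_tsupport_subset_Ioo hs (x := b) (by simp)] at h
  rw [← integral_Ioc_eq_integral_Ioo, ← integral_Ioc_eq_integral_Ioo,
    ← intervalIntegral.integral_of_le hab.le, ← intervalIntegral.integral_of_le hab.le, h]
  simp only [mul_zero, sub_zero, zero_sub, neg_inj]
  rw [intervalIntegral.integral_of_le hab.le, intervalIntegral.integral_of_le hab.le,
    integral_Ioc_eq_integral_Ioo, integral_Ioc_eq_integral_Ioo]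
  refine setIntegral_congr_ae measurableSet_Ioo ?_
  filter_upwards [_root_.LocallyIntegrable.ae_hasDerivAt_integral
      (integrable_indicator_Ioo hv).locallyIntegrable] with x hx hxI
  have := (hx a).deriv
  rw [indicator_of_mem hxI] at this
  change deriv (fun x => ∫ t in a..x, (Ioo a b).indicator v t) x * _ = _
  rw [this]

/-- Each atom acts as a Heaviside function, for which ∫_z^b η' = -η(z). Summability of `J` justifies
exchanging sum and integral; the sum runs over the support of `J`, since that exchange needs a
countable index. -/
lemma integral_jumpLeft_mul_deriv {a b : ℝ} {J : ℝ → ℝ}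
    (hJ : Summable J) (hJ0 : ∀ x, x ∉ Ioo a b → J x = 0) {η : ℝ → ℝ}
    (hη : ContDiff ℝ ((⊤ : ℕ∞) : WithTop ℕ∞) η) (hs : tsupport η ⊆ Ioo a b) :
    ∫ x in Ioo a b, jumpLeft J x * deriv η x = -∑' x, J x * η x := by
  have hD := countable_support_of_summable hJ
  have : Countable {x | J x ≠ 0} := hD.to_subtype
  have hη' : Continuous (deriv η) := hη.continuous_deriv (by exact_mod_cast le_top)
  have hint : IntegrableOn (deriv η) (Ioo a b) :=
    (hη'.continuousOn.integrableOn_compact isCompact_Icc).mono_set Ioo_subset_Icc_self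
  set F : {x | J x ≠ 0} → ℝ → ℝ := fun z x => (Ioi (z : ℝ)).indicator (fun x => J z * deriv η x) x
    with hF
  have hFi : ∀ z, Integrable (F z) (volume.restrict (Ioo a b)) := fun z =>
    (hint.const_mul _).indicator measurableSet_Ioi
  have hFs : Summable fun z => ∫ x in Ioo a b, ‖F z x‖ := by
    refine Summable.of_nonneg_of_le (fun z => integral_nonneg fun x => norm_nonneg _) (fun z => ?_)
      ((hJ.abs.mul_right (∫ x in Ioo a b, |deriv η x|)).subtype {x | J x ≠ 0})
    simp only [Function.comp]
    rw [← integral_const_mul]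
    refine integral_mono (hFi z).norm (hint.abs.const_mul _) fun x => ?_
    refine (norm_indicator_le_norm_self _ _).trans (le_of_eq ?_)
    simp
  have hsum := hasSum_integral_of_summable_integral_norm hFi hFs
  have e1 : ∀ x, ∑' z, F z x = jumpLeft J x * deriv η x := by
    intro x
    rw [jumpLeft, ← tsum_mul_right, ← tsum_subtype_eq_of_support_subset (s := {x | J x ≠ 0})]
    · refine tsum_congr fun z => ?_
      by_cases h : (z : ℝ) < x <;> simp [hF, indicator, h]
    · intro z hz hz0
      refine hz ?_
      have : J z = 0 := by simpa using hz0
      simp [indicator, this]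
  have e2 : ∀ z : {x | J x ≠ 0}, ∫ x in Ioo a b, F z x = -(J z * η z) := by
    intro z
    have hz : (z : ℝ) ∈ Ioo a b := by
      by_contra h; exact z.2 (hJ0 _ h)
    rw [hF, setIntegral_indicator measurableSet_Ioi]
    have : Ioo a b ∩ Ioi (z : ℝ) = Ioo (z : ℝ) b := by
      ext x; simp only [mem_inter_iff, mem_Ioo, mem_Ioi]
      exact ⟨fun h => ⟨h.2, h.1.2⟩, fun h => ⟨⟨hz.1.trans h.1, h.2⟩, h.1⟩⟩
    rw [this, integral_const_mul, ← integral_Ioc_eq_integral_Ioo,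
      ← intervalIntegral.integral_of_le hz.2.le, intervalIntegral.integral_deriv_eq_sub]
    · rw [eq_zero_of_tsupport_subset_Ioo hs (x := b) (by simp)]; ring
    · exact fun x _ => (hη.differentiable (by simp)).differentiableAt
    · exact hη'.intervalIntegrable _ _
  simp_rw [e1, e2] at hsum
  rw [← hsum.tsum_eq, tsum_neg, ← tsum_subtype_eq_of_support_subset (s := {x | J x ≠ 0})]
  intro z hz hz0
  exact hz (by have : J z = 0 := by simpa using hz0
               simp [this])

lemma integrableOn_leftRep {a b C : ℝ} {v J : ℝ → ℝ} (hv : IntegrableOn v (Ioo a b))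
    (hJ : Summable J) : IntegrableOn (leftRep a b C v J) (Ioo a b) :=
  Measure.integrableOn_of_bounded (by simp) (measurable_leftRep hv hJ).aestronglyMeasurable
    (Eventually.of_forall fun x => abs_leftRep_le hv hJ x)

lemma integral_leftRep_mul_deriv {a b C : ℝ} (hab : a < b) {v J : ℝ → ℝ}
    (hv : IntegrableOn v (Ioo a b)) (hJ : Summable J) (hJ0 : ∀ x, x ∉ Ioo a b → J x = 0) {η : ℝ → ℝ}
    (hη : ContDiff ℝ ((⊤ : ℕ∞) : WithTop ℕ∞) η) (hs : tsupport η ⊆ Ioo a b) :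
    ∫ x in Ioo a b, leftRep a b C v J x * deriv η x =
      -((∫ x in Ioo a b, v x * η x) + ∑' x, J x * η x) := by
  have hη' : Continuous (deriv η) := hη.continuous_deriv (by exact_mod_cast le_top)
  have hint : IntegrableOn (deriv η) (Ioo a b) :=
    (hη'.continuousOn.integrableOn_compact isCompact_Icc).mono_set Ioo_subset_Icc_self
  have h0 : ∫ x in Ioo a b, C * deriv η x = 0 := by
    rw [integral_const_mul, ← integral_Ioc_eq_integral_Ioo,
      ← intervalIntegral.integral_of_le hab.le, intervalIntegral.integral_deriv_eq_sub]
    · rw [eq_zero_of_tsupport_subset_Ioo hs (x := b) (by simp),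
        eq_zero_of_tsupport_subset_Ioo hs (x := a) (by simp)]; ring
    · exact fun x _ => (hη.differentiable (by simp)).differentiableAt
    · exact hη'.intervalIntegrable _ _
  have i1 : IntegrableOn (fun x => acPart a b v x * deriv η x) (Ioo a b) :=
    (((continuous_acPart hv).mul hη').continuousOn.integrableOn_compact isCompact_Icc).mono_set
      Ioo_subset_Icc_self
  have i2 : IntegrableOn (fun x => jumpLeft J x * deriv η x) (Ioo a b) := by
    refine Integrable.bdd_mul (c := (jumpMeasure J).real univ) hint
      (measurable_jumpLeft hJ).aestronglyMeasurable (Eventually.of_forall fun x => ?_)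
    have := isFiniteMeasure_jumpMeasure hJ
    exact (abs_tsum_indicator_le hJ measurableSet_Iio).trans (measureReal_mono (subset_univ _))
  have i01 : IntegrableOn (fun x => C * deriv η x + acPart a b v x * deriv η x) (Ioo a b) :=
    (hint.const_mul C).add i1
  calc ∫ x in Ioo a b, leftRep a b C v J x * deriv η x
      = ∫ x in Ioo a b, ((C * deriv η x + acPart a b v x * deriv η x)
          + jumpLeft J x * deriv η x) := by
        refine integral_congr_ae (Eventually.of_forall fun x => ?_)
        simp only [leftRep]; ring
    _ = _ := by
        rw [integral_add i01 i2, integral_add (hint.const_mul C) i1, h0,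
          integral_acPart_mul_deriv hab hv hη hs, integral_jumpLeft_mul_deriv hJ hJ0 hη hs]
        ring

/-- A function whose distributional derivative vanishes is constant. -/
lemma ae_eq_const_of_integral_mul_deriv_eq_zero {a b : ℝ} (hab : a < b) {f : ℝ → ℝ}
    (hf : IntegrableOn f (Ioo a b))
    (h : ∀ η : ℝ → ℝ, ContDiff ℝ ((⊤ : ℕ∞) : WithTop ℕ∞) η → HasCompactSupport η →
      tsupport η ⊆ Ioo a b → ∫ x in Ioo a b, f x * deriv η x = 0) :
    ∃ C : ℝ, ∀ᵐ x ∂(volume.restrict (Ioo a b)), f x = C := by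
  obtain ⟨ψ₀, hψ₀, hψ₀c, hψ₀s, hψ₀i⟩ : ∃ ψ : ℝ → ℝ, ContDiff ℝ ((⊤ : ℕ∞) : WithTop ℕ∞) ψ ∧
      HasCompactSupport ψ ∧ tsupport ψ ⊆ Ioo a b ∧ ∫ x, ψ x = 1 := by
    let φ : ContDiffBump ((a + b) / 2) := ⟨(b - a) / 8, (b - a) / 4, by linarith, by linarith⟩
    refine ⟨φ.normed volume, φ.contDiff_normed, φ.hasCompactSupport_normed, ?_, φ.integral_normed⟩
    rw [φ.tsupport_normed_eq, Real.closedBall_eq_Icc]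
    intro x hx
    simp only [mem_Icc, φ] at hx
    constructor <;> linarith [hx.1, hx.2]
  refine ⟨∫ x in Ioo a b, f x * ψ₀ x, ?_⟩
  set C := ∫ x in Ioo a b, f x * ψ₀ x with hC
  have fmul : ∀ ψ : ℝ → ℝ, Continuous ψ → IntegrableOn (fun x => f x * ψ x) (Ioo a b) := by
    intro ψ hψ
    obtain ⟨M, hM⟩ := isCompact_Icc.exists_bound_of_continuousOn (s := Icc a b) hψ.continuousOn
    refine Integrable.mul_bdd (c := M) hf hψ.aestronglyMeasurable ?_
    filter_upwards [ae_restrict_mem measurableSet_Ioo] with x hx using hM x (Ioo_subset_Icc_self hx)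
  have key : ∀ᵐ x, x ∈ Ioo a b → f x - C = 0 := by
    refine IsOpen.ae_eq_zero_of_integral_contDiff_smul_eq_zero isOpen_Ioo ?_ ?_
    · exact (hf.sub (integrableOn_const (by simp))).locallyIntegrableOn
    intro ψ hψ hψc hψs
    set m := ∫ x, ψ x with hm
    -- The du Bois-Reymond device: subtracting a multiple of the bump makes the integral zero, so
    -- that the primitive of χ is again compactly supported and may serve as a test function.
    set χ : ℝ → ℝ := fun x => ψ x - m * ψ₀ x with hχ
    have hχd : ContDiff ℝ ((⊤ : ℕ∞) : WithTop ℕ∞) χ := hψ.sub (contDiff_const.mul hψ₀)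
    set K := tsupport ψ ∪ tsupport ψ₀ with hK
    have hKc : IsCompact K := hψc.union hψ₀c
    have hχK : ∀ x, x ∉ K → χ x = 0 := by
      intro x hx
      simp only [hK, mem_union, not_or] at hx
      simp [hχ, image_eq_zero_of_notMem_tsupport hx.1, image_eq_zero_of_notMem_tsupport hx.2]
    have hKs : K ⊆ Ioo a b := union_subset hψs hψ₀s
    -- A compact interval inside `(a,b)` carrying χ: the primitive vanishes to its left trivially
    -- and to its right because ∫ χ = 0.
    obtain ⟨a', b', ha', hb', hab'⟩ : ∃ a' b', a < a' ∧ b' < b ∧ K ⊆ Icc a' b' := by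
      rcases K.eq_empty_or_nonempty with hKe | hKn
      · exact ⟨(a + b) / 2, (a + b) / 2, by linarith, by linarith, by simp [hKe]⟩
      · refine ⟨sInf K, sSup K, (hKs (hKc.sInf_mem hKn)).1, (hKs (hKc.sSup_mem hKn)).2, ?_⟩
        exact fun x hx => ⟨csInf_le hKc.bddBelow hx, le_csSup hKc.bddAbove hx⟩
    have hχ0 : ∀ x, x ∉ Icc a' b' → χ x = 0 := fun x hx => hχK x fun h => hx (hab' h)
    have hχi : Integrable χ :=
      (hψ.continuous.integrable_of_hasCompactSupport hψc).sub
        ((hψ₀.continuous.integrable_of_hasCompactSupport hψ₀c).const_mul m)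
    have hχint : ∫ x, χ x = 0 := by
      rw [hχ, integral_sub (hψ.continuous.integrable_of_hasCompactSupport hψc)
        ((hψ₀.continuous.integrable_of_hasCompactSupport hψ₀c).const_mul m), integral_const_mul,
        hψ₀i, hm]; ring
    set η : ℝ → ℝ := fun x => ∫ t in a..x, χ t with hη
    have hηd : ∀ x, HasDerivAt η (χ x) x := fun x =>
      intervalIntegral.integral_hasDerivAt_right hχi.intervalIntegrable
        (hχd.continuous.stronglyMeasurableAtFilter _ _) hχd.continuous.continuousAt
    have hηderiv : deriv η = χ := funext fun x => (hηd x).deriv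
    have hηc : ContDiff ℝ ((⊤ : ℕ∞) : WithTop ℕ∞) η := by
      rw [contDiff_infty_iff_deriv, hηderiv]
      exact ⟨fun x => (hηd x).differentiableAt, hχd⟩
    have hηsupp : tsupport η ⊆ Icc a' b' := by
      refine closure_minimal ?_ isClosed_Icc
      intro x hx
      by_contra hxI
      refine hx ?_
      rcases lt_or_ge x a' with h1 | h1
      · rw [hη]
        refine intervalIntegral.integral_zero_ae (Eventually.of_forall fun t ht => hχ0 t ?_)
        intro h2
        have h3 := uIoc_subset_uIcc ht
        rw [mem_uIcc] at h3
        rcases h3 with h3 | h3 <;> linarith [h2.1, h3.2]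
      · have h2 : b' < x := by
          by_contra h2; exact hxI ⟨h1, not_lt.1 h2⟩
        rw [← hχint, hη]
        have h3 : a ≤ x := by linarith
        change ∫ t in a..x, χ t = _
        rw [intervalIntegral.integral_of_le h3]
        refine setIntegral_eq_integral_of_forall_compl_eq_zero fun t ht => hχ0 t ?_
        exact fun h4 => ht ⟨by linarith [h4.1], by linarith [h4.2]⟩
    have := h η hηc (isCompact_Icc.of_isClosed_subset (isClosed_tsupport _) hηsupp)
      (hηsupp.trans fun x hx => ⟨ha'.trans_le hx.1, hx.2.trans_lt hb'⟩)
    rw [hηderiv] at this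
    have e1 : ∫ x in Ioo a b, f x * χ x = (∫ x in Ioo a b, f x * ψ x) - m * C := by
      rw [hC, ← integral_const_mul, ← integral_sub (fmul ψ hψ.continuous)
        ((fmul ψ₀ hψ₀.continuous).const_mul m)]
      refine integral_congr_ae (Eventually.of_forall fun x => ?_)
      simp only [hχ]; ring
    have e2 : ∫ x, ψ x • (f x - C) = ∫ x in Ioo a b, (f x * ψ x - C * ψ x) := by
      rw [← setIntegral_eq_integral_of_forall_compl_eq_zero (s := Ioo a b)]
      · refine integral_congr_ae (Eventually.of_forall fun x => ?_)
        simp only [smul_eq_mul]; ring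
      · intro x hx; simp [eq_zero_of_tsupport_subset_Ioo hψs hx]
    have e3 : ∫ x in Ioo a b, ψ x = m :=
      setIntegral_eq_integral_of_forall_compl_eq_zero fun x hx =>
        eq_zero_of_tsupport_subset_Ioo hψs hx
    rw [e2, integral_sub (fmul ψ hψ.continuous)
      ((hψ.continuous.integrable_of_hasCompactSupport hψc).integrableOn.const_mul C),
      integral_const_mul, e3]
    rw [e1] at this; linarith
  rw [ae_restrict_iff' measurableSet_Ioo]
  filter_upwards [key] with x hx hxI using sub_eq_zero.1 (hx hxI)

/-- An `SBV` function agrees almost everywhere with its left-continuous representative. -/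
theorem HasSBVDerivative.exists_ae_eq_leftRep {a b : ℝ} (hab : a < b) {u v J : ℝ → ℝ}
    (h : HasSBVDerivative a b u v J) :
    ∃ C : ℝ, ∀ᵐ x ∂(volume.restrict (Ioo a b)), u x = leftRep a b C v J x := by
  obtain ⟨hu, hv, hJ, hJ0, hd⟩ := h
  have hL := integrableOn_leftRep (C := 0) hv hJ
  obtain ⟨C, hC⟩ := ae_eq_const_of_integral_mul_deriv_eq_zero hab (hu.sub hL) (by
    intro η hη hηc hηs
    have hη' : Continuous (deriv η) := hη.continuous_deriv (by exact_mod_cast le_top)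
    obtain ⟨M, hM⟩ := isCompact_Icc.exists_bound_of_continuousOn (s := Icc a b) hη'.continuousOn
    have hb : ∀ᵐ x ∂(volume.restrict (Ioo a b)), ‖deriv η x‖ ≤ M := by
      filter_upwards [ae_restrict_mem measurableSet_Ioo] with x hx
        using hM x (Ioo_subset_Icc_self hx)
    simp only [Pi.sub_apply, sub_mul]
    rw [integral_sub (hu.mul_bdd hη'.aestronglyMeasurable hb)
      (hL.mul_bdd hη'.aestronglyMeasurable hb), hd η hη hηc hηs,
      integral_leftRep_mul_deriv hab hv hJ hJ0 hη hηs, sub_self])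
  refine ⟨C, ?_⟩
  filter_upwards [hC] with x hx
  simp only [Pi.sub_apply, leftRep] at hx ⊢
  linarith

/-- Conversely every function of the form `C + ∫ v + ∑ J` has the expected derivative. -/
theorem hasSBVDerivative_of_ae_eq_leftRep {a b C : ℝ} (hab : a < b) {u v J : ℝ → ℝ}
    (hv : IntegrableOn v (Ioo a b)) (hJ : Summable J) (hJ0 : ∀ x, x ∉ Ioo a b → J x = 0)
    (hu : ∀ᵐ x ∂(volume.restrict (Ioo a b)), u x = leftRep a b C v J x) :
    HasSBVDerivative a b u v J := by
  refine ⟨(integrableOn_leftRep hv hJ).congr (EventuallyEq.symm hu), hv, hJ, hJ0, ?_⟩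
  intro η hη hηc hηs
  rw [← integral_leftRep_mul_deriv (C := C) hab hv hJ hJ0 hη hηs]
  refine integral_congr_ae ?_
  filter_upwards [hu] with x hx
  rw [hx]

/-! ### Traces and the singular set -/

lemma eventually_forall_Ioo_left {x : ℝ} {p : ℝ → Prop} (h : ∀ᶠ y in 𝓝[<] x, p y) :
    ∀ᶠ r in 𝓝[>] (0 : ℝ), ∀ y ∈ Ioo (x - r) x, p y := by
  obtain ⟨l, hl, hlp⟩ := mem_nhdsLT_iff_exists_Ioo_subset.1 h
  have hl' : l < x := hl
  filter_upwards [Ioo_mem_nhdsGT (sub_pos.2 hl')] with r hr y hy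
  exact hlp ⟨by linarith [hr.2, hy.1], hy.2⟩

lemma eventually_forall_Ioo_right {x : ℝ} {p : ℝ → Prop} (h : ∀ᶠ y in 𝓝[>] x, p y) :
    ∀ᶠ r in 𝓝[>] (0 : ℝ), ∀ y ∈ Ioo x (x + r), p y := by
  obtain ⟨l, hl, hlp⟩ := mem_nhdsGT_iff_exists_Ioo_subset.1 h
  have hl' : x < l := hl
  filter_upwards [Ioo_mem_nhdsGT (sub_pos.2 hl')] with r hr y hy
  exact hlp ⟨hy.1, by linarith [hr.2, hy.2]⟩

/-- An average belongs to every closed ball, a convex set, that contains almost all the averaged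
values. -/
lemma tendsto_average_of_eventually_ae {u : ℝ → ℝ} {l : ℝ} {s : ℝ → Set ℝ}
    (hs : ∀ᶠ r in 𝓝[>] (0 : ℝ), volume (s r) ≠ 0 ∧ volume (s r) ≠ ∞ ∧ IntegrableOn u (s r))
    (h : ∀ ε > 0, ∀ᶠ r in 𝓝[>] (0 : ℝ), ∀ᵐ y ∂(volume.restrict (s r)), |u y - l| ≤ ε) :
    Tendsto (fun r => ⨍ y in s r, u y) (𝓝[>] (0 : ℝ)) (𝓝 l) := by
  rw [Metric.tendsto_nhds]
  intro ε hε
  filter_upwards [hs, h (ε / 2) (half_pos hε)] with r hr hr2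
  have := (convex_closedBall l (ε / 2)).set_average_mem (f := u) Metric.isClosed_closedBall
    hr.1 hr.2.1 (by filter_upwards [hr2] with y hy; simpa [Real.dist_eq] using hy) hr.2.2
  exact lt_of_le_of_lt this (half_lt_self hε)

section

variable {a b x l : ℝ} {u f : ℝ → ℝ}

lemma tendsto_average_left (hx : x ∈ Ioo a b) (hu : IntegrableOn u (Ioo a b))
    (huf : ∀ᵐ y ∂(volume.restrict (Ioo a b)), u y = f y) (hf : Tendsto f (𝓝[<] x) (𝓝 l)) :
    Tendsto (fun r => ⨍ y in Ioo (x - r) x, u y) (𝓝[>] (0 : ℝ)) (𝓝 l) := by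
  have hsub : ∀ᶠ r in 𝓝[>] (0 : ℝ), Ioo (x - r) x ⊆ Ioo a b := by
    filter_upwards [eventually_forall_Ioo_left (Ioo_mem_nhdsLT hx.1)] with r hr y hy
    exact ⟨(hr y hy).1, hy.2.trans hx.2⟩
  refine tendsto_average_of_eventually_ae ?_ ?_
  · filter_upwards [hsub, self_mem_nhdsWithin] with r hr hr0
    have hr0' : (0 : ℝ) < r := hr0
    refine ⟨?_, ?_, hu.mono_set hr⟩ <;> simp [hr0']
  · intro ε hε
    filter_upwards [hsub, eventually_forall_Ioo_left
      (hf.eventually (Metric.closedBall_mem_nhds l hε))] with r hr hr2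
    filter_upwards [ae_restrict_of_ae_restrict_of_subset hr huf,
      ae_restrict_mem measurableSet_Ioo] with y hy hyI
    rw [hy]; simpa [Real.dist_eq] using hr2 y hyI

lemma tendsto_average_right (hx : x ∈ Ioo a b) (hu : IntegrableOn u (Ioo a b))
    (huf : ∀ᵐ y ∂(volume.restrict (Ioo a b)), u y = f y) (hf : Tendsto f (𝓝[>] x) (𝓝 l)) :
    Tendsto (fun r => ⨍ y in Ioo x (x + r), u y) (𝓝[>] (0 : ℝ)) (𝓝 l) := by
  have hsub : ∀ᶠ r in 𝓝[>] (0 : ℝ), Ioo x (x + r) ⊆ Ioo a b := by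
    filter_upwards [eventually_forall_Ioo_right (Ioo_mem_nhdsGT hx.2)] with r hr y hy
    exact ⟨hx.1.trans hy.1, (hr y hy).2⟩
  refine tendsto_average_of_eventually_ae ?_ ?_
  · filter_upwards [hsub, self_mem_nhdsWithin] with r hr hr0
    have hr0' : (0 : ℝ) < r := hr0
    refine ⟨?_, ?_, hu.mono_set hr⟩ <;> simp [hr0']
  · intro ε hε
    filter_upwards [hsub, eventually_forall_Ioo_right
      (hf.eventually (Metric.closedBall_mem_nhds l hε))] with r hr hr2
    filter_upwards [ae_restrict_of_ae_restrict_of_subset hr huf,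
      ae_restrict_mem measurableSet_Ioo] with y hy hyI
    rw [hy]; simpa [Real.dist_eq] using hr2 y hyI

lemma tendsto_average_both (hx : x ∈ Ioo a b) (hu : IntegrableOn u (Ioo a b))
    (huf : ∀ᵐ y ∂(volume.restrict (Ioo a b)), u y = f y) (hf : Tendsto f (𝓝[<] x) (𝓝 l))
    (hf' : Tendsto f (𝓝[>] x) (𝓝 l)) :
    Tendsto (fun r => ⨍ y in Ioo (x - r) (x + r), u y) (𝓝[>] (0 : ℝ)) (𝓝 l) := by
  have hsub : ∀ᶠ r in 𝓝[>] (0 : ℝ), Ioo (x - r) (x + r) ⊆ Ioo a b := by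
    filter_upwards [Ioo_mem_nhdsGT (sub_pos.2 hx.1), Ioo_mem_nhdsGT (sub_pos.2 hx.2)]
      with r hr hr' y hy
    exact ⟨by linarith [hr.2, hy.1], by linarith [hr'.2, hy.2]⟩
  refine tendsto_average_of_eventually_ae ?_ ?_
  · filter_upwards [hsub, self_mem_nhdsWithin] with r hr hr0
    have hr0' : (0 : ℝ) < r := hr0
    refine ⟨?_, ?_, hu.mono_set hr⟩
    · simp [hr0']
    · simp
  · intro ε hε
    filter_upwards [hsub, eventually_forall_Ioo_right
      (hf'.eventually (Metric.closedBall_mem_nhds l hε)), eventually_forall_Ioo_left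
      (hf.eventually (Metric.closedBall_mem_nhds l hε))] with r hr hr2 hr3
    have hne : ∀ᵐ y ∂(volume.restrict (Ioo (x - r) (x + r))), y ≠ x :=
      ae_restrict_of_ae (Measure.ae_ne volume x)
    filter_upwards [ae_restrict_of_ae_restrict_of_subset hr huf, hne,
      ae_restrict_mem measurableSet_Ioo] with y hy hyx hyI
    rw [hy]
    rcases lt_or_gt_of_ne hyx with h | h
    · simpa [Real.dist_eq] using hr3 y ⟨hyI.1, h⟩
    · simpa [Real.dist_eq] using hr2 y ⟨h, hyI.2⟩

/-- If `⨍ |u - z| → 0` over symmetric intervals, the same holds over subintervals of half size. -/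
lemma tendsto_average_half {s : ℝ → Set ℝ} {h : ℝ → ℝ} (hx : x ∈ Ioo a b)
    (hh : IntegrableOn h (Ioo a b)) (h0 : ∀ y, 0 ≤ h y)
    (hs : ∀ r > 0, s r ⊆ Ioo (x - r) (x + r) ∧ volume (s r) = ENNReal.ofReal r)
    (ht : Tendsto (fun r => ⨍ y in Ioo (x - r) (x + r), h y) (𝓝[>] (0 : ℝ)) (𝓝 0)) :
    Tendsto (fun r => ⨍ y in s r, h y) (𝓝[>] (0 : ℝ)) (𝓝 0) := by
  have ht2 := ht.const_mul 2
  rw [mul_zero] at ht2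
  refine squeeze_zero' (Eventually.of_forall fun r => ?_) ?_ ht2
  · rw [setAverage_eq]
    exact smul_nonneg (by positivity) (integral_nonneg h0)
  filter_upwards [Ioo_mem_nhdsGT (sub_pos.2 hx.1), Ioo_mem_nhdsGT (sub_pos.2 hx.2)] with r hr hr'
  have hsub : Ioo (x - r) (x + r) ⊆ Ioo a b := fun y hy =>
    ⟨by linarith [hr.2, hy.1], by linarith [hr'.2, hy.2]⟩
  have hr0 : 0 < r := hr.1
  rw [setAverage_eq, setAverage_eq, Measure.real, Measure.real, (hs r hr0).2, Real.volume_Ioo,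
    ENNReal.toReal_ofReal hr0.le, ENNReal.toReal_ofReal (by linarith), smul_eq_mul, smul_eq_mul]
  have hle : ∫ y in s r, h y ≤ ∫ y in Ioo (x - r) (x + r), h y :=
    setIntegral_mono_set (hh.mono_set hsub) (Eventually.of_forall h0) (hs r hr0).1.eventuallyLE
  have e : x + r - (x - r) = 2 * r := by ring
  rw [e, mul_inv, ← mul_assoc, ← mul_assoc, mul_inv_cancel₀ two_ne_zero, one_mul]
  gcongr

end

section

variable {a b C : ℝ} {u v J : ℝ → ℝ}

lemma leftTrace_eq_leftRep (h : HasSBVDerivative a b u v J)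
    (hC : ∀ᵐ x ∂(volume.restrict (Ioo a b)), u x = leftRep a b C v J x) {x : ℝ}
    (hx : x ∈ Ioo a b) : leftTrace u x = leftRep a b C v J x :=
  (tendsto_average_left hx h.1 hC (tendsto_leftRep_left h.2.1 h.2.2.1 x)).limUnder_eq

lemma rightTrace_eq_rightRep (h : HasSBVDerivative a b u v J)
    (hC : ∀ᵐ x ∂(volume.restrict (Ioo a b)), u x = leftRep a b C v J x) {x : ℝ}
    (hx : x ∈ Ioo a b) : rightTrace u x = rightRep a b C v J x :=
  (tendsto_average_right hx h.1 hC (tendsto_leftRep_right h.2.1 h.2.2.1 x)).limUnder_eq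

/-- The symmetric average of `|u - z|` bounds half of each one-sided average, and these tend to the
distances of z from the two traces. An approximate limit z thus equals both traces, whose difference
is `J x`; conversely equal traces give an approximate limit. -/
lemma mem_singularSet_iff (h : HasSBVDerivative a b u v J)
    (hC : ∀ᵐ x ∂(volume.restrict (Ioo a b)), u x = leftRep a b C v J x) {x : ℝ}
    (hx : x ∈ Ioo a b) : x ∈ singularSet a b u ↔ J x ≠ 0 := by
  obtain ⟨hu, hv, hJ, hJ0, hd⟩ := h
  have hi : ∀ z, IntegrableOn (fun y => |u y - z|) (Ioo a b) := fun z =>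
    (hu.sub (integrableOn_const (by simp))).abs
  have hae : ∀ z, ∀ᵐ y ∂(volume.restrict (Ioo a b)), |u y - z| = |leftRep a b C v J y - z| := by
    intro z; filter_upwards [hC] with y hy; rw [hy]
  have hl : ∀ z, Tendsto (fun y => |leftRep a b C v J y - z|) (𝓝[<] x)
      (𝓝 |leftRep a b C v J x - z|) := fun z => ((tendsto_leftRep_left hv hJ x).sub_const z).abs
  have hr : ∀ z, Tendsto (fun y => |leftRep a b C v J y - z|) (𝓝[>] x)
      (𝓝 |rightRep a b C v J x - z|) := fun z => ((tendsto_leftRep_right hv hJ x).sub_const z).abs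
  have hlr := rightRep_sub_leftRep (a := a) (b := b) (C := C) (v := v) hJ x
  constructor
  · rintro ⟨-, h⟩ hJx
    refine h ⟨leftRep a b C v J x, ?_⟩
    have h1 := hl (leftRep a b C v J x)
    have h2 := hr (leftRep a b C v J x)
    rw [hlr, hJx, abs_zero] at h2
    rw [sub_self, abs_zero] at h1
    exact tendsto_average_both hx (hi _) (hae _) h1 h2
  · intro hJx
    refine ⟨hx, ?_⟩
    rintro ⟨z, hz⟩
    have t1 := tendsto_average_half (s := fun r => Ioo (x - r) x) hx (hi z)
      (fun _ => abs_nonneg _)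
      (fun r hr => ⟨Ioo_subset_Ioo_right (by linarith), by simp⟩) hz
    have t2 := tendsto_average_half (s := fun r => Ioo x (x + r)) hx (hi z)
      (fun _ => abs_nonneg _)
      (fun r hr => ⟨Ioo_subset_Ioo_left (by linarith), by simp⟩) hz
    have l1 := tendsto_nhds_unique t1 (tendsto_average_left hx (hi z) (hae z) (hl z))
    have l2 := tendsto_nhds_unique t2 (tendsto_average_right hx (hi z) (hae z) (hr z))
    have e1 := abs_eq_zero.1 l1.symm
    have e2 := abs_eq_zero.1 l2.symm
    exact hJx (by linarith)

lemma singularSet_eq (h : HasSBVDerivative a b u v J)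
    (hC : ∀ᵐ x ∂(volume.restrict (Ioo a b)), u x = leftRep a b C v J x) :
    singularSet a b u = {x | J x ≠ 0} := by
  ext x
  by_cases hx : x ∈ Ioo a b
  · exact mem_singularSet_iff h hC hx
  · exact ⟨fun h' => absurd h'.1 hx, fun h' => absurd (h.2.2.2.1 x hx) h'⟩

end

lemma MemSBV.exists_hasSBVDerivative {a b : ℝ} {u : ℝ → ℝ} (h : MemSBV a b u) :
    ∃ J, HasSBVDerivative a b u (sbvDeriv a b u) J := by
  rw [sbvDeriv, dif_pos h]; exact h.choose_spec

/-- The approximate derivative is determined up to null sets. -/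
theorem HasSBVDerivative.sbvDeriv_ae_eq {a b : ℝ} (hab : a < b) {u v J : ℝ → ℝ}
    (h : HasSBVDerivative a b u v J) :
    ∀ᵐ x ∂(volume.restrict (Ioo a b)), sbvDeriv a b u x = v x := by
  obtain ⟨J', h'⟩ := MemSBV.exists_hasSBVDerivative ⟨v, J, h⟩
  obtain ⟨C, hC⟩ := h.exists_ae_eq_leftRep hab
  obtain ⟨C', hC'⟩ := h'.exists_ae_eq_leftRep hab
  rw [ae_restrict_iff' measurableSet_Ioo]
  filter_upwards [ae_hasDerivAt_leftRep (C := C) h.2.1 h.2.2.1,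
    ae_hasDerivAt_leftRep (C := C') h'.2.1 h'.2.2.1] with x h1 h2 hx
  refine (h2 hx).unique ((h1 hx).congr_of_eventuallyEq ?_)
  filter_upwards [isOpen_Ioo.mem_nhds hx] with y hy
  rw [← leftTrace_eq_leftRep h hC hy, ← leftTrace_eq_leftRep h' hC' hy]

/-! ### One-dimensional Hausdorff measure of graphs -/

/-- N ↦ |f(N)| is an outer measure that does not exceed the Stieltjes length on half-open intervals,
by monotonicity of f, and the Stieltjes outer measure is the largest one with this property. -/
lemma volume_image_le_stieltjes (f : StieltjesFunction ℝ) (N : Set ℝ) :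
    volume (f '' N) ≤ f.measure N := by
  have h : OuterMeasure.comap f (volume : Measure ℝ).toOuterMeasure ≤ f.outer := by
    rw [StieltjesFunction.outer, OuterMeasure.le_ofFunction]
    intro s
    rw [OuterMeasure.comap_apply, StieltjesFunction.length_eq]
    refine le_iInf fun p => le_iInf fun q => le_iInf fun hs => ?_
    have hs' : s ⊆ Ioc p q := fun x hx => hs ⟨hx, by simp [botSet, not_isBot]⟩
    refine (measure_mono (t := Icc (f p) (f q)) ?_).trans (by simp)
    rintro _ ⟨x, hx, rfl⟩
    exact ⟨f.mono (hs' hx).1.le, f.mono (hs' hx).2⟩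
  have := h N
  rw [StieltjesFunction.measure]
  exact this

/-- A curve dominated by a finite measure maps null sets of this measure to `ℋ¹`-null sets. -/
lemma hausdorffMeasure_image_eq_zero {X : Type*} [MetricSpace X] [MeasurableSpace X] [BorelSpace X]
    (ρ : Measure ℝ) [IsFiniteMeasure ρ] {f : ℝ → X} {N : Set ℝ} (hN : ρ N = 0)
    (hf : ∀ x ∈ N, ∀ y ∈ N, x ≤ y → edist (f x) (f y) ≤ ρ (Ioc x y)) :
    (μH[1] : Measure X) (f '' N) = 0 := by
  rcases eq_or_ne ρ 0 with h0 | h0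
  · have : (f '' N).Subsingleton := by
      rintro _ ⟨x, hx, rfl⟩ _ ⟨y, hy, rfl⟩
      rcases le_total x y with h | h
      · have := hf x hx y hy h
        rw [h0] at this
        exact edist_le_zero.1 (by simpa using this)
      · have := hf y hy x hx h
        rw [h0] at this
        exact (edist_le_zero.1 (by simpa using this)).symm
    have := Measure.nullSingletonClass_hausdorff X (d := 1) one_pos
    exact Set.Subsingleton.measure_zero ‹_› _
  have : NeZero ρ := ⟨h0⟩
  have hρ0 : ρ univ ≠ 0 := by simpa using h0
  set K : ℝ≥0 := (ρ univ).toNNReal with hK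
  -- The normalization makes the distribution function F available. On N the curve factors through F
  -- as a K-Lipschitz map, and F(N) is Lebesgue-null.
  set π : Measure ℝ := (ρ univ)⁻¹ • ρ with hπ
  have : IsProbabilityMeasure π := isProbabilityMeasureSMul
  have hρπ : ∀ s, ρ s = K * π s := by
    intro s
    rw [hK, ENNReal.coe_toNNReal (measure_ne_top _ _), hπ, Measure.smul_apply, smul_eq_mul,
      ← mul_assoc, ENNReal.mul_inv_cancel hρ0 (measure_ne_top _ _), one_mul]
  set F := ProbabilityTheory.cdf π with hF
  have hFπ : F.measure = π := ProbabilityTheory.measure_cdf π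
  have key' : ∀ x ∈ N, ∀ y ∈ N, x ≤ y → edist (f x) (f y) ≤ K * edist (F x) (F y) := by
    intro x hx y hy hxy
    refine (hf x hx y hy hxy).trans ?_
    rw [hρπ, ← hFπ, StieltjesFunction.measure_Ioc, edist_comm, edist_dist, Real.dist_eq,
      abs_of_nonneg (sub_nonneg.2 (F.mono hxy))]
  have key : ∀ x ∈ N, ∀ y ∈ N, edist (f x) (f y) ≤ K * edist (F x) (F y) := by
    intro x hx y hy
    rcases le_total x y with h | h
    · exact key' x hx y hy h
    · rw [edist_comm, edist_comm (F x)]; exact key' y hy x hx h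
  have hinv : ∀ x ∈ N, Function.invFunOn F N (F x) ∈ N ∧ F (Function.invFunOn F N (F x)) = F x :=
    fun x hx => ⟨Function.invFunOn_mem ⟨x, hx, rfl⟩, Function.invFunOn_eq ⟨x, hx, rfl⟩⟩
  have himg : f '' N ⊆ (f ∘ Function.invFunOn F N) '' (F '' N) := by
    rintro _ ⟨x, hx, rfl⟩
    refine ⟨F x, ⟨x, hx, rfl⟩, ?_⟩
    refine edist_le_zero.1 ((key _ (hinv x hx).1 _ hx).trans ?_)
    rw [(hinv x hx).2]; simp
  have hLip : LipschitzOnWith K (f ∘ Function.invFunOn F N) (F '' N) := by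
    rintro _ ⟨x, hx, rfl⟩ _ ⟨y, hy, rfl⟩
    refine (key _ (hinv x hx).1 _ (hinv y hy).1).trans ?_
    rw [(hinv x hx).2, (hinv y hy).2]
  have h1 := hLip.hausdorffMeasure_image_le zero_le_one
  have h2 : (μH[1] : Measure ℝ) (F '' N) = 0 := by
    rw [hausdorffMeasure_real]
    refine le_antisymm ((volume_image_le_stieltjes F N).trans ?_) (zero_le)
    rw [hFπ, hπ, Measure.smul_apply, hN, smul_zero]
  rw [h2, mul_zero] at h1
  exact le_antisymm ((measure_mono himg).trans h1) (zero_le)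

/-- The point `(x,t)`. -/
def pt (x t : ℝ) : Plane := !₂[x, t]

@[simp] lemma pt_zero (x t : ℝ) : pt x t 0 = x := rfl

@[simp] lemma pt_one (x t : ℝ) : pt x t 1 = t := rfl

lemma pt_eta (p : Plane) : pt (p 0) (p 1) = p := by
  ext i; fin_cases i <;> rfl

lemma norm_plane (p : Plane) : ‖p‖ = Real.sqrt (p 0 ^ 2 + p 1 ^ 2) := by
  rw [EuclideanSpace.norm_eq, Fin.sum_univ_two]; simp

lemma continuous_pt : Continuous fun q : ℝ × ℝ => pt q.1 q.2 := by
  refine (PiLp.continuous_toLp 2 _).comp (continuous_pi fun i => ?_)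
  fin_cases i
  · exact continuous_fst
  · exact continuous_snd

lemma measurable_pt {f g : ℝ → ℝ} (hf : Measurable f) (hg : Measurable g) :
    Measurable fun x => pt (f x) (g x) :=
  continuous_pt.measurable.comp (hf.prodMk hg)

lemma measurable_coord (i : Fin 2) : Measurable fun p : Plane => p i :=
  (EuclideanSpace.proj (𝕜 := ℝ) i).continuous.measurable

lemma isometry_pt (x : ℝ) : Isometry (pt x) := by
  refine Isometry.of_dist_eq fun s t => ?_
  rw [dist_eq_norm, norm_plane, Real.dist_eq]
  simp [Real.sqrt_sq_eq_abs]

/-- The length element of a graph with slope `k`. -/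
def len (k : ℝ) : ℝ := Real.sqrt (1 + k ^ 2)

lemma len_eq_norm (k : ℝ) : len k = ‖pt 1 k‖ := by rw [norm_plane, len]; simp

lemma len_pos (k : ℝ) : 0 < len k := Real.sqrt_pos.2 (by positivity)

lemma len_le (k : ℝ) : len k ≤ 1 + |k| := by
  rw [len, Real.sqrt_le_left (by positivity)]
  nlinarith [sq_abs k, abs_nonneg k]

lemma measurable_len : Measurable len :=
  (Real.continuous_sqrt.comp (continuous_const.add (continuous_id.pow 2))).measurable

lemma len_le_add (k l : ℝ) : len k ≤ len l + |k - l| := by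
  rw [len_eq_norm, len_eq_norm]
  have : pt 1 k = pt 1 l + pt 0 (k - l) := by ext i; fin_cases i <;> simp [pt]
  rw [this]
  refine (norm_add_le _ _).trans (le_of_eq ?_)
  rw [norm_plane (pt 0 _)]; simp [Real.sqrt_sq_eq_abs]

/-- A set has only countably many points isolated from the right within it. Hence a derivative can
be computed along s alone at almost every point of s. -/
lemma ae_neBot_nhdsWithin_Ioi (s : Set ℝ) : ∀ᵐ x, x ∈ s → (𝓝[s ∩ Ioi x] x).NeBot := by
  have h := (countable_setOfPred_isolated_right_within (s := s)).ae_notMem volume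
  filter_upwards [h] with x hx hxs
  refine ⟨fun h' => hx ⟨hxs, h'⟩⟩

lemma abs_deriv_sub_le_of_neBot {L : ℝ → ℝ} {d x k ε : ℝ} {s : Set ℝ} (h : HasDerivAt L d x)
    (hne : (𝓝[s ∩ Ioi x] x).NeBot) (hs : ∀ y ∈ s, |L y - L x - k * (y - x)| ≤ ε * |y - x|) :
    |d - k| ≤ ε := by
  have hle : 𝓝[s ∩ Ioi x] x ≤ 𝓝[≠] x := nhdsWithin_mono _ fun y hy => ne_of_gt hy.2
  have ht := ((hasDerivAt_iff_tendsto_slope.1 h).mono_left hle).sub_const k |>.abs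
  refine le_of_tendsto ht ?_
  filter_upwards [self_mem_nhdsWithin] with y hy
  have hy0 : 0 < y - x := sub_pos.2 hy.2
  have := hs y hy.1
  rw [slope_def_field, div_sub' hy0.ne', abs_div, div_le_iff₀ (abs_pos.2 hy0.ne')]
  rwa [mul_comm (y - x) k]

lemma dist_graph_le {L : ℝ → ℝ} {k ε x y : ℝ} (h : |L x - L y - k * (x - y)| ≤ ε * |x - y|) :
    dist (pt x (L x)) (pt y (L y)) ≤ (len k + ε) * |x - y| := by
  have e : pt x (L x) - pt y (L y) = (x - y) • pt 1 k + pt 0 (L x - L y - k * (x - y)) := by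
    ext i; fin_cases i <;> simp [pt]
    ring
  rw [dist_eq_norm, e]
  refine (norm_add_le _ _).trans ?_
  rw [norm_smul, ← len_eq_norm, norm_plane (pt 0 _)]
  simp only [pt_zero, pt_one, Real.norm_eq_abs]
  rw [show (0 : ℝ) ^ 2 + (L x - L y - k * (x - y)) ^ 2 = (L x - L y - k * (x - y)) ^ 2 by ring,
    Real.sqrt_sq_eq_abs]
  linarith

lemma le_dist_graph {L : ℝ → ℝ} {k ε x y : ℝ} (h : |L x - L y - k * (x - y)| ≤ ε * |x - y|) :
    (len k - ε) * |x - y| ≤ dist (pt x (L x)) (pt y (L y)) := by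
  have e : (x - y) • pt 1 k = (pt x (L x) - pt y (L y)) - pt 0 (L x - L y - k * (x - y)) := by
    ext i; fin_cases i <;> simp [pt]
    ring
  have h1 : ‖(x - y) • pt 1 k‖ ≤ dist (pt x (L x)) (pt y (L y)) + ε * |x - y| := by
    rw [e, dist_eq_norm]
    refine (norm_sub_le _ _).trans (add_le_add le_rfl ?_)
    rw [norm_plane (pt 0 _)]
    simpa [Real.sqrt_sq_eq_abs] using h
  rw [norm_smul, ← len_eq_norm, Real.norm_eq_abs] at h1
  linarith

lemma hausdorffMeasure_graph_le {L : ℝ → ℝ} {k ε : ℝ} (hε : 0 ≤ ε) {s : Set ℝ}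
    (h : ∀ x ∈ s, ∀ y ∈ s, |L x - L y - k * (x - y)| ≤ ε * |x - y|) :
    (μH[1] : Measure Plane) ((fun x => pt x (L x)) '' s) ≤
      ENNReal.ofReal (len k + ε) * volume s := by
  have hL : LipschitzOnWith (Real.toNNReal (len k + ε)) (fun x => pt x (L x)) s := by
    refine LipschitzOnWith.of_dist_le_mul fun x hx y hy => ?_
    rw [Real.coe_toNNReal _ (by linarith [len_pos k])]
    exact dist_graph_le (h x hx y hy)
  have := hL.hausdorffMeasure_image_le zero_le_one
  rwa [hausdorffMeasure_real, ENNReal.rpow_one] at this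

/-- The projection to the x-axis is Lipschitz with constant (len k - ε)⁻¹ on such a piece of graph;
if len k ≤ ε there is nothing to prove. -/
lemma le_hausdorffMeasure_graph {L : ℝ → ℝ} {k ε : ℝ} (hε : 0 ≤ ε) {s : Set ℝ}
    (h : ∀ x ∈ s, ∀ y ∈ s, |L x - L y - k * (x - y)| ≤ ε * |x - y|) :
    ENNReal.ofReal (len k) * volume s ≤
      (μH[1] : Measure Plane) ((fun x => pt x (L x)) '' s) + ENNReal.ofReal ε * volume s := by
  rcases le_or_gt (len k) ε with hk | hk
  · refine le_add_left ?_
    gcongr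
  have hpos : 0 < len k - ε := by linarith
  have hL : LipschitzOnWith (Real.toNNReal (len k - ε)⁻¹) (fun p : Plane => p 0)
      ((fun x => pt x (L x)) '' s) := by
    refine LipschitzOnWith.of_dist_le_mul ?_
    rintro _ ⟨x, hx, rfl⟩ _ ⟨y, hy, rfl⟩
    rw [Real.coe_toNNReal _ (by positivity), ← div_eq_inv_mul, le_div_iff₀ hpos, mul_comm]
    simpa [Real.dist_eq] using le_dist_graph (h x hx y hy)
  have h1 := hL.hausdorffMeasure_image_le zero_le_one
  have himg : (fun p : Plane => p 0) '' ((fun x => pt x (L x)) '' s) = s := by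
    rw [image_image]; simp
  rw [himg, hausdorffMeasure_real, ENNReal.rpow_one] at h1
  have h2 : ENNReal.ofReal (len k - ε) * volume s ≤
      (μH[1] : Measure Plane) ((fun x => pt x (L x)) '' s) := by
    calc _ ≤ ENNReal.ofReal (len k - ε) * (((len k - ε)⁻¹.toNNReal : ℝ≥0∞) * _) := by gcongr
      _ = _ := by
        rw [← mul_assoc]
        change ENNReal.ofReal (len k - ε) * ENNReal.ofReal (len k - ε)⁻¹ * _ = _
        rw [← ENNReal.ofReal_mul hpos.le, mul_inv_cancel₀ hpos.ne', ENNReal.ofReal_one, one_mul]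
  calc ENNReal.ofReal (len k) * volume s
      = ENNReal.ofReal (len k - ε) * volume s + ENNReal.ofReal ε * volume s := by
        rw [← add_mul, ← ENNReal.ofReal_add hpos.le hε]; congr 2; ring
    _ ≤ _ := by gcongr

lemma measurableSet_graph_image {L : ℝ → ℝ} (hL : Measurable L) {s : Set ℝ}
    (hs : MeasurableSet s) : MeasurableSet ((fun x => pt x (L x)) '' s) := by
  have : (fun x => pt x (L x)) '' s = {p : Plane | p 0 ∈ s ∧ p 1 = L (p 0)} := by
    ext p; constructor
    · rintro ⟨x, hx, rfl⟩; simp [hx]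
    · rintro ⟨h1, h2⟩; exact ⟨p 0, h1, by simp only; rw [← h2, pt_eta]⟩
  rw [this]
  exact (measurable_coord 0 hs).inter
    (measurableSet_eq_fun (measurable_coord 1) (hL.comp (measurable_coord 0)))

/-- The area formula for graphs over the differentiability set. -/
theorem hausdorffMeasure_graph {L v : ℝ → ℝ} (hL : Measurable L) {s : Set ℝ}
    (hs : MeasurableSet s) (hfin : volume s ≠ ∞) (hd : ∀ x ∈ s, HasDerivAt L (v x) x) :
    (μH[1] : Measure Plane) ((fun x => pt x (L x)) '' s) = ∫⁻ x in s, ENNReal.ofReal (len (v x)) := by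
  -- The set is cut into countably many pieces on which L is ε-close to linear. One ε pays for
  -- comparing the length with `len k`, the other for replacing the slope k of the piece by the true
  -- slope.
  have main : ∀ ε : ℝ≥0, 0 < ε →
      (μH[1] : Measure Plane) ((fun x => pt x (L x)) '' s) ≤
        (∫⁻ x in s, ENNReal.ofReal (len (v x))) + 2 * ε * volume s ∧
      (∫⁻ x in s, ENNReal.ofReal (len (v x))) ≤
        (μH[1] : Measure Plane) ((fun x => pt x (L x)) '' s) + 2 * ε * volume s := by
    intro ε hε
    obtain ⟨t, A, hdisj, htm, hcov, happ, -⟩ :=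
      exists_partition_approximatesLinearOn_of_hasFDerivWithinAt L s
        (fun x => ContinuousLinearMap.toSpanSingleton ℝ (v x))
        (fun x hx => (hd x hx).hasFDerivAt.hasFDerivWithinAt) (fun _ => ε) (fun _ => hε.ne')
    set k : ℕ → ℝ := fun n => A n 1 with hk
    have happ' : ∀ n, ∀ x ∈ s ∩ t n, ∀ y ∈ s ∩ t n,
        |L x - L y - k n * (x - y)| ≤ ε * |x - y| := by
      intro n x hx y hy
      have := happ n x hx y hy
      have e : A n (x - y) = k n * (x - y) := by
        rw [hk, mul_comm, ← smul_eq_mul, ← (A n).map_smul, smul_eq_mul, mul_one]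
      rwa [e] at this
    have hmeas : ∀ n, MeasurableSet (s ∩ t n) := fun n => hs.inter (htm n)
    have hunion : s = ⋃ n, s ∩ t n := by
      rw [← inter_iUnion]; exact (inter_eq_left.2 hcov).symm
    have hdisj' : Pairwise (Function.onFun Disjoint fun n => s ∩ t n) := fun i j hij =>
      (hdisj hij).mono inter_subset_right inter_subset_right
    have hslope : ∀ n, ∀ᵐ x ∂(volume.restrict (s ∩ t n)), |v x - k n| ≤ ε := by
      intro n
      rw [ae_restrict_iff' (hmeas n)]
      filter_upwards [ae_neBot_nhdsWithin_Ioi (s ∩ t n)] with x hx hxs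
      exact abs_deriv_sub_le_of_neBot (hd x hxs.1) (hx hxs) fun y hy => happ' n y hy x hxs
    have hint : ∫⁻ x in s, ENNReal.ofReal (len (v x)) =
        ∑' n, ∫⁻ x in s ∩ t n, ENNReal.ofReal (len (v x)) := by
      conv_lhs => rw [hunion]
      exact lintegral_iUnion hmeas hdisj' _
    have hvol : volume s = ∑' n, volume (s ∩ t n) := by
      conv_lhs => rw [hunion]
      exact measure_iUnion hdisj' hmeas
    have himage : (μH[1] : Measure Plane) ((fun x => pt x (L x)) '' s) =
        ∑' n, (μH[1] : Measure Plane) ((fun x => pt x (L x)) '' (s ∩ t n)) := by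
      conv_lhs => rw [hunion, image_iUnion]
      refine measure_iUnion (fun i j hij => ?_) fun n => measurableSet_graph_image hL (hmeas n)
      refine (disjoint_image_iff ?_).2 (hdisj' hij)
      intro x y hxy
      have := congrArg (fun p : Plane => p 0) hxy
      simpa using this
    have e2 : (2 * ε * volume s : ℝ≥0∞) = ∑' n, 2 * ε * volume (s ∩ t n) := by
      rw [hvol, ENNReal.tsum_mul_left]
    have hεe : ENNReal.ofReal (ε : ℝ) = (ε : ℝ≥0∞) := ENNReal.ofReal_coe_nnreal
    constructor
    · rw [himage, hint, e2, ← ENNReal.tsum_add]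
      refine ENNReal.tsum_le_tsum fun n => ?_
      refine (hausdorffMeasure_graph_le ε.coe_nonneg (happ' n)).trans ?_
      rw [← setLIntegral_const, ← setLIntegral_const, ← lintegral_add_right _ measurable_const]
      refine lintegral_mono_ae ?_
      filter_upwards [hslope n] with x hx
      rw [← hεe, show (2 : ℝ≥0∞) = ENNReal.ofReal 2 by simp, ← ENNReal.ofReal_mul zero_le_two,
        ← ENNReal.ofReal_add (len_pos _).le (by positivity)]
      refine ENNReal.ofReal_le_ofReal ?_
      have := len_le_add (k n) (v x)
      rw [abs_sub_comm] at this
      linarith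
    · rw [himage, hint, e2, ← ENNReal.tsum_add]
      refine ENNReal.tsum_le_tsum fun n => ?_
      have h1 := le_hausdorffMeasure_graph ε.coe_nonneg (happ' n)
      calc ∫⁻ x in s ∩ t n, ENNReal.ofReal (len (v x))
          ≤ ∫⁻ x in s ∩ t n, (ENNReal.ofReal (len (k n)) + ENNReal.ofReal ε) := by
            refine lintegral_mono_ae ?_
            filter_upwards [hslope n] with x hx
            rw [← ENNReal.ofReal_add (len_pos _).le ε.coe_nonneg]
            exact ENNReal.ofReal_le_ofReal (by linarith [len_le_add (v x) (k n)])
        _ = ENNReal.ofReal (len (k n)) * volume (s ∩ t n)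
            + ENNReal.ofReal ε * volume (s ∩ t n) := by
            rw [lintegral_add_right _ measurable_const, setLIntegral_const, setLIntegral_const]
        _ ≤ _ := by
            refine (add_le_add_left h1 _).trans (le_of_eq ?_)
            rw [hεe]; ring
  have lim : ∀ X Y : ℝ≥0∞, (∀ ε : ℝ≥0, 0 < ε → X ≤ Y + 2 * ε * volume s) → X ≤ Y := by
    intro X Y h
    have ht : Tendsto (fun n : ℕ => Y + 2 * (((n : ℝ≥0) + 1)⁻¹ : ℝ≥0) * volume s) atTop
        (𝓝 (Y + 2 * (0 : ℝ≥0) * volume s)) := by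
      refine tendsto_const_nhds.add (ENNReal.Tendsto.mul_const ?_ (Or.inr hfin))
      refine ENNReal.Tendsto.const_mul (ENNReal.tendsto_coe.2 ?_) (Or.inr (by simp))
      have := tendsto_one_div_add_atTop_nhds_zero_nat (𝕜 := ℝ≥0)
      simpa using this
    have := ge_of_tendsto' ht fun n => h _ (by positivity)
    simpa using this
  exact le_antisymm (lim _ _ fun ε hε => (main ε hε).1) (lim _ _ fun ε hε => (main ε hε).2)

/-! ### The structure of the extended graph -/

/-- Good one-sided representatives `L`, `R` of the `SBV` function `u`, with jumps `J` and a set `A`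
of full measure of points of differentiability. -/
structure GraphData (a b : ℝ) (u L R J : ℝ → ℝ) (A : Set ℝ) : Prop where
  measurable_left : Measurable L
  measurable_right : Measurable R
  measurableSet : MeasurableSet A
  subset : A ⊆ Ioo a b
  disjoint : ∀ x ∈ A, x ∉ singularSet a b u
  ae_mem : ∀ᵐ x ∂(volume.restrict (Ioo a b)), x ∈ A
  hasDerivAt : ∀ x ∈ A, HasDerivAt L (sbvDeriv a b u x) x
  left_eq : ∀ x ∈ Ioo a b, leftTrace u x = L x
  right_eq : ∀ x ∈ Ioo a b, rightTrace u x = R x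
  mem_singularSet : ∀ x ∈ Ioo a b, x ∈ singularSet a b u ↔ L x ≠ R x
  countable : (singularSet a b u).Countable
  ae_eq : ∀ᵐ x ∂(volume.restrict (Ioo a b)), u x = L x
  summable : Summable J
  sub_eq : ∀ x, R x - L x = J x
  integrableOn : IntegrableOn (sbvDeriv a b u) (Ioo a b)
  tendsto_right : ∀ x, Tendsto L (𝓝[>] x) (𝓝 (R x))
  abs_sub_le : ∀ x y, x ≤ y → |L y - L x| ≤
    (∫ t in x..y, |(Ioo a b).indicator (sbvDeriv a b u) t|) + (jumpMeasure J).real (Ico x y)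
  bounded : ∃ M, ∀ x, |L x| ≤ M

theorem MemSBV.exists_graphData {a b : ℝ} (hab : a < b) {u : ℝ → ℝ} (hu : MemSBV a b u) :
    ∃ L R J A, GraphData a b u L R J A := by
  obtain ⟨J, h⟩ := hu.exists_hasSBVDerivative
  obtain ⟨C, hC⟩ := h.exists_ae_eq_leftRep hab
  have hv := h.2.1
  have hJ := h.2.2.1
  set v := sbvDeriv a b u with hvdef
  have hae : ∀ᵐ x, x ∈ Ioo a b → (HasDerivAt (leftRep a b C v J) (v x) x ∧ J x = 0) := by
    filter_upwards [ae_hasDerivAt_leftRep (C := C) hv hJ,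
      (countable_support_of_summable hJ).ae_notMem volume] with x h1 h2 hx
    exact ⟨h1 hx, by simpa using h2⟩
  obtain ⟨B, hBsub, hBm, hB0⟩ := exists_measurable_superset_of_null (ae_iff.1 hae)
  refine ⟨leftRep a b C v J, rightRep a b C v J, J, Ioo a b \ B, ?_⟩
  have hA : ∀ x ∈ Ioo a b \ B, HasDerivAt (leftRep a b C v J) (v x) x ∧ J x = 0 := by
    intro x hx
    by_contra hcon
    exact hx.2 (hBsub fun h' => hcon (h' hx.1))
  exact
    { measurable_left := measurable_leftRep hv hJ
      measurable_right := measurable_rightRep hv hJ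
      measurableSet := measurableSet_Ioo.diff hBm
      subset := sdiff_subset
      disjoint := fun x hx => by rw [mem_singularSet_iff h hC hx.1]; simpa using (hA x hx).2
      ae_mem := by
        rw [ae_restrict_iff' measurableSet_Ioo]
        filter_upwards [measure_eq_zero_iff_ae_notMem.1 hB0] with x hx hxI using ⟨hxI, hx⟩
      hasDerivAt := fun x hx => (hA x hx).1
      left_eq := fun x hx => leftTrace_eq_leftRep h hC hx
      right_eq := fun x hx => rightTrace_eq_rightRep h hC hx
      mem_singularSet := fun x hx => by
        rw [mem_singularSet_iff h hC hx, ← rightRep_sub_leftRep (a := a) (b := b) (C := C)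
          (v := v) hJ x, sub_ne_zero, ne_comm]
      countable := by rw [singularSet_eq h hC]; exact countable_support_of_summable hJ
      ae_eq := hC
      summable := hJ
      sub_eq := fun x => rightRep_sub_leftRep hJ x
      integrableOn := hv
      tendsto_right := fun x => tendsto_leftRep_right hv hJ x
      abs_sub_le := fun x y hxy => abs_leftRep_sub_le hv hJ hxy
      bounded := ⟨_, fun x => abs_leftRep_le hv hJ x⟩ }

/-- The vertical segment of the extended graph over `x`. -/
def vert (L R : ℝ → ℝ) (x : ℝ) : Set Plane := pt x '' uIcc (L x) (R x)

lemma hausdorffMeasure_restrict_vert (x : ℝ) (s : Set ℝ) :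
    (μH[1] : Measure Plane).restrict (pt x '' s) = (volume.restrict s).map (pt x) := by
  have hm : Measurable (pt x) := (isometry_pt x).continuous.measurable
  ext B hB
  rw [Measure.restrict_apply hB, Measure.map_apply hm hB, Measure.restrict_apply (hm hB),
    ← hausdorffMeasure_real, ← (isometry_pt x).hausdorffMeasure_image (Or.inl zero_le_one)]
  congr 1
  rw [inter_comm, inter_comm (pt x ⁻¹' B), image_inter_preimage]

lemma measurableSet_vert (L R : ℝ → ℝ) (x : ℝ) : MeasurableSet (vert L R x) :=
  (isCompact_uIcc.image (isometry_pt x).continuous).isClosed.measurableSet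

lemma vert_subset (L R : ℝ → ℝ) (x : ℝ) : vert L R x ⊆ {p | p 0 = x} := by
  rintro _ ⟨t, -, rfl⟩; rfl

lemma measurable_len_deriv (L : ℝ → ℝ) : Measurable fun x => len (deriv L x) :=
  measurable_len.comp (measurable_deriv L)

/-- The measure on `A` which parametrizes the length of the graph of `L` over `A`. -/
def lengthMeasure (A : Set ℝ) (L : ℝ → ℝ) : Measure ℝ :=
  (volume.restrict A).withDensity fun x => ENNReal.ofReal (len (deriv L x))

namespace GraphData

variable {a b : ℝ} {u L R J : ℝ → ℝ} {A : Set ℝ}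

lemma extendedGraph_eq (h : GraphData a b u L R J A) :
    extendedGraph a b u = {p | p 0 ∈ Ioo a b ∧ p 1 ∈ uIcc (L (p 0)) (R (p 0))} := by
  ext p
  simp only [extendedGraph, mem_ofPred_eq, uIcc, mem_Icc]
  refine and_congr_right fun hp => ?_
  rw [h.left_eq _ hp, h.right_eq _ hp]

lemma measurableSet_extendedGraph (h : GraphData a b u L R J A) :
    MeasurableSet (extendedGraph a b u) := by
  rw [h.extendedGraph_eq]
  have hL := h.measurable_left.comp (measurable_coord 0)
  have hR := h.measurable_right.comp (measurable_coord 0)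
  exact (measurable_coord 0 measurableSet_Ioo).inter
    ((measurableSet_le (hL.inf hR) (measurable_coord 1)).inter
      (measurableSet_le (measurable_coord 1) (hL.sup hR)))

lemma extendedGraph_eq_union (h : GraphData a b u L R J A) :
    extendedGraph a b u = ((fun x => pt x (L x)) '' A ∪
      (fun x => pt x (L x)) '' ((Ioo a b \ singularSet a b u) \ A)) ∪
      ⋃ x : singularSet a b u, vert L R x := by
  rw [h.extendedGraph_eq]
  ext p
  constructor
  · rintro ⟨hp, hp'⟩
    by_cases hS : p 0 ∈ singularSet a b u
    · refine Or.inr (mem_iUnion.2 ⟨⟨p 0, hS⟩, p 1, hp', pt_eta p⟩)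
    · left
      have hLR : L (p 0) = R (p 0) := by
        by_contra hne; exact hS ((h.mem_singularSet _ hp).2 hne)
      have : p 1 = L (p 0) := by
        rw [← hLR, uIcc_self] at hp'; exact hp'
      have hpe : pt (p 0) (L (p 0)) = p := by rw [← this, pt_eta]
      by_cases hA : p 0 ∈ A
      · exact Or.inl ⟨p 0, hA, hpe⟩
      · exact Or.inr ⟨p 0, ⟨⟨hp, hS⟩, hA⟩, hpe⟩
  · rintro ((⟨x, hx, rfl⟩ | ⟨x, hx, rfl⟩) | hp)
    · exact ⟨h.subset hx, left_mem_uIcc⟩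
    · exact ⟨hx.1.1, left_mem_uIcc⟩
    · obtain ⟨⟨x, hx⟩, t, ht, rfl⟩ := mem_iUnion.1 hp
      exact ⟨hx.1, ht⟩

/-- L need not be Lipschitz here, so Lebesgue-nullity of the base alone does not suffice. Chords are
bounded by the finite measure dx + |u'| dx + |J|, and the exceptional base points are null for it:
the first two parts are absolutely continuous, and J vanishes off the singular set. -/
lemma hausdorffMeasure_null (h : GraphData a b u L R J A) :
    (μH[1] : Measure Plane)
      ((fun x => pt x (L x)) '' ((Ioo a b \ singularSet a b u) \ A)) = 0 := by
  have hJf := isFiniteMeasure_jumpMeasure h.summable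
  set V : ℝ → ℝ := (Ioo a b).indicator (sbvDeriv a b u) with hV
  have hVi : Integrable V := integrable_indicator_Ioo h.integrableOn
  have hVf : IsFiniteMeasure (volume.withDensity fun t => ENNReal.ofReal |V t|) :=
    isFiniteMeasure_withDensity_ofReal hVi.abs.2
  set N := (Ioo a b \ singularSet a b u) \ A with hN
  have hNm : MeasurableSet N :=
    (measurableSet_Ioo.diff h.countable.measurableSet).diff h.measurableSet
  have hN0 : volume N = 0 := by
    have := h.ae_mem
    rw [ae_restrict_iff' measurableSet_Ioo] at this
    refine measure_mono_null (fun x hx => ?_) (ae_iff.1 this)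
    exact fun h' => hx.2 (h' hx.1.1)
  have hNJ : ∀ x ∈ N, J x = 0 := fun x hx => by
    have : L x = R x := by
      by_contra hne; exact hx.1.2 ((h.mem_singularSet x hx.1.1).2 hne)
    rw [← h.sub_eq x, this, sub_self]
  refine hausdorffMeasure_image_eq_zero
    ((volume.restrict (Ioo a b) + volume.withDensity fun t => ENNReal.ofReal |V t|)
      + jumpMeasure J) ?_ ?_
  · have h1 : volume.restrict (Ioo a b) N = 0 :=
      le_antisymm ((Measure.restrict_apply_le _ _).trans hN0.le) zero_le
    have h2 : (volume.withDensity fun t => ENNReal.ofReal |V t|) N = 0 :=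
      withDensity_absolutelyContinuous _ _ hN0
    rw [Measure.add_apply, Measure.add_apply, h1, h2, jumpMeasure_of_forall_eq_zero hNm hNJ]
    simp
  · intro x hx y hy hxy
    have hd : dist (pt x (L x)) (pt y (L y)) ≤ (y - x) + |L y - L x| := by
      rw [dist_eq_norm, norm_plane, Real.sqrt_le_left (by positivity)]
      simp only [PiLp.sub_apply, pt_zero, pt_one]
      have := abs_nonneg (L y - L x)
      nlinarith [sq_abs (L y - L x), mul_nonneg (sub_nonneg.2 hxy) this]
    have hle := hd.trans (add_le_add le_rfl (h.abs_sub_le x y hxy))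
    rw [edist_dist]
    refine (ENNReal.ofReal_le_ofReal hle).trans ?_
    have hint0 : 0 ≤ ∫ t in x..y, |V t| :=
      intervalIntegral.integral_nonneg hxy fun _ _ => abs_nonneg _
    rw [← add_assoc, ENNReal.ofReal_add (by positivity) (measureReal_nonneg),
      ENNReal.ofReal_add (sub_nonneg.2 hxy) hint0, Measure.add_apply, Measure.add_apply]
    refine add_le_add (add_le_add ?_ ?_) ?_
    · have : Ioc x y ⊆ Ioo a b := fun z hz => ⟨hx.1.1.1.trans hz.1, hz.2.trans_lt hy.1.1.2⟩
      rw [Measure.restrict_apply measurableSet_Ioc, inter_eq_left.2 this, Real.volume_Ioc]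
    · rw [withDensity_apply _ measurableSet_Ioc, intervalIntegral.integral_of_le hxy,
        ofReal_integral_eq_lintegral_ofReal hVi.abs.integrableOn
          (Eventually.of_forall fun _ => abs_nonneg _)]
    · rw [Measure.real, ENNReal.ofReal_toReal (measure_ne_top _ _)]
      -- The increment of a left-continuous function sees the atom at the left endpoint, but x
      -- carries no jump.
      have hsub : Ico x y ⊆ Ioc x y ∪ {x} := by
        intro z hz
        rcases eq_or_lt_of_le hz.1 with h' | h'
        · exact Or.inr h'.symm
        · exact Or.inl ⟨h', hz.2.le⟩
      refine (measure_mono hsub).trans ((measure_union_le _ _).trans ?_)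
      rw [jumpMeasure_of_forall_eq_zero (measurableSet_singleton x)
        (fun z hz => by rw [mem_singleton_iff.1 hz]; exact hNJ x hx), add_zero]

lemma volume_ne_top (h : GraphData a b u L R J A) : volume A ≠ ∞ :=
  ((measure_mono h.subset).trans_lt (by simp)).ne

lemma measurable_graph (h : GraphData a b u L R J A) : Measurable fun x => pt x (L x) :=
  measurable_pt measurable_id h.measurable_left

lemma restrict_graph (h : GraphData a b u L R J A) :
    (μH[1] : Measure Plane).restrict ((fun x => pt x (L x)) '' A) =
      (lengthMeasure A L).map fun x => pt x (L x) := by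
  ext B hB
  have hB' : MeasurableSet ((fun x => pt x (L x)) ⁻¹' B) := h.measurable_graph hB
  rw [Measure.restrict_apply hB, Measure.map_apply h.measurable_graph hB, lengthMeasure,
    withDensity_apply _ hB', Measure.restrict_restrict hB', inter_comm B,
    ← image_inter_preimage, inter_comm A]
  refine hausdorffMeasure_graph h.measurable_left (hB'.inter h.measurableSet)
    (measure_ne_top_of_subset inter_subset_right h.volume_ne_top) fun x hx => ?_
  exact (h.hasDerivAt x hx.2).differentiableAt.hasDerivAt

/-- The restriction of `ℋ¹` to the extended graph. -/
theorem restrict_extendedGraph (h : GraphData a b u L R J A) :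
    (μH[1] : Measure Plane).restrict (extendedGraph a b u) =
      (lengthMeasure A L).map (fun x => pt x (L x)) +
      Measure.sum fun x : singularSet a b u =>
        (volume.restrict (uIcc (L x) (R x))).map (pt (x : ℝ)) := by
  have : Countable (singularSet a b u) := h.countable.to_subtype
  have hVm : MeasurableSet (⋃ x : singularSet a b u, vert L R x) :=
    MeasurableSet.iUnion fun x => measurableSet_vert L R x
  rw [h.extendedGraph_eq_union, Measure.restrict_union ?_ hVm]
  · congr 1
    · rw [← h.restrict_graph]
      refine Measure.restrict_congr_set ?_
      exact union_ae_eq_left_of_ae_eq_empty (ae_eq_empty.2 h.hausdorffMeasure_null)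
    · rw [Measure.restrict_iUnion]
      · congr 1; funext x
        exact hausdorffMeasure_restrict_vert x _
      · intro x y hxy
        refine disjoint_left.2 fun p hp hp' => hxy (Subtype.ext ?_)
        rw [← vert_subset L R x hp, ← vert_subset L R y hp']
      · exact fun x => measurableSet_vert L R x
  · rw [disjoint_left]
    intro p hp hp'
    obtain ⟨x, hx⟩ := mem_iUnion.1 hp'
    have hxS : p 0 ∈ singularSet a b u := by rw [vert_subset L R x hx]; exact x.2
    rcases hp with ⟨y, hy, rfl⟩ | ⟨y, hy, rfl⟩
    · exact h.disjoint _ hy hxS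
    · exact hy.1.2 hxS

lemma deriv_eq (h : GraphData a b u L R J A) {x : ℝ} (hx : x ∈ A) :
    deriv L x = sbvDeriv a b u x := (h.hasDerivAt x hx).deriv

lemma restrict_eq_restrict_Ioo (h : GraphData a b u L R J A) :
    volume.restrict A = volume.restrict (Ioo a b) := by
  refine Measure.restrict_congr_set ?_
  have := h.ae_mem
  rw [ae_restrict_iff' measurableSet_Ioo] at this
  filter_upwards [this] with x hx
  exact propext ⟨fun h' => h.subset h', fun h' => hx h'⟩

lemma isFiniteMeasure_lengthMeasure (h : GraphData a b u L R J A) :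
    IsFiniteMeasure (lengthMeasure A L) := by
  refine isFiniteMeasure_withDensity_ofReal ?_
  have hi : Integrable (fun x => 1 + |sbvDeriv a b u x|) (volume.restrict A) := by
    rw [h.restrict_eq_restrict_Ioo]
    exact (integrableOn_const (by simp)).add h.integrableOn.abs
  refine (Integrable.mono' hi
    (measurable_len_deriv L).aestronglyMeasurable ?_).2
  filter_upwards [ae_restrict_mem h.measurableSet] with x hx
  rw [Real.norm_eq_abs, abs_of_pos (len_pos _), h.deriv_eq hx]
  exact len_le _

lemma hausdorffMeasure_extendedGraph_lt_top (h : GraphData a b u L R J A) :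
    (μH[1] : Measure Plane) (extendedGraph a b u) < ∞ := by
  have := h.isFiniteMeasure_lengthMeasure
  rw [← Measure.restrict_apply_univ, h.restrict_extendedGraph, Measure.add_apply,
    Measure.sum_apply _ MeasurableSet.univ]
  refine ENNReal.add_lt_top.2 ⟨?_, ?_⟩
  · rw [Measure.map_apply h.measurable_graph MeasurableSet.univ]
    exact measure_lt_top _ _
  · have e : ∀ x : singularSet a b u, ((volume.restrict (uIcc (L x) (R x))).map (pt (x : ℝ))) univ
        = ENNReal.ofReal |J x| := by
      intro x
      rw [Measure.map_apply (isometry_pt (x : ℝ)).continuous.measurable MeasurableSet.univ,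
        preimage_univ, Measure.restrict_apply_univ, uIcc, Real.volume_Icc, max_sub_min_eq_abs',
        abs_sub_comm, h.sub_eq]
    simp_rw [e]
    have hs : Summable fun x : singularSet a b u => |J x| := h.summable.abs.subtype _
    rw [← ENNReal.ofReal_tsum_of_nonneg (fun _ => abs_nonneg _) hs]
    exact ENNReal.ofReal_lt_top

lemma ae_mem_or_mem (h : GraphData a b u L R J A) :
    ∀ᵐ p ∂((μH[1] : Measure Plane).restrict (extendedGraph a b u)),
      (p 0 ∈ A ∧ p = pt (p 0) (L (p 0))) ∨ (p 0 ∈ singularSet a b u) := by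
  rw [ae_restrict_iff' h.measurableSet_extendedGraph]
  filter_upwards [measure_eq_zero_iff_ae_notMem.1 h.hausdorffMeasure_null] with p hp hpG
  rw [h.extendedGraph_eq_union] at hpG
  rcases hpG with (⟨x, hx, rfl⟩ | hp') | hp'
  · exact Or.inl ⟨hx, rfl⟩
  · exact absurd hp' hp
  · obtain ⟨x, hx⟩ := mem_iUnion.1 hp'
    right; rw [vert_subset L R x hx]; exact x.2

lemma orient_of_notMem {p : Plane} (hp : p 0 ∉ singularSet a b u) :
    (graphCurrent a b u).orient p =
      (len (sbvDeriv a b u (p 0)))⁻¹ • pt 1 (sbvDeriv a b u (p 0)) := by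
  simp only [graphCurrent, if_neg hp]; rfl

lemma orient_of_mem (h : GraphData a b u L R J A) {p : Plane} (hp : p 0 ∈ singularSet a b u) :
    (graphCurrent a b u).orient p = pt 0 (Real.sign (R (p 0) - L (p 0))) := by
  simp only [graphCurrent, if_pos hp]
  rw [h.left_eq _ hp.1, h.right_eq _ hp.1]; rfl

lemma sign_sq_eq_one {x : ℝ} (hx : x ≠ 0) : Real.sign x = 1 ∨ Real.sign x = -1 := by
  rcases lt_or_gt_of_ne hx with h | h
  · exact Or.inr (Real.sign_of_neg h)
  · exact Or.inl (Real.sign_of_pos h)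

lemma sign_jump (h : GraphData a b u L R J A) {x : ℝ} (hx : x ∈ singularSet a b u) :
    Real.sign (R x - L x) = 1 ∨ Real.sign (R x - L x) = -1 :=
  sign_sq_eq_one (sub_ne_zero.2 ((h.mem_singularSet x hx.1).1 hx).symm)

lemma norm_orient (h : GraphData a b u L R J A) (p : Plane) :
    ‖(graphCurrent a b u).orient p‖ = 1 := by
  by_cases hp : p 0 ∈ singularSet a b u
  · rw [h.orient_of_mem hp, norm_plane]
    rcases h.sign_jump hp with e | e <;> simp [e]
  · rw [orient_of_notMem hp, norm_smul, ← len_eq_norm, norm_inv, Real.norm_eq_abs,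
      abs_of_pos (len_pos _), inv_mul_cancel₀ (len_pos _).ne']

lemma aestronglyMeasurable_orient (h : GraphData a b u L R J A) :
    AEStronglyMeasurable (graphCurrent a b u).orient
      ((μH[1] : Measure Plane).restrict (extendedGraph a b u)) := by
  classical
  have hS : MeasurableSet {p : Plane | p 0 ∈ singularSet a b u} :=
    measurable_coord 0 h.countable.measurableSet
  have hc0 := measurable_coord 0
  -- `deriv L` is Borel, while `sbvDeriv` is a chosen representative that need not be; the two agree
  -- on `A`.
  have hd : Measurable fun p : Plane => deriv L (p 0) := (measurable_deriv L).comp hc0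
  have hm : Measurable fun p : Plane => if p 0 ∈ singularSet a b u then
      pt 0 (Real.sign (R (p 0) - L (p 0))) else (len (deriv L (p 0)))⁻¹ • pt 1 (deriv L (p 0)) := by
    have hsign : Measurable Real.sign :=
      Measurable.ite measurableSet_Iio measurable_const
        (Measurable.ite measurableSet_Ioi measurable_const measurable_const)
    refine Measurable.ite hS ?_ ?_
    · exact continuous_pt.measurable.comp (measurable_const.prodMk (hsign.comp
        ((h.measurable_right.comp hc0).sub (h.measurable_left.comp hc0))))
    · exact ((measurable_len.comp hd).inv).smul
        (continuous_pt.measurable.comp (measurable_const.prodMk hd))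
  refine hm.aestronglyMeasurable.congr ?_
  filter_upwards [h.ae_mem_or_mem] with p hp
  by_cases hpS : p 0 ∈ singularSet a b u
  · rw [if_pos hpS, h.orient_of_mem hpS]
  · rw [if_neg hpS, orient_of_notMem hpS]
    rcases hp with hp | hp
    · rw [h.deriv_eq hp.1]
    · exact absurd hp hpS

lemma hasDerivAt_pt {f g : ℝ → ℝ} {f' g' x : ℝ} (hf : HasDerivAt f f' x) (hg : HasDerivAt g g' x) :
    HasDerivAt (fun x => pt (f x) (g x)) (pt f' g') x := by
  have e : ∀ s t : ℝ, pt s t = s • pt 1 0 + t • pt 0 1 := by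
    intro s t; ext i; fin_cases i <;> simp [pt]
  rw [e f' g']
  simp_rw [fun x => e (f x) (g x)]
  exact (hf.smul_const _).add (hg.smul_const _)

/-- At points where s does not determine derivatives, `derivWithin` has the default value 0, which
lies in every span. -/
lemma derivWithin_mem_span {f : ℝ → Plane} {f' w : Plane} {x : ℝ} (s : Set ℝ)
    (hf : HasDerivAt f f' x) (hw : f' ∈ Submodule.span ℝ {w}) :
    derivWithin f s x ∈ Submodule.span ℝ {w} := by
  by_cases hs : UniqueDiffWithinAt ℝ s x
  · rw [hf.hasDerivWithinAt.derivWithin hs]; exact hw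
  · rw [derivWithin_zero_of_not_uniqueDiffWithinAt hs]; exact Submodule.zero_mem _

/-- The graph current of an `SBV` function is rectifiable. -/
theorem isRectifiable (h : GraphData a b u L R J A) : (graphCurrent a b u).IsRectifiable a b where
  measurableSet := h.measurableSet_extendedGraph
  subset := fun p hp => hp.1
  mult_pos := fun p _ => one_pos
  mult_integrable := integrableOn_const h.hausdorffMeasure_extendedGraph_lt_top.ne
  orient_measurable := h.aestronglyMeasurable_orient
  orient_unit := Eventually.of_forall fun p => h.norm_orient p
  exists_cover := by
    obtain ⟨t, B, hdisj, htm, hcov, happ, -⟩ :=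
      exists_partition_approximatesLinearOn_of_hasFDerivWithinAt L A
        (fun x => ContinuousLinearMap.toSpanSingleton ℝ (sbvDeriv a b u x))
        (fun x hx => (h.hasDerivAt x hx).hasFDerivAt.hasFDerivWithinAt) (fun _ => 1)
        (fun _ => one_ne_zero)
    have happ' : ∀ n, ∀ x ∈ A ∩ t n, ∀ y ∈ A ∩ t n,
        |L x - L y - B n 1 * (x - y)| ≤ 1 * |x - y| := by
      intro n x hx y hy
      have := happ n x hx y hy
      have e : B n (x - y) = B n 1 * (x - y) := by
        rw [mul_comm, ← smul_eq_mul, ← (B n).map_smul, smul_eq_mul, mul_one]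
      rwa [e] at this
    have : Countable (singularSet a b u) := h.countable.to_subtype
    -- The cover consists of countably many Lipschitz pieces of graph, with tolerance 1 in the
    -- linear approximation, and of one vertical segment per singular point.
    obtain ⟨e, he⟩ := exists_surjective_nat (ℕ ⊕ singularSet a b u)
    let f : ℕ ⊕ singularSet a b u → ℝ → Plane :=
      Sum.elim (fun _ x => pt x (L x)) (fun x => pt (x : ℝ))
    let s : ℕ ⊕ singularSet a b u → Set ℝ :=
      Sum.elim (fun n => A ∩ t n) (fun x => uIcc (L x) (R x))
    let K : ℕ ⊕ singularSet a b u → ℝ≥0 :=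
      Sum.elim (fun n => Real.toNNReal (len (B n 1) + 1)) (fun _ => 1)
    refine ⟨fun n => f (e n), fun n => s (e n), fun n => K (e n), fun n => ?_, ?_⟩
    · have hsub := h.extendedGraph_eq_union
      beta_reduce
      rcases e n with m | x
      · refine ⟨h.measurableSet.inter (htm m), ?_, ?_, ?_⟩
        · refine LipschitzOnWith.of_dist_le_mul fun x hx y hy => ?_
          change dist (pt x (L x)) (pt y (L y)) ≤ (Real.toNNReal (len (B m 1) + 1) : ℝ) * |x - y|
          rw [Real.coe_toNNReal _ (by linarith [len_pos (B m 1)])]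
          exact dist_graph_le (happ' m x hx y hy)
        · change (fun x => pt x (L x)) '' (A ∩ t m) ⊆ extendedGraph a b u
          rw [hsub]
          exact (image_mono inter_subset_left).trans
            (subset_union_left.trans subset_union_left)
        · refine ae_restrict_of_forall_mem (h.measurableSet.inter (htm m)) fun τ hτ => ?_
          refine derivWithin_mem_span _ (hasDerivAt_pt (hasDerivAt_id τ) (h.hasDerivAt τ hτ.1)) ?_
          rw [orient_of_notMem (show (f (Sum.inl m) τ) 0 ∉ _ from h.disjoint τ hτ.1)]
          refine Submodule.mem_span_singleton.2 ⟨len (sbvDeriv a b u τ), ?_⟩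
          change len (sbvDeriv a b u τ) • (len (sbvDeriv a b u τ))⁻¹ • pt 1 (sbvDeriv a b u τ) = _
          rw [smul_smul, mul_inv_cancel₀ (len_pos _).ne', one_smul]
      · refine ⟨measurableSet_uIcc, ?_, ?_, ?_⟩
        · exact (isometry_pt (x : ℝ)).lipschitz.lipschitzOnWith
        · change vert L R x ⊆ extendedGraph a b u
          rw [hsub]
          exact (subset_iUnion (fun x : singularSet a b u => vert L R x) x).trans
            subset_union_right
        · refine ae_restrict_of_forall_mem measurableSet_uIcc fun τ hτ => ?_
          refine derivWithin_mem_span _ (hasDerivAt_pt (hasDerivAt_const τ (x : ℝ))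
            (hasDerivAt_id τ)) ?_
          rw [h.orient_of_mem (show (f (Sum.inr x) τ) 0 ∈ _ from x.2)]
          refine Submodule.mem_span_singleton.2 ⟨Real.sign (R x - L x), ?_⟩
          change Real.sign (R x - L x) • pt 0 (Real.sign (R x - L x)) = _
          ext i
          fin_cases i
          · simp [pt]
          · rcases h.sign_jump x.2 with e | e <;> simp [e]
    · refine measure_mono_null ?_ h.hausdorffMeasure_null
      rintro p ⟨hp, hp'⟩
      change p ∈ extendedGraph a b u at hp
      rw [h.extendedGraph_eq_union] at hp
      rcases hp with (⟨x, hx, rfl⟩ | hp) | hp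
      · obtain ⟨m, hm⟩ := mem_iUnion.1 (hcov hx)
        obtain ⟨n, hn⟩ := he (Sum.inl m)
        refine absurd (mem_iUnion.2 ⟨n, ?_⟩) hp'
        beta_reduce; rw [hn]; exact ⟨x, ⟨hx, hm⟩, rfl⟩
      · exact hp
      · obtain ⟨x, hx⟩ := mem_iUnion.1 hp
        obtain ⟨n, hn⟩ := he (Sum.inr x)
        refine absurd (mem_iUnion.2 ⟨n, ?_⟩) hp'
        beta_reduce; rw [hn]; exact hx

end GraphData

lemma graphCurrent_mem_graphCone {a b : ℝ} (hab : a < b) {u : ℝ → ℝ} (hu : MemSBV a b u) :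
    graphCurrent a b u ∈ graphCone a b := by
  obtain ⟨L, R, J, A, h⟩ := hu.exists_graphData hab
  exact ⟨h.isRectifiable, 1, fun _ => 1, fun _ => u, fun _ => one_pos, fun _ => hu,
    fun ω _ => by simp⟩

/-! ### Integration along graph currents -/

lemma inner_plane (p q : Plane) : inner ℝ p q = p 0 * q 0 + p 1 * q 1 := by
  rw [PiLp.inner_apply, Fin.sum_univ_two]
  simp [mul_comm]

lemma inner_normal (T : CurrentTriple) (q p : Plane) :
    inner ℝ q (T.normal p) = q 0 * T.orient p 1 - q 1 * T.orient p 0 := by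
  rw [inner_plane, CurrentTriple.normal]
  simp; ring

lemma abs_coord_le_norm (p : Plane) (i : Fin 2) : |p i| ≤ ‖p‖ := by
  simpa using PiLp.norm_apply_le p i

lemma abs_inner_normal_le (T : CurrentTriple) {q p : Plane} {M : ℝ} (h0 : |q 0| ≤ M)
    (h1 : |q 1| ≤ M) (hp : ‖T.orient p‖ = 1) : |inner ℝ q (T.normal p)| ≤ 2 * M := by
  rw [inner_normal]
  have e0 := abs_coord_le_norm (T.orient p) 0
  have e1 := abs_coord_le_norm (T.orient p) 1
  rw [hp] at e0 e1
  have hM : 0 ≤ M := (abs_nonneg _).trans h0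
  refine (abs_sub _ _).trans ?_
  rw [abs_mul, abs_mul]
  have := mul_le_mul h0 e1 (abs_nonneg _) hM
  have := mul_le_mul h1 e0 (abs_nonneg _) hM
  linarith

lemma aestronglyMeasurable_inner_normal {T : CurrentTriple} {μ : Measure Plane}
    (hT : AEStronglyMeasurable T.orient μ) {φ : Plane → Plane} (hφ : Measurable φ) :
    AEStronglyMeasurable (fun p => inner ℝ (φ p) (T.normal p)) μ := by
  simp_rw [inner_normal]
  have hc : ∀ i : Fin 2, AEStronglyMeasurable (fun p => T.orient p i) μ := fun i =>
    (EuclideanSpace.proj (𝕜 := ℝ) i).continuous.comp_aestronglyMeasurable hT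
  have hm : ∀ i : Fin 2, AEStronglyMeasurable (fun p => φ p i) μ := fun i =>
    ((measurable_coord i).comp hφ).aestronglyMeasurable
  exact ((hm 0).mul (hc 1)).sub ((hm 1).mul (hc 0))

namespace GraphData

variable {a b : ℝ} {u L R J : ℝ → ℝ} {A : Set ℝ}

lemma inner_normal_graph (h : GraphData a b u L R J A) (φ : Plane → Plane) {x : ℝ} (hx : x ∈ A) :
    len (sbvDeriv a b u x) * inner ℝ (φ (pt x (L x))) ((graphCurrent a b u).normal (pt x (L x))) =
      φ (pt x (L x)) 0 * sbvDeriv a b u x - φ (pt x (L x)) 1 := by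
  rw [inner_normal, orient_of_notMem (show pt x (L x) 0 ∉ _ from h.disjoint x hx)]
  simp only [pt_zero, PiLp.smul_apply, pt_one, smul_eq_mul]
  field_simp [(len_pos (sbvDeriv a b u x)).ne']

lemma inner_normal_vert (h : GraphData a b u L R J A) (φ : Plane → Plane) {x : ℝ}
    (hx : x ∈ singularSet a b u) (t : ℝ) :
    inner ℝ (φ (pt x t)) ((graphCurrent a b u).normal (pt x t)) =
      Real.sign (R x - L x) * φ (pt x t) 0 := by
  rw [inner_normal, h.orient_of_mem (show pt x t 0 ∈ _ from hx)]
  simp [mul_comm]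

/-- The sign coming from the orientation of the segment converts the integral over an unordered
interval into an oriented one. -/
lemma integral_vert (_h : GraphData a b u L R J A) (f : ℝ → ℝ) (x : ℝ) :
    ∫ t in uIcc (L x) (R x), Real.sign (R x - L x) * f t = ∫ t in L x..R x, f t := by
  rw [integral_const_mul]
  rcases lt_trichotomy (L x) (R x) with hlt | heq | hgt
  · rw [Real.sign_of_pos (sub_pos.2 hlt), uIcc_of_le hlt.le, integral_Icc_eq_integral_Ioc,
      intervalIntegral.integral_of_le hlt.le, one_mul]
  · simp [heq]
  · rw [Real.sign_of_neg (sub_neg.2 hgt), uIcc_of_ge hgt.le, integral_Icc_eq_integral_Ioc,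
      intervalIntegral.integral_of_ge hgt.le]; ring

lemma integral_map_lengthMeasure (h : GraphData a b u L R J A) {φ : Plane → Plane}
    (hφ : Measurable φ) :
    ∫ p, inner ℝ (φ p) ((graphCurrent a b u).normal p)
        ∂((lengthMeasure A L).map fun x => pt x (L x)) =
      ∫ x in Ioo a b, (φ (pt x (L x)) 0 * sbvDeriv a b u x - φ (pt x (L x)) 1) := by
  have hm := aestronglyMeasurable_inner_normal h.aestronglyMeasurable_orient hφ
  rw [h.restrict_extendedGraph] at hm
  rw [integral_map h.measurable_graph.aemeasurable (hm.mono_measure (Measure.le_add_right le_rfl)),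
    lengthMeasure, integral_withDensity_eq_integral_toReal_smul
      (measurable_len_deriv L).ennreal_ofReal (by simp), ← h.restrict_eq_restrict_Ioo]
  refine setIntegral_congr_fun h.measurableSet fun x hx => ?_
  simp only [smul_eq_mul]
  rw [ENNReal.toReal_ofReal (len_pos _).le, h.deriv_eq hx]
  exact h.inner_normal_graph φ hx

lemma integrableOn_inner_normal (h : GraphData a b u L R J A) {φ : Plane → Plane}
    (hφ : Measurable φ) {M : ℝ} (hM : ∀ p, |φ p 0| ≤ M ∧ |φ p 1| ≤ M) :
    IntegrableOn (fun p => inner ℝ (φ p) ((graphCurrent a b u).normal p))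
      (extendedGraph a b u) (μH[1] : Measure Plane) := by
  have : IsFiniteMeasure ((μH[1] : Measure Plane).restrict (extendedGraph a b u)) :=
    ⟨by rw [Measure.restrict_apply_univ]; exact h.hausdorffMeasure_extendedGraph_lt_top⟩
  exact Integrable.of_bound
    (aestronglyMeasurable_inner_normal h.aestronglyMeasurable_orient hφ) (2 * M)
    (Eventually.of_forall fun p => abs_inner_normal_le _ (hM p).1 (hM p).2 (h.norm_orient p))

/-- The flux of a bounded field through an extended graph. -/
theorem integral_extendedGraph (h : GraphData a b u L R J A) {φ : Plane → Plane}
    (hφ : Measurable φ) {M : ℝ} (hM : ∀ p, |φ p 0| ≤ M ∧ |φ p 1| ≤ M) :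
    ∫ p in extendedGraph a b u, inner ℝ (φ p) ((graphCurrent a b u).normal p) ∂μH[1] =
      (∫ x in Ioo a b, (φ (pt x (L x)) 0 * sbvDeriv a b u x - φ (pt x (L x)) 1)) +
      ∑' x : singularSet a b u, ∫ t in L x..R x, φ (pt x t) 0 := by
  have hi := h.integrableOn_inner_normal hφ hM
  rw [IntegrableOn, h.restrict_extendedGraph] at hi
  have hi2 := hi.mono_measure (Measure.le_add_left le_rfl :
    (Measure.sum fun x : singularSet a b u =>
        (volume.restrict (uIcc (L x) (R x))).map (pt (x : ℝ))) ≤ _)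
  have hi1 := hi.mono_measure (Measure.le_add_right le_rfl :
    ((lengthMeasure A L).map fun x => pt x (L x)) ≤ _)
  rw [h.restrict_extendedGraph, integral_add_measure hi1 hi2, h.integral_map_lengthMeasure hφ,
    integral_sum_measure hi2]
  congr 1
  refine tsum_congr fun x => ?_
  rw [integral_map (isometry_pt (x : ℝ)).continuous.measurable.aemeasurable
    (hi2.1.mono_measure (Measure.le_sum (fun x : singularSet a b u =>
        (volume.restrict (uIcc (L x) (R x))).map (pt (x : ℝ))) x)),
    ← h.integral_vert]
  refine integral_congr_ae (Eventually.of_forall fun t => ?_)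
  exact h.inner_normal_vert φ x.2 t

/-- The flux of a bounded field which is essentially vertical outside finitely many lines. -/
theorem integral_extendedGraph_of_finset (h : GraphData a b u L R J A) {φ : Plane → Plane}
    (hφ : Measurable φ) {M : ℝ} (hM : ∀ p, |φ p 0| ≤ M ∧ |φ p 1| ≤ M) {E : Finset ℝ}
    (hE : ∀ x ∈ E, x ∈ Ioo a b) (hφE : ∀ x, x ∉ E → ∀ᵐ t, φ (pt x t) 0 = 0) :
    ∫ p in extendedGraph a b u, inner ℝ (φ p) ((graphCurrent a b u).normal p) ∂μH[1] =
      (∫ x in Ioo a b, (φ (pt x (L x)) 0 * sbvDeriv a b u x - φ (pt x (L x)) 1)) +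
      ∑ x ∈ E, ∫ t in L x..R x, φ (pt x t) 0 := by
  rw [h.integral_extendedGraph hφ hM]
  congr 1
  -- G vanishes off the singular set because the traces coincide there, and off E because the field
  -- is vertical almost everywhere on such lines. So the sums over the two sets are equal.
  set G : ℝ → ℝ := fun x => (Ioo a b).indicator (fun x => ∫ t in L x..R x, φ (pt x t) 0) x with hG
  have hGE : ∀ x ∉ E, G x = 0 := by
    intro x hx
    refine indicator_apply_eq_zero.2 fun _ => ?_
    refine intervalIntegral.integral_zero_ae ?_
    filter_upwards [hφE x hx] with t ht _ using ht
  have hGS : ∀ x ∉ singularSet a b u, G x = 0 := by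
    intro x hx
    refine indicator_apply_eq_zero.2 fun hxI => ?_
    have : L x = R x := by
      by_contra hne; exact hx ((h.mem_singularSet x hxI).2 hne)
    rw [this, intervalIntegral.integral_same]
  have e1 : ∑' x : singularSet a b u, ∫ t in L x..R x, φ (pt x t) 0 =
      ∑' x : singularSet a b u, G x := by
    refine tsum_congr fun x => ?_
    rw [hG]; exact (indicator_of_mem x.2.1 (fun x => ∫ t in L x..R x, φ (pt x t) 0)).symm
  rw [e1, tsum_subtype_eq_of_support_subset (f := G), tsum_eq_sum hGE]
  · refine Finset.sum_congr rfl fun x hx => ?_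
    exact indicator_of_mem (hE x hx) _
  · intro x hx
    by_contra hxS
    exact hx (hGS x hxS)

end GraphData

/-! ### Currents are determined by their action on test forms -/

/-- The density of a current with respect to `ℋ¹`. -/
def CurrentTriple.density (T : CurrentTriple) : Plane → Plane :=
  T.carrier.indicator fun p => T.mult p • T.orient p

lemma CurrentTriple.IsRectifiable.integrable_density {a b : ℝ} {T : CurrentTriple}
    (h : T.IsRectifiable a b) : Integrable T.density (μH[1] : Measure Plane) := by
  rw [CurrentTriple.density, integrable_indicator_iff h.measurableSet]
  refine Integrable.mono h.mult_integrable
    (h.mult_integrable.1.smul h.orient_measurable) ?_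
  filter_upwards [h.orient_unit] with p hp
  rw [norm_smul, hp, mul_one]

lemma measurableSet_cylinder {B : Set ℝ} (hB : MeasurableSet B) : MeasurableSet (cylinder B) :=
  measurable_coord 0 hB

lemma CurrentTriple.action_restrict {T : CurrentTriple} {B : Set Plane}
    (hT : MeasurableSet T.carrier) (hB : MeasurableSet B) (ω : Plane → Plane) :
    (T.restrict B).action ω =
      ∫ p, inner ℝ (ω p) (B.indicator T.density p) ∂(μH[1] : Measure Plane) := by
  rw [CurrentTriple.action, CurrentTriple.restrict, ← integral_indicator (hT.inter hB)]
  refine integral_congr_ae (Eventually.of_forall fun p => ?_)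
  by_cases h1 : p ∈ T.carrier <;> by_cases h2 : p ∈ B <;>
    simp [CurrentTriple.density, indicator, h1, h2, inner_smul_right, mul_comm]

lemma CurrentTriple.action_eq {T : CurrentTriple} (hT : MeasurableSet T.carrier)
    (ω : Plane → Plane) :
    T.action ω = ∫ p, inner ℝ (ω p) (T.density p) ∂(μH[1] : Measure Plane) := by
  have := T.action_restrict hT MeasurableSet.univ ω
  simpa [CurrentTriple.restrict, CurrentTriple.action] using this

lemma IsTestForm.integrable_inner {a b : ℝ} {ω f : Plane → Plane} (hω : IsTestForm a b ω)
    (hf : Integrable f (μH[1] : Measure Plane)) :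
    Integrable (fun p => inner ℝ (ω p) (f p)) (μH[1] : Measure Plane) := by
  obtain ⟨M, hM⟩ := hω.2.1.exists_bound_of_continuous hω.1.continuous
  refine Integrable.mono' (hf.norm.const_mul M)
    (hω.1.continuous.aestronglyMeasurable.inner hf.1) (Eventually.of_forall fun p => ?_)
  exact (norm_inner_le_norm _ _).trans (mul_le_mul_of_nonneg_right (hM p) (norm_nonneg _))

/-- An integrable vector field orthogonal to all test forms vanishes. -/
theorem ae_eq_zero_of_forall_isTestForm {a b : ℝ} {f : Plane → Plane}
    (hf : Integrable f (μH[1] : Measure Plane))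
    (h : ∀ ω, IsTestForm a b ω → ∫ p, inner ℝ (ω p) (f p) ∂(μH[1] : Measure Plane) = 0) :
    ∀ᵐ p ∂(μH[1] : Measure Plane), p ∈ cylinder (Ioo a b) → f p = 0 := by
  have ho : IsOpen (cylinder (Ioo a b)) :=
    isOpen_Ioo.preimage (EuclideanSpace.proj (𝕜 := ℝ) (0 : Fin 2)).continuous
  -- ℋ¹ is not locally finite on the plane; local integrability of f is what this form of the
  -- fundamental lemma uses. The vector-valued integral is tested against each constant direction w.
  refine ho.ae_eq_zero_of_integral_contDiff_smul_eq_zero (hf.locallyIntegrable.locallyIntegrableOn _) ?_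
  intro g hg hgc hgs
  have hgf : Integrable (fun p => g p • f p) (μH[1] : Measure Plane) := by
    obtain ⟨M, hM⟩ := hgc.exists_bound_of_continuous hg.continuous
    refine Integrable.mono' (hf.norm.const_mul M)
      (hg.continuous.aestronglyMeasurable.smul hf.1) (Eventually.of_forall fun p => ?_)
    rw [norm_smul]
    exact mul_le_mul_of_nonneg_right (hM p) (norm_nonneg _)
  refine ext_inner_left ℝ fun w => ?_
  rw [inner_zero_right, ← integral_inner hgf]
  have hω : IsTestForm a b fun p => g p • w := by
    refine ⟨hg.smul contDiff_const, hgc.smul_right, ?_⟩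
    exact (tsupport_smul_subset_left _ _).trans hgs
  rw [← h _ hω]
  refine integral_congr_ae (Eventually.of_forall fun p => ?_)
  simp only [real_inner_smul_left, inner_smul_right]

lemma density_eq_zero {a b : ℝ} {T : CurrentTriple} (hT : T.IsRectifiable a b) {p : Plane}
    (hp : p ∉ cylinder (Ioo a b)) : T.density p = 0 :=
  indicator_of_notMem (fun h => hp (hT.subset h)) _

/-- The density of a combination of graph currents. -/
theorem density_ae_eq_sum {a b : ℝ} (hab : a < b) {T : CurrentTriple} (hT : T.IsRectifiable a b)
    {k : ℕ} {lam : Fin k → ℝ} {u : Fin k → ℝ → ℝ} (hu : ∀ i, MemSBV a b (u i))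
    (h : ∀ ω : Plane → Plane, IsTestForm a b ω →
        T.action ω = ∑ i, lam i * (graphCurrent a b (u i)).action ω) :
    ∀ᵐ p ∂(μH[1] : Measure Plane),
      T.density p = ∑ i, lam i • (graphCurrent a b (u i)).density p := by
  have hr : ∀ i, (graphCurrent a b (u i)).IsRectifiable a b := fun i => by
    obtain ⟨L, R, J, A, h⟩ := (hu i).exists_graphData hab
    exact h.isRectifiable
  have hI : Integrable (fun p => ∑ i, lam i • (graphCurrent a b (u i)).density p)
      (μH[1] : Measure Plane) :=
    integrable_finsetSum _ fun i _ => (hr i).integrable_density.smul (lam i)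
  have := ae_eq_zero_of_forall_isTestForm (a := a) (b := b) (hT.integrable_density.sub hI) ?_
  · filter_upwards [this] with p hp
    by_cases hpc : p ∈ cylinder (Ioo a b)
    · exact sub_eq_zero.1 (hp hpc)
    · rw [density_eq_zero hT hpc]
      simp [fun i => density_eq_zero (hr i) hpc]
  · intro ω hω
    simp only [Pi.sub_apply, inner_sub_right]
    rw [integral_sub (hω.integrable_inner hT.integrable_density) (hω.integrable_inner hI),
      ← CurrentTriple.action_eq hT.measurableSet, h ω hω, sub_eq_zero]
    simp only [inner_sum, inner_smul_right]
    rw [integral_finsetSum _ fun i _ =>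
      (hω.integrable_inner (hr i).integrable_density).const_mul (lam i)]
    refine Finset.sum_congr rfl fun i _ => ?_
    rw [integral_const_mul, CurrentTriple.action_eq (hr i).measurableSet]

/-- Currents which agree over `B` have the same density over `B`. -/
theorem density_ae_eq_of_sameCurrent {a b : ℝ} {S T : CurrentTriple}
    (hS : S.IsRectifiable a b) (hT : T.IsRectifiable a b) {B : Set ℝ} (hB : MeasurableSet B)
    (h : SameCurrent a b (T.restrict (cylinder B)) (S.restrict (cylinder B))) :
    ∀ᵐ p ∂(μH[1] : Measure Plane), p ∈ cylinder B → T.density p = S.density p := by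
  have hBm := measurableSet_cylinder hB
  have iT := hT.integrable_density.indicator hBm
  have iS := hS.integrable_density.indicator hBm
  have := ae_eq_zero_of_forall_isTestForm (a := a) (b := b) (iT.sub iS) ?_
  · filter_upwards [this] with p hp hpB
    by_cases hpc : p ∈ cylinder (Ioo a b)
    · have := hp hpc
      rw [Pi.sub_apply, indicator_of_mem hpB, indicator_of_mem hpB] at this
      exact sub_eq_zero.1 this
    · rw [density_eq_zero hT hpc, density_eq_zero hS hpc]
  · intro ω hω
    simp only [Pi.sub_apply, inner_sub_right]
    rw [integral_sub (hω.integrable_inner iT) (hω.integrable_inner iS), sub_eq_zero,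
      ← CurrentTriple.action_restrict hT.measurableSet hBm,
      ← CurrentTriple.action_restrict hS.measurableSet hBm]
    exact h ω hω

/-! ### The flux of a bounded field through a combination of graphs -/

lemma extIntegral_of_integrable {μ : Measure Plane} {f : Plane → ℝ} (hf : Integrable f μ) :
    extIntegral μ f = ((∫ p, f p ∂μ : ℝ) : EReal) := by
  have h2 : ∫⁻ p, ENNReal.ofReal (-f p) ∂μ < ∞ := hf.neg.lintegral_lt_top
  rw [extIntegral, integral_eq_lintegral_pos_part_sub_lintegral_neg_part hf, EReal.coe_sub,
    EReal.coe_ennreal_toReal hf.lintegral_lt_top.ne, EReal.coe_ennreal_toReal h2.ne]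

lemma mult_mul_inner_normal (T : CurrentTriple) (q p : Plane) (hp : p ∈ T.carrier) :
    T.mult p * inner ℝ q (T.normal p) = q 0 * T.density p 1 - q 1 * T.density p 0 := by
  rw [inner_normal, CurrentTriple.density, indicator_of_mem hp]
  simp only [PiLp.smul_apply, smul_eq_mul]; ring

lemma integrable_cross {f φ : Plane → Plane} (hf : Integrable f (μH[1] : Measure Plane))
    (hφ : Measurable φ) {M : ℝ} (hM : ∀ p, |φ p 0| ≤ M ∧ |φ p 1| ≤ M) :
    Integrable (fun p => φ p 0 * f p 1 - φ p 1 * f p 0) (μH[1] : Measure Plane) := by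
  have hc : ∀ i : Fin 2, Integrable (fun p => f p i) (μH[1] : Measure Plane) := fun i =>
    (EuclideanSpace.proj (𝕜 := ℝ) i).integrable_comp hf
  have hm : ∀ i : Fin 2, AEStronglyMeasurable (fun p => φ p i) (μH[1] : Measure Plane) := fun i =>
    ((measurable_coord i).comp hφ).aestronglyMeasurable
  exact ((hc 1).bdd_mul (hm 0) (Eventually.of_forall fun p => (hM p).1)).sub
    ((hc 0).bdd_mul (hm 1) (Eventually.of_forall fun p => (hM p).2))

/-- In this form the flux is linear in the density, which the current determines almost everywhere;
this makes fluxes additive over combinations of graphs. -/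
lemma CurrentTriple.IsRectifiable.setIntegral_eq {a b : ℝ} {T : CurrentTriple}
    (hT : T.IsRectifiable a b) (φ : Plane → Plane) :
    ∫ p in T.carrier, T.mult p * inner ℝ (φ p) (T.normal p) ∂(μH[1] : Measure Plane) =
      ∫ p, (φ p 0 * T.density p 1 - φ p 1 * T.density p 0) ∂(μH[1] : Measure Plane) := by
  rw [← integral_indicator hT.measurableSet]
  refine integral_congr_ae (Eventually.of_forall fun p => ?_)
  by_cases hp : p ∈ T.carrier
  · simp only [indicator_of_mem hp, mult_mul_inner_normal T (φ p) p hp]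
  · simp [indicator_of_notMem hp, CurrentTriple.density]

lemma CurrentTriple.IsRectifiable.integrableOn_flux {a b : ℝ} {T : CurrentTriple}
    (hT : T.IsRectifiable a b) {φ : Plane → Plane}
    (hφ : Measurable φ) {M : ℝ} (hM : ∀ p, |φ p 0| ≤ M ∧ |φ p 1| ≤ M) :
    IntegrableOn (fun p => T.mult p * inner ℝ (φ p) (T.normal p)) T.carrier
      (μH[1] : Measure Plane) := by
  refine (integrable_cross hT.integrable_density hφ hM).integrableOn.congr_fun
    (fun p hp => ?_) hT.measurableSet
  exact (mult_mul_inner_normal T (φ p) p hp).symm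

lemma integral_cross_graphCurrent {a b : ℝ} (hab : a < b) {u : ℝ → ℝ} (hu : MemSBV a b u)
    (φ : Plane → Plane) :
    ∫ p, (φ p 0 * (graphCurrent a b u).density p 1 - φ p 1 * (graphCurrent a b u).density p 0)
        ∂(μH[1] : Measure Plane) =
      ∫ p in extendedGraph a b u, inner ℝ (φ p) ((graphCurrent a b u).normal p) ∂μH[1] := by
  obtain ⟨L, R, J, A, h⟩ := hu.exists_graphData hab
  rw [← h.isRectifiable.setIntegral_eq]
  simp [graphCurrent]

/-- The value of the flux of a bounded admissible field bounds the lift from below. -/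
theorem flux_le_lift {a b α β : ℝ} (hab : a < b) {g : ℝ → ℝ} {T : CurrentTriple}
    (hT : T.IsRectifiable a b)
    {k : ℕ} {lam : Fin k → ℝ} {u : Fin k → ℝ → ℝ} (hu : ∀ i, MemSBV a b (u i))
    (h : ∀ ω : Plane → Plane, IsTestForm a b ω →
        T.action ω = ∑ i, lam i * (graphCurrent a b (u i)).action ω)
    {φ : Plane → Plane} (hφ : φ ∈ admissibleFields a b α β g) {M : ℝ}
    (hM : ∀ p, |φ p 0| ≤ M ∧ |φ p 1| ≤ M) :
    ((∑ i, lam i * ∫ p in extendedGraph a b (u i),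
      inner ℝ (φ p) ((graphCurrent a b (u i)).normal p) ∂μH[1] : ℝ) : EReal) ≤
      lift a b α β g T := by
  have hr : ∀ i, (graphCurrent a b (u i)).IsRectifiable a b := fun i => by
    obtain ⟨L, R, J, A, h⟩ := (hu i).exists_graphData hab
    exact h.isRectifiable
  refine le_trans (le_of_eq ?_) (le_iSup₂ (f := fun φ (_ : φ ∈ admissibleFields a b α β g) =>
    extIntegral ((μH[1] : Measure Plane).restrict T.carrier)
      fun p => T.mult p * inner ℝ (φ p) (T.normal p)) φ hφ)
  rw [extIntegral_of_integrable (hT.integrableOn_flux hφ.1 hM), hT.setIntegral_eq]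
  congr 1
  simp_rw [← integral_cross_graphCurrent hab (hu _), ← integral_const_mul]
  rw [← integral_finsetSum _ fun i _ =>
    (integrable_cross (hr i).integrable_density hφ.1 hM).const_mul (lam i)]
  refine integral_congr_ae ?_
  filter_upwards [density_ae_eq_sum hab hT hu h] with p hp
  rw [hp]
  simp only [WithLp.ofLp_sum, WithLp.ofLp_smul, Finset.sum_apply, Pi.smul_apply, smul_eq_mul,
    Finset.mul_sum, ← Finset.sum_sub_distrib]
  refine Finset.sum_congr rfl fun i _ => by ring

/-- If a combination of graphs agrees with the graph of `u` over a set `B` of positive measure,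
then the weights sum to one and all functions agree with `u` on `B`. -/
theorem eq_of_sameCurrent {a b : ℝ} (hab : a < b) {T : CurrentTriple}
    (hT : T.IsRectifiable a b)
    {k : ℕ} {lam : Fin k → ℝ} {u : Fin k → ℝ → ℝ} (hlam : ∀ i, 0 < lam i)
    (hu : ∀ i, MemSBV a b (u i))
    (h : ∀ ω : Plane → Plane, IsTestForm a b ω →
        T.action ω = ∑ i, lam i * (graphCurrent a b (u i)).action ω)
    {w : ℝ → ℝ} (hw : MemSBV a b w) {B : Set ℝ} (hB : MeasurableSet B) (hBI : B ⊆ Ioo a b)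
    (hB0 : volume B ≠ 0)
    (hs : SameCurrent a b (T.restrict (cylinder B)) ((graphCurrent a b w).restrict (cylinder B))) :
    ∑ i, lam i = 1 ∧ ∀ i, ∀ᵐ x ∂(volume.restrict B), u i x = w x := by
  classical
  choose L R J A hg using fun i => (hu i).exists_graphData hab
  obtain ⟨Lw, Rw, Jw, Aw, hgw⟩ := hw.exists_graphData hab
  have hBfin : volume B ≠ ∞ := measure_ne_top_of_subset hBI (by simp)
  have key : ∀ E : Set Plane, MeasurableSet E →
      ∑ i, lam i * volume.real (B ∩ {x | pt x (L i x) ∈ E}) =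
        volume.real (B ∩ {x | pt x (Lw x) ∈ E}) := by
    intro E hE
    -- A downward vertical field on part of the plane: its flux through a graph counts the length of
    -- the set of x in B over which the graph lies in E.
    set φ : Plane → Plane := (E ∩ cylinder B).indicator fun _ => pt 0 (-1) with hφdef
    have hEB := hE.inter (measurableSet_cylinder hB)
    have hφ : Measurable φ := measurable_const.indicator hEB
    have hM : ∀ p, |φ p 0| ≤ 1 ∧ |φ p 1| ≤ 1 := by
      intro p
      by_cases hp : p ∈ E ∩ cylinder B
      · rw [hφdef, indicator_of_mem hp]; simp
      · rw [hφdef, indicator_of_notMem hp]; simp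
    have hφ0 : ∀ p, φ p 0 = 0 := by
      intro p
      by_cases hp : p ∈ E ∩ cylinder B
      · rw [hφdef, indicator_of_mem hp]; simp
      · rw [hφdef, indicator_of_notMem hp]; simp
    have flux : ∀ {v L R J : ℝ → ℝ} {A : Set ℝ}, GraphData a b v L R J A →
        ∫ p in extendedGraph a b v, inner ℝ (φ p) ((graphCurrent a b v).normal p) ∂μH[1] =
          volume.real (B ∩ {x | pt x (L x) ∈ E}) := by
      intro v L R J A hg
      rw [hg.integral_extendedGraph_of_finset hφ hM (E := ∅) (by simp)
        (fun x _ => Eventually.of_forall fun t => hφ0 _)]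
      have hm : MeasurableSet (B ∩ {x | pt x (L x) ∈ E}) := hB.inter (hg.measurable_graph hE)
      have e : ∀ x, φ (pt x (L x)) 0 * sbvDeriv a b v x - φ (pt x (L x)) 1 =
          (B ∩ {x | pt x (L x) ∈ E}).indicator (fun _ => (1 : ℝ)) x := by
        intro x
        rw [hφ0, hφdef]
        by_cases h1 : x ∈ B <;> by_cases h2 : pt x (L x) ∈ E <;>
          simp [indicator, cylinder, h1, h2]
      simp_rw [e]
      rw [setIntegral_indicator hm, inter_eq_right.2 (inter_subset_left.trans hBI)]
      simp
    have hr : ∀ i, (graphCurrent a b (u i)).IsRectifiable a b := fun i => (hg i).isRectifiable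
    rw [← flux hgw, ← integral_cross_graphCurrent hab hw]
    simp_rw [← flux (hg _), ← integral_cross_graphCurrent hab (hu _), ← integral_const_mul]
    rw [← integral_finsetSum _ fun i _ =>
      (integrable_cross (hr i).integrable_density hφ hM).const_mul (lam i)]
    refine integral_congr_ae ?_
    filter_upwards [density_ae_eq_sum hab hT hu h,
      density_ae_eq_of_sameCurrent hgw.isRectifiable hT hB hs] with p hp hp2
    by_cases hpB : p ∈ cylinder B
    · rw [← hp2 hpB, hp]
      simp only [WithLp.ofLp_sum, WithLp.ofLp_smul, Finset.sum_apply, Pi.smul_apply, smul_eq_mul,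
    Finset.mul_sum, ← Finset.sum_sub_distrib]
      refine Finset.sum_congr rfl fun i _ => by ring
    · have : φ p = 0 := by rw [hφdef]; exact indicator_of_notMem (fun h => hpB h.2) _
      simp [this]
  have hBpos : 0 < volume.real B := ENNReal.toReal_pos hB0 hBfin
  constructor
  · have := key univ MeasurableSet.univ
    simp only [mem_univ, ofPred_true, inter_univ] at this
    rw [← Finset.sum_mul] at this
    exact mul_right_cancel₀ hBpos.ne' (by rw [this, one_mul])
  · intro i
    -- Off the graph of w the right side of `key` is zero, and a vanishing sum of nonnegative terms
    -- has vanishing terms. Here the positivity of the weights is essential.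
    have hE : MeasurableSet {p : Plane | p 1 ≠ Lw (p 0)} :=
      (measurableSet_eq_fun (measurable_coord 1)
        (hgw.measurable_left.comp (measurable_coord 0))).compl
    have := key _ hE
    have e0 : B ∩ {x | pt x (Lw x) ∈ {p : Plane | p 1 ≠ Lw (p 0)}} = ∅ := by
      ext x; simp
    rw [e0, measureReal_empty, Finset.sum_eq_zero_iff_of_nonneg
      fun i _ => mul_nonneg (hlam i).le measureReal_nonneg] at this
    have h1 := (mul_eq_zero.1 (this i (Finset.mem_univ i))).resolve_left (hlam i).ne'
    rw [measureReal_eq_zero_iff (measure_ne_top_of_subset inter_subset_left hBfin)] at h1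
    have h2 : ∀ᵐ x ∂(volume.restrict B), L i x = Lw x := by
      rw [ae_restrict_iff' hB]
      filter_upwards [measure_eq_zero_iff_ae_notMem.1 h1] with x hx hxB
      by_contra hne
      exact hx ⟨hxB, hne⟩
    filter_upwards [h2, ae_restrict_of_ae_restrict_of_subset hBI (hg i).ae_eq,
      ae_restrict_of_ae_restrict_of_subset hBI hgw.ae_eq] with x e1 e2 e3
    rw [e2, e1, e3]

/-! ### The lift of a graph is at most the energy -/

/-- Infinitely many jumps make the energy infinite. Otherwise the flux through the finitely many
vertical segments is an honest integral of at most α each, while over the graph only the positive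
part has to be bounded. -/
theorem lift_graphCurrent_le {a b α β : ℝ} (hab : a < b) (hα : 0 < α) (hβ : 0 ≤ β) {g u : ℝ → ℝ}
    (hu : MemSBV a b u) :
    lift a b α β g (graphCurrent a b u) ≤ (energy a b α β g u : EReal) := by
  obtain ⟨L, R, J, A, h⟩ := hu.exists_graphData hab
  rcases (singularSet a b u).finite_or_infinite with hfin | hinf
  swap
  · have : energy a b α β g u = ∞ := by
      rw [energy, hinf.encard_eq]
      simp [ENNReal.mul_top, hα]
    rw [this]; exact le_top
  refine iSup₂_le fun φ hφ => ?_
  have : Fintype (singularSet a b u) := hfin.fintype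
  set F : Plane → ℝ := fun p => inner ℝ (φ p) ((graphCurrent a b u).normal p) with hF
  have hF1 : (fun p => (graphCurrent a b u).mult p *
      inner ℝ (φ p) ((graphCurrent a b u).normal p)) = F := by
    funext p; simp [graphCurrent, hF]
  have hFm : AEStronglyMeasurable F ((μH[1] : Measure Plane).restrict (extendedGraph a b u)) :=
    aestronglyMeasurable_inner_normal h.aestronglyMeasurable_orient hφ.1
  rw [hF1]
  change extIntegral ((μH[1] : Measure Plane).restrict (extendedGraph a b u)) F ≤ _
  rw [h.restrict_extendedGraph] at hFm ⊢
  set μ₁ := (lengthMeasure A L).map fun x => pt x (L x) with hμ₁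
  set μ₂ := Measure.sum fun x : singularSet a b u =>
        (volume.restrict (uIcc (L x) (R x))).map (pt (x : ℝ)) with hμ₂
  have hm1 : AEStronglyMeasurable F μ₁ := hFm.mono_measure (Measure.le_add_right le_rfl)
  have hm2 : AEStronglyMeasurable F μ₂ := hFm.mono_measure (Measure.le_add_left le_rfl)
  have hm3 : ∀ x : singularSet a b u, AEStronglyMeasurable F
      ((volume.restrict (uIcc (L x) (R x))).map (pt (x : ℝ))) := fun x =>
    hm2.mono_measure (Measure.le_sum (fun x : singularSet a b u =>
        (volume.restrict (uIcc (L x) (R x))).map (pt (x : ℝ))) x)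
  have hpm : ∀ x : ℝ, AEMeasurable (pt x) (volume.restrict (uIcc (L x) (R x))) := fun x =>
    (isometry_pt x).continuous.measurable.aemeasurable
  have hFv : ∀ x : singularSet a b u, F ∘ pt (x : ℝ) =
      fun t => Real.sign (R x - L x) * φ (pt x t) 0 := fun x =>
    funext fun t => h.inner_normal_vert φ x.2 t
  have hi3 : ∀ x : singularSet a b u, Integrable F
      ((volume.restrict (uIcc (L x) (R x))).map (pt (x : ℝ))) := by
    intro x
    rw [integrable_map_measure (hm3 x) (hpm x), hFv]
    exact ((intervalIntegrable_iff' (by simp)).1 (hφ.2.2 x x.2.1 (L x) (R x)).1).const_mul _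
  have hi2 : Integrable F μ₂ := by
    rw [hμ₂, Measure.sum_fintype]
    exact integrable_finsetSum_measure.2 fun x _ => hi3 x
  have hI2 : ∫ p, F p ∂μ₂ ≤ α * Fintype.card (singularSet a b u) := by
    rw [hμ₂, Measure.sum_fintype, integral_finsetSum_measure fun x _ => hi3 x]
    calc ∑ x : singularSet a b u,
          ∫ p, F p ∂((volume.restrict (uIcc (L x) (R x))).map (pt (x : ℝ)))
        ≤ ∑ x : singularSet a b u, α := by
          refine Finset.sum_le_sum fun x _ => ?_
          rw [integral_map (hpm x) (hm3 x)]
          have : ∫ t in uIcc (L x) (R x), F (pt x t) = ∫ t in L x..R x, φ (pt x t) 0 := by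
            rw [← h.integral_vert]
            exact integral_congr_ae (Eventually.of_forall fun t => congrFun (hFv x) t)
          rw [this]
          exact (le_abs_self _).trans (hφ.2.2 x x.2.1 (L x) (R x)).2
      _ = _ := by simp [mul_comm]
  have hI1 : ∫⁻ p, ENNReal.ofReal (F p) ∂μ₁ ≤
      (∫⁻ x in Ioo a b, ENNReal.ofReal (sbvDeriv a b u x ^ 2))
        + ENNReal.ofReal β * (∫⁻ x in Ioo a b, ENNReal.ofReal ((u x - g x) ^ 2)) := by
    rw [hμ₁, lintegral_map' hm1.aemeasurable.ennreal_ofReal h.measurable_graph.aemeasurable,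
      lengthMeasure]
    refine (lintegral_withDensity_le_lintegral_mul _
      (measurable_len_deriv L).ennreal_ofReal _).trans ?_
    rw [← lintegral_const_mul' _ _ ENNReal.ofReal_ne_top,
      ← lintegral_add_left' (h.integrableOn.1.aemeasurable.pow_const 2).ennreal_ofReal,
      ← h.restrict_eq_restrict_Ioo]
    refine lintegral_mono_ae ?_
    have hae := h.ae_eq
    rw [← h.restrict_eq_restrict_Ioo] at hae
    filter_upwards [hae, ae_restrict_mem h.measurableSet] with x hx hxA
    simp only [Pi.mul_apply]
    rw [← ENNReal.ofReal_mul (len_pos _).le, h.deriv_eq hxA, h.inner_normal_graph φ hxA,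
      ← ENNReal.ofReal_mul hβ, ← ENNReal.ofReal_add (sq_nonneg _) (by positivity), hx]
    refine ENNReal.ofReal_le_ofReal ?_
    have h1 : (φ (pt x (L x)) 0) ^ 2 / 4 - β * (L x - g x) ^ 2 ≤ φ (pt x (L x)) 1 :=
      hφ.2.1 x (h.subset hxA) (L x)
    -- φˣv - (φˣ)²/4 ≤ v² is the nonnegativity of (φˣ/2 - v)².
    nlinarith [sq_nonneg (φ (pt x (L x)) 0 / 2 - sbvDeriv a b u x)]
  have hN2 : ∫⁻ p, ENNReal.ofReal (-F p) ∂μ₂ < ∞ := hi2.neg.lintegral_lt_top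
  have hE2 := extIntegral_of_integrable hi2
  rw [extIntegral] at hE2 ⊢
  rw [lintegral_add_measure, lintegral_add_measure]
  -- The negative part over the graph may have infinite integral; discarding it can only increase
  -- the difference.
  calc _ ≤ ((∫⁻ p, ENNReal.ofReal (F p) ∂μ₁ + ∫⁻ p, ENNReal.ofReal (F p) ∂μ₂ : ℝ≥0∞) : EReal)
          - ((∫⁻ p, ENNReal.ofReal (-F p) ∂μ₂ : ℝ≥0∞) : EReal) :=
        EReal.sub_le_sub le_rfl (EReal.coe_ennreal_le_coe_ennreal_iff.2 le_add_self)
    _ = ((∫⁻ p, ENNReal.ofReal (F p) ∂μ₁ : ℝ≥0∞) : EReal) + ((∫ p, F p ∂μ₂ : ℝ) : EReal) := by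
        rw [← hE2, EReal.coe_ennreal_add, sub_eq_add_neg, sub_eq_add_neg, add_assoc]
    _ ≤ (((∫⁻ x in Ioo a b, ENNReal.ofReal (sbvDeriv a b u x ^ 2))
        + ENNReal.ofReal β * (∫⁻ x in Ioo a b, ENNReal.ofReal ((u x - g x) ^ 2)) : ℝ≥0∞) : EReal)
        + ((α * Fintype.card (singularSet a b u) : ℝ) : EReal) :=
        add_le_add (EReal.coe_ennreal_le_coe_ennreal_iff.2 hI1) (EReal.coe_le_coe_iff.2 hI2)
    _ = _ := by
        rw [energy, EReal.coe_ennreal_add _ (ENNReal.ofReal α * _)]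
        congr 1
        have hc : ((singularSet a b u).encard : ℝ≥0∞) =
            ENNReal.ofReal (Fintype.card (singularSet a b u)) := by
          rw [← Set.coe_fintypeCard, ENNReal.ofReal_natCast]; rfl
        rw [hc, ← ENNReal.ofReal_mul hα.le, EReal.coe_ennreal_ofReal, max_eq_left (by positivity)]

/-! ### Calibrating fields -/

lemma exists_lipschitzOnWith_finset (D : Finset ℝ) (f : ℝ → ℝ) :
    ∃ K, LipschitzOnWith K f (D : Set ℝ) := by
  -- The sum of all difference quotients dominates each of them; the diagonal terms are zero.
  refine ⟨∑ s ∈ D, ∑ t ∈ D, ‖f s - f t‖₊ / ‖s - t‖₊, ?_⟩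
  refine LipschitzOnWith.of_dist_le_mul fun s hs t ht => ?_
  rcases eq_or_ne s t with rfl | hst
  · simp
  have h1 : ‖f s - f t‖₊ / ‖s - t‖₊ ≤ ∑ s ∈ D, ∑ t ∈ D, ‖f s - f t‖₊ / ‖s - t‖₊ :=
    (Finset.single_le_sum (f := fun t => ‖f s - f t‖₊ / ‖s - t‖₊) (fun _ _ => zero_le) ht).trans
      (Finset.single_le_sum (f := fun s => ∑ t ∈ D, ‖f s - f t‖₊ / ‖s - t‖₊)
        (fun _ _ => zero_le) hs)
  have h2 : 0 < ‖s - t‖₊ := nnnorm_pos.2 (sub_ne_zero.2 hst)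
  have h3 := (div_le_iff₀ h2).1 h1
  rw [dist_eq_norm, dist_eq_norm]
  exact_mod_cast h3

/-- A function with values in `[0,α]` on a finite set has a primitive-like bounded density. -/
lemma exists_density_of_finset {α : ℝ} (hα : 0 ≤ α) (D : Finset ℝ) (f : ℝ → ℝ)
    (hf : ∀ t, f t ∈ Icc 0 α) :
    ∃ ψ : ℝ → ℝ, Measurable ψ ∧ (∃ M, ∀ t, |ψ t| ≤ M) ∧
      (∀ s t, IntervalIntegrable ψ volume s t ∧ |∫ r in s..t, ψ r| ≤ α) ∧
      ∀ s ∈ D, ∀ t ∈ D, ∫ r in s..t, ψ r = f t - f s := by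
  obtain ⟨K, hK⟩ := exists_lipschitzOnWith_finset D f
  obtain ⟨h, hh, hhf⟩ := hK.extend_real
  -- Clamping the Lipschitz extension to [0,α] bounds every increment by α and changes nothing on D.
  -- The density sought is the derivative of Φ.
  set Φ : ℝ → ℝ := fun t => max 0 (min α (h t)) with hΦ
  have hΦL : LipschitzWith K Φ := (hh.const_min α).const_max 0
  have hΦr : ∀ t, Φ t ∈ Icc 0 α := fun t => ⟨le_max_left _ _, max_le hα (min_le_left _ _)⟩
  have hΦD : ∀ t ∈ D, Φ t = f t := by
    intro t ht
    simp only [hΦ]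
    rw [← hhf ht, min_eq_right (hf t).2, max_eq_right (hf t).1]
  have hAC : ∀ s t, AbsolutelyContinuousOnInterval Φ s t := fun s t =>
    (hΦL.lipschitzOnWith (s := uIcc s t)).absolutelyContinuousOnInterval
  have hint : ∀ s t, ∫ r in s..t, deriv Φ r = Φ t - Φ s := fun s t =>
    (hAC s t).integral_deriv_eq_sub
  refine ⟨deriv Φ, measurable_deriv Φ, ⟨K, fun t => norm_deriv_le_of_lipschitz hΦL⟩,
    fun s t => ⟨(hAC s t).intervalIntegrable_deriv, ?_⟩, fun s hs t ht => ?_⟩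
  · rw [hint, abs_le]
    constructor <;> linarith [(hΦr s).1, (hΦr s).2, (hΦr t).1, (hΦr t).2]
  · rw [hint, hΦD s hs, hΦD t ht]

/-- Truncation to `0` of the values larger than `n`. -/
def trunc (n : ℕ) (x : ℝ) : ℝ := if |x| ≤ n then x else 0

lemma measurable_trunc (n : ℕ) : Measurable (trunc n) :=
  Measurable.ite (measurableSet_le measurable_norm measurable_const) measurable_id measurable_const

lemma abs_trunc_le (n : ℕ) (x : ℝ) : |trunc n x| ≤ n := by
  rw [trunc]; split_ifs with h
  · exact h
  · simp

/-- Owing to this identity a bounded field with φˣ = 2 `trunc n v` still has the exact flux density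
φˣv - (φˣ)²/4 = (`trunc n v`)². -/
lemma trunc_mul_self (n : ℕ) (x : ℝ) : trunc n x * x = trunc n x ^ 2 := by
  rw [trunc]; split_ifs <;> ring

lemma trunc_sq_le (n : ℕ) (x : ℝ) : trunc n x ^ 2 ≤ x ^ 2 := by
  rw [trunc]; split_ifs
  · exact le_rfl
  · simpa using sq_nonneg x

lemma tendsto_trunc (x : ℝ) : Tendsto (fun n => trunc n x) atTop (𝓝 x) := by
  refine tendsto_const_nhds.congr' ?_
  obtain ⟨N, hN⟩ := exists_nat_ge |x|
  filter_upwards [eventually_ge_atTop N] with n hn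
  rw [trunc, if_pos (hN.trans (by exact_mod_cast hn))]

/-- Almost every contact point is a right limit of contact points, along which the difference
quotients of f - g vanish. -/
lemma ae_deriv_eq_of_eq {f g f' g' : ℝ → ℝ} {s : Set ℝ} (hf : ∀ x ∈ s, HasDerivAt f (f' x) x)
    (hg : ∀ x ∈ s, HasDerivAt g (g' x) x) :
    ∀ᵐ x, x ∈ s → f x = g x → f' x = g' x := by
  filter_upwards [ae_neBot_nhdsWithin_Ioi (s ∩ {x | f x = g x})] with x hx hxs hxe
  have := abs_deriv_sub_le_of_neBot (k := 0) (ε := 0) ((hf x hxs).sub (hg x hxs)) (hx ⟨hxs, hxe⟩)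
    (fun y hy => by
      have h1 : f y = g y := hy.2
      simp [h1, hxe])
  have h0 : |f' x - g' x| = 0 := le_antisymm (by simpa using this) (abs_nonneg _)
  exact sub_eq_zero.1 (abs_eq_zero.1 h0)

section

variable {a b α β : ℝ} {g : ℝ → ℝ} {k : ℕ} {u L R J : Fin k → ℝ → ℝ} {A : Fin k → Set ℝ}

/-- A measurable set of full measure of points where all the functions are differentiable, where
coinciding functions have the same derivative and where `g` agrees with a bounded Borel function. -/
lemma exists_good_set (hgd : ∀ i, GraphData a b (u i) (L i) (R i) (J i) (A i))
    (hg : MemLp g ⊤ (volume.restrict (Ioo a b))) (E : Finset ℝ) :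
    ∃ (X : Set ℝ) (g₀ : ℝ → ℝ) (M : ℝ), MeasurableSet X ∧ Measurable g₀ ∧
      (∀ᵐ x ∂(volume.restrict (Ioo a b)), x ∈ X) ∧
      ∀ x ∈ X, x ∉ E ∧ g x = g₀ x ∧ |g₀ x| ≤ M ∧ (∀ i, x ∈ A i) ∧
        ∀ i j, L i x = L j x → sbvDeriv a b (u i) x = sbvDeriv a b (u j) x := by
  have hM : ∀ᵐ x ∂(volume.restrict (Ioo a b)), |g x| ≤
      (eLpNormEssSup g (volume.restrict (Ioo a b))).toReal := by
    filter_upwards [enorm_ae_le_eLpNormEssSup g (volume.restrict (Ioo a b))] with x hx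
    have h2 : eLpNormEssSup g (volume.restrict (Ioo a b)) ≠ ∞ := by
      have := hg.2
      rw [eLpNorm_exponent_top] at this
      exact this.ne
    have := ENNReal.toReal_mono h2 hx
    simpa using this
  set M := (eLpNormEssSup g (volume.restrict (Ioo a b))).toReal with hMdef
  have hc : ∀ i j, ∀ᵐ x ∂(volume.restrict (Ioo a b)), x ∈ A i ∩ A j → L i x = L j x →
      sbvDeriv a b (u i) x = sbvDeriv a b (u j) x := fun i j =>
    ae_restrict_of_ae (ae_deriv_eq_of_eq (s := A i ∩ A j)
      (fun x hx => (hgd i).hasDerivAt x hx.1) (fun x hx => (hgd j).hasDerivAt x hx.2))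
  have hA : ∀ i, ∀ᵐ x ∂(volume.restrict (Ioo a b)), x ∈ A i := fun i => (hgd i).ae_mem
  have hE : ∀ᵐ x ∂(volume.restrict (Ioo a b)), x ∉ (E : Set ℝ) :=
    ae_restrict_of_ae (E.countable_toSet.ae_notMem volume)
  have hall : ∀ᵐ x ∂(volume.restrict (Ioo a b)), x ∉ E ∧ g x = hg.1.mk g x ∧ |hg.1.mk g x| ≤ M ∧
      (∀ i, x ∈ A i) ∧ ∀ i j, L i x = L j x → sbvDeriv a b (u i) x = sbvDeriv a b (u j) x := by
    filter_upwards [hM, hg.1.ae_eq_mk, ae_all_iff.2 hA,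
      ae_all_iff.2 fun i => ae_all_iff.2 (hc i), hE] with x h1 h2 h3 h4 h5
    exact ⟨by simpa using h5, h2, by rw [← h2]; exact h1, h3,
      fun i j => h4 i j ⟨h3 i, h3 j⟩⟩
  obtain ⟨N, hN, hNm, hN0⟩ := exists_measurable_superset_of_null (ae_iff.1 hall)
  refine ⟨Nᶜ, hg.1.mk g, M, hNm.compl, hg.1.stronglyMeasurable_mk.measurable, ?_, ?_⟩
  · exact measure_eq_zero_iff_ae_notMem.1 hN0
  · intro x hx
    by_contra hcon
    exact hx (hN hcon)

/-- The calibrating field: it is vertical and optimal on the graphs of the `L i`, and on the lines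
over `E` it interpolates the jump potentials `f`. -/
theorem exists_calibrating_field (hgd : ∀ i, GraphData a b (u i) (L i) (R i) (J i) (A i))
    (hα : 0 ≤ α) (hβ : 0 ≤ β) (hg : MemLp g ⊤ (volume.restrict (Ioo a b))) (E : Finset ℝ)
    (hE : ∀ x ∈ E, x ∈ Ioo a b) (f : ℝ → ℝ → ℝ) (hf : ∀ x t, f x t ∈ Icc 0 α) (n : ℕ) :
    ∃ φ ∈ admissibleFields a b α β g, (∃ M, ∀ p, |φ p 0| ≤ M ∧ |φ p 1| ≤ M) ∧
      ∀ i, ∫ p in extendedGraph a b (u i), inner ℝ (φ p) ((graphCurrent a b (u i)).normal p) ∂μH[1]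
        = (∫ x in Ioo a b, (trunc n (sbvDeriv a b (u i) x) ^ 2 + β * (L i x - g x) ^ 2)) +
          ∑ x ∈ E, (f x (R i x) - f x (L i x)) := by
  classical
  obtain ⟨X, g₀, Mg, hXm, hg₀, hXae, hX⟩ := exists_good_set hgd hg E
  choose ψ hψm hψb hψi hψ using fun x => exists_density_of_finset hα
    (Finset.univ.image (fun i => L i x) ∪ Finset.univ.image (fun i => R i x)) (f x) (hf x)
  choose Mψ hMψ using hψb
  choose ML hML using fun i => (hgd i).bounded
  have hc0 := measurable_coord 0
  have hc1 := measurable_coord 1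
  set cnt : Plane → ℝ := fun p => ∑ i, if p 1 = L i (p 0) then (1 : ℝ) else 0 with hcnt
  set tot : Plane → ℝ := fun p => ∑ i, if p 1 = L i (p 0) then deriv (L i) (p 0) else 0 with htot
  -- The mean slope of the graphs through p. Over X these slopes coincide, so the mean is the common
  -- slope, and it is Borel without any choice of an index.
  set V : Plane → ℝ := fun p => if p 0 ∈ X then trunc n (tot p / cnt p) else 0 with hV
  set Ψ : Plane → ℝ := fun p => ∑ e ∈ E, if p 0 = e then ψ e (p 1) else 0 with hΨ
  -- The fidelity term is needed on the graphs only. Zero elsewhere keeps the field admissible,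
  -- since it enters φᵗ with a minus sign, and bounded in t; the Borel representative g₀ keeps it
  -- measurable.
  set W : Plane → ℝ := fun p => if p 0 ∈ X ∧ cnt p ≠ 0 then (p 1 - g₀ (p 0)) ^ 2 else 0 with hW
  set H : Plane → ℝ := fun p => Ψ p + 2 * V p with hH
  have hcond : ∀ i, MeasurableSet {p : Plane | p 1 = L i (p 0)} := fun i =>
    measurableSet_eq_fun hc1 ((hgd i).measurable_left.comp hc0)
  have hcntm : Measurable cnt := Finset.measurable_sum _ fun i _ =>
    Measurable.ite (hcond i) measurable_const measurable_const
  have htotm : Measurable tot := Finset.measurable_sum _ fun i _ =>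
    Measurable.ite (hcond i) ((measurable_deriv (L i)).comp hc0) measurable_const
  have hVm : Measurable V := Measurable.ite (hc0 hXm)
    ((measurable_trunc n).comp (htotm.div hcntm)) measurable_const
  have hΨm : Measurable Ψ := Finset.measurable_sum _ fun e _ =>
    Measurable.ite (hc0 (measurableSet_singleton e)) ((hψm e).comp hc1) measurable_const
  have hWm : Measurable W := Measurable.ite
    ((hc0 hXm).inter (hcntm (measurableSet_singleton 0)).compl)
    ((hc1.sub (hg₀.comp hc0)).pow_const 2) measurable_const
  have hHm : Measurable H := hΨm.add (hVm.const_mul 2)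
  set φ : Plane → Plane := fun p => pt (H p) (H p ^ 2 / 4 - β * W p) with hφ
  have hφm : Measurable φ := continuous_pt.measurable.comp
    (hHm.prodMk (((hHm.pow_const 2).div_const 4).sub (hWm.const_mul β)))
  have hΨE : ∀ x ∈ E, ∀ t, Ψ (pt x t) = ψ x t := by
    intro x hx t
    change (∑ e ∈ E, if x = e then ψ e t else 0) = _
    rw [Finset.sum_ite_eq, if_pos hx]
  have hΨ0 : ∀ x ∉ E, ∀ t, Ψ (pt x t) = 0 := by
    intro x hx t
    change (∑ e ∈ E, if x = e then ψ e t else 0) = _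
    rw [Finset.sum_ite_eq, if_neg hx]
  have hVX : ∀ x ∉ X, ∀ t, V (pt x t) = 0 := by
    exact fun x hx t => if_neg hx
  have hV0 : ∀ x t, (∀ i, t ≠ L i x) → V (pt x t) = 0 := by
    intro x t ht
    have : tot (pt x t) = 0 := by
      exact Finset.sum_eq_zero fun i _ => if_neg (ht i)
    simp only [hV, this, zero_div]
    simp [trunc]
  have hHE : ∀ x ∈ E, ∀ t, H (pt x t) = ψ x t := by
    intro x hx t
    simp only [hH]
    rw [hΨE x hx, hVX x fun h => (hX x h).1 hx]; ring
  -- On a line off E the horizontal component differs from 0 at finitely many heights at most, so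
  -- the integral constraint holds trivially there.
  have hH0 : ∀ x ∉ E, ∀ᵐ t, H (pt x t) = 0 := by
    intro x hx
    have hfin : ∀ᵐ t : ℝ, ∀ i, t ≠ L i x := ae_all_iff.2 fun i => Measure.ae_ne volume (L i x)
    filter_upwards [hfin] with t ht
    simp only [hH]
    rw [hΨ0 x hx, hV0 x t ht]; ring
  have hcontact : ∀ x ∈ X, ∀ i, cnt (pt x (L i x)) ≠ 0 ∧
      V (pt x (L i x)) = trunc n (sbvDeriv a b (u i) x) := by
    intro x hx i
    have h1 : 0 < cnt (pt x (L i x)) := by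
      change 0 < ∑ j, if L i x = L j x then (1 : ℝ) else 0
      refine Finset.sum_pos' (fun j _ => by split_ifs <;> simp) ⟨i, Finset.mem_univ i, ?_⟩
      simp
    have h2 : tot (pt x (L i x)) = cnt (pt x (L i x)) * sbvDeriv a b (u i) x := by
      change (∑ j, if L i x = L j x then deriv (L j) x else 0) =
        (∑ j, if L i x = L j x then (1 : ℝ) else 0) * sbvDeriv a b (u i) x
      rw [Finset.sum_mul]
      refine Finset.sum_congr rfl fun j _ => ?_
      split_ifs with hij
      · rw [(hgd j).deriv_eq ((hX x hx).2.2.2.1 j), (hX x hx).2.2.2.2 i j hij, one_mul]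
      · rw [zero_mul]
    refine ⟨h1.ne', ?_⟩
    refine (if_pos hx).trans ?_
    rw [h2, mul_div_cancel_left₀ _ h1.ne']
  have hWle : ∀ x t, W (pt x t) ≤ (t - g x) ^ 2 := by
    intro x t
    change (if x ∈ X ∧ cnt (pt x t) ≠ 0 then (t - g₀ x) ^ 2 else 0) ≤ _
    split_ifs with hcase
    · rw [(hX x hcase.1).2.1]
    · positivity
  have hWX : ∀ x ∈ X, ∀ i, W (pt x (L i x)) = (L i x - g x) ^ 2 := by
    intro x hx i
    refine (if_pos ⟨hx, (hcontact x hx i).1⟩).trans ?_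
    rw [(hX x hx).2.1]
    rfl
  have hWb : ∀ p, |W p| ≤ (∑ i, |ML i| + |Mg|) ^ 2 := by
    intro p
    simp only [hW]
    split_ifs with hcase
    · obtain ⟨i, hi⟩ : ∃ i, p 1 = L i (p 0) := by
        by_contra hcon
        push Not at hcon
        exact hcase.2 (Finset.sum_eq_zero fun i _ => if_neg (hcon i))
      rw [abs_pow]
      have h1 : |p 1| ≤ ∑ i, |ML i| := by
        rw [hi]
        exact ((hML i _).trans (le_abs_self _)).trans
          (Finset.single_le_sum (f := fun i => |ML i|) (fun _ _ => abs_nonneg _)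
            (Finset.mem_univ i))
      have h2 := (hX _ hcase.1).2.2.1
      gcongr
      refine (abs_sub _ _).trans (add_le_add h1 (h2.trans (le_abs_self _)))
    · simp; positivity
  have hHb : ∀ p, |H p| ≤ ∑ e ∈ E, |Mψ e| + 2 * n := by
    intro p
    simp only [hH]
    refine (abs_add_le _ _).trans (add_le_add ?_ ?_)
    · refine (Finset.abs_sum_le_sum_abs _ _).trans (Finset.sum_le_sum fun e _ => ?_)
      split_ifs
      · exact (hMψ e _).trans (le_abs_self _)
      · simp
    · rw [abs_mul, abs_two]
      gcongr
      simp only [hV]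
      split_ifs
      · exact abs_trunc_le _ _
      · simp
  set MH := ∑ e ∈ E, |Mψ e| + 2 * (n : ℝ) with hMH
  set MW := (∑ i, |ML i| + |Mg|) ^ 2 with hMW
  have hMH0 : 0 ≤ MH := by positivity
  have hbound : ∀ p, |φ p 0| ≤ MH + MH ^ 2 + β * MW ∧ |φ p 1| ≤ MH + MH ^ 2 + β * MW := by
    intro p
    have h0 : φ p 0 = H p := rfl
    have h1 : φ p 1 = H p ^ 2 / 4 - β * W p := rfl
    have h2 : β * |W p| ≤ β * MW := mul_le_mul_of_nonneg_left (hWb p) hβ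
    have h3 : 0 ≤ β * |W p| := by positivity
    have h4 : |H p| ^ 2 ≤ MH ^ 2 := by gcongr; exact hHb p
    constructor
    · rw [h0]; linarith [hHb p, sq_nonneg MH]
    · rw [h1]
      refine (abs_sub _ _).trans ?_
      rw [abs_div, abs_pow, abs_mul, abs_of_nonneg hβ, abs_of_pos (show (0 : ℝ) < 4 by norm_num)]
      nlinarith [sq_nonneg |H p|]
  refine ⟨φ, ⟨hφm, ?_, ?_⟩, ⟨_, hbound⟩, ?_⟩
  · intro x _ t
    change H (pt x t) ^ 2 / 4 - β * (t - g x) ^ 2 ≤ H (pt x t) ^ 2 / 4 - β * W (pt x t)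
    have := mul_le_mul_of_nonneg_left (hWle x t) hβ
    linarith
  · intro x _ t₁ t₂
    change IntervalIntegrable (fun t => H (pt x t)) volume t₁ t₂ ∧
      |∫ t in t₁..t₂, H (pt x t)| ≤ α
    by_cases hx : x ∈ E
    · simp_rw [hHE x hx]
      exact hψi x t₁ t₂
    · constructor
      · refine (intervalIntegrable_const (c := (0 : ℝ))).congr_ae ?_
        refine ae_restrict_of_ae ?_
        filter_upwards [hH0 x hx] with t ht using ht.symm
      · rw [intervalIntegral.integral_zero_ae]
        · simpa using hα
        · filter_upwards [hH0 x hx] with t ht _ using ht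
  · intro i
    rw [(hgd i).integral_extendedGraph_of_finset hφm hbound hE hH0]
    congr 1
    · refine integral_congr_ae ?_
      filter_upwards [hXae] with x hx
      have hHx : H (pt x (L i x)) = 2 * trunc n (sbvDeriv a b (u i) x) := by
        simp only [hH]
        rw [hΨ0 x (hX x hx).1, (hcontact x hx i).2]; ring
      change H (pt x (L i x)) * sbvDeriv a b (u i) x -
        (H (pt x (L i x)) ^ 2 / 4 - β * W (pt x (L i x))) = _
      rw [hHx, hWX x hx, mul_assoc, trunc_mul_self]; ring
    · refine Finset.sum_congr rfl fun x hx => ?_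
      change ∫ t in L i x..R i x, H (pt x t) = _
      simp_rw [hHE x hx]
      exact hψ x _ (by simp) _ (by simp)

lemma integrableOn_sq_sub (hgd : ∀ i, GraphData a b (u i) (L i) (R i) (J i) (A i))
    (hg : MemLp g ⊤ (volume.restrict (Ioo a b))) (i : Fin k) :
    IntegrableOn (fun x => (L i x - g x) ^ 2) (Ioo a b) := by
  have h1 : MemLp (L i) ⊤ (volume.restrict (Ioo a b)) := by
    obtain ⟨M, hM⟩ := (hgd i).bounded
    exact memLp_top_of_bound (hgd i).measurable_left.aestronglyMeasurable M
      (Eventually.of_forall hM)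
  exact ((h1.sub hg).mono_exponent (p := 2) le_top).integrable_sq

/-- The lower bound for the lift of a combination of graphs obtained from jump potentials. -/
theorem energy_add_potential_le (hab : a < b)
    (hgd : ∀ i, GraphData a b (u i) (L i) (R i) (J i) (A i))
    (hα : 0 ≤ α) (hβ : 0 ≤ β) (hg : MemLp g ⊤ (volume.restrict (Ioo a b)))
    {T : CurrentTriple} (hT : T.IsRectifiable a b)
    {lam : Fin k → ℝ} (hlam : ∀ i, 0 < lam i) (hu : ∀ i, MemSBV a b (u i))
    (h : ∀ ω : Plane → Plane, IsTestForm a b ω →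
        T.action ω = ∑ i, lam i * (graphCurrent a b (u i)).action ω)
    {C : ℝ} (hC : lift a b α β g T ≤ (C : EReal)) :
    (∀ i, IntegrableOn (fun x => sbvDeriv a b (u i) x ^ 2) (Ioo a b)) ∧
    ∀ (E : Finset ℝ) (_ : ∀ x ∈ E, x ∈ Ioo a b) (f : ℝ → ℝ → ℝ) (_ : ∀ x t, f x t ∈ Icc 0 α),
      (∑ i, lam i * ∫ x in Ioo a b, (sbvDeriv a b (u i) x ^ 2 + β * (L i x - g x) ^ 2)) +
        ∑ x ∈ E, ∑ i, lam i * (f x (R i x) - f x (L i x)) ≤ C := by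
  have hi1 := integrableOn_sq_sub hgd hg
  have hvm : ∀ i, AEStronglyMeasurable (sbvDeriv a b (u i)) (volume.restrict (Ioo a b)) :=
    fun i => (hgd i).integrableOn.1
  have htm : ∀ i n, AEStronglyMeasurable (fun x => trunc n (sbvDeriv a b (u i) x) ^ 2)
      (volume.restrict (Ioo a b)) := fun i n =>
    (((measurable_trunc n).comp_aemeasurable (hvm i).aemeasurable).pow_const 2).aestronglyMeasurable
  have hti : ∀ i n, IntegrableOn (fun x => trunc n (sbvDeriv a b (u i) x) ^ 2) (Ioo a b) := by
    intro i n
    refine Integrable.of_bound (htm i n) ((n : ℝ) ^ 2) ?_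
    refine Eventually.of_forall fun x => ?_
    rw [Real.norm_eq_abs, abs_pow]
    gcongr
    exact abs_trunc_le _ _
  have hkey : ∀ (E : Finset ℝ) (_ : ∀ x ∈ E, x ∈ Ioo a b) (f : ℝ → ℝ → ℝ)
      (_ : ∀ x t, f x t ∈ Icc 0 α) (n : ℕ),
      (∑ i, lam i * ∫ x in Ioo a b,
          (trunc n (sbvDeriv a b (u i) x) ^ 2 + β * (L i x - g x) ^ 2)) +
        ∑ x ∈ E, ∑ i, lam i * (f x (R i x) - f x (L i x)) ≤ C := by
    intro E hE f hf n
    obtain ⟨φ, hφ, ⟨M, hM⟩, hint⟩ := exists_calibrating_field hgd hα hβ hg E hE f hf n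
    have h1 := (flux_le_lift hab hT hu h hφ hM).trans hC
    rw [EReal.coe_le_coe_iff] at h1
    simp_rw [hint] at h1
    refine le_trans (le_of_eq ?_) h1
    rw [Finset.sum_comm, ← Finset.sum_add_distrib]
    exact Finset.sum_congr rfl fun i _ => by rw [mul_add, Finset.mul_sum]
  have hbd : ∀ i n, ∫ x in Ioo a b, trunc n (sbvDeriv a b (u i) x) ^ 2 ≤ C / lam i := by
    intro i n
    -- With no jump potential, the bound is uniform in the truncation level; Fatou then puts the
    -- slopes in L², and dominated convergence removes the truncation.
    have h1 := hkey ∅ (by simp) (fun _ _ => 0) (fun _ _ => ⟨le_rfl, hα⟩) n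
    rw [Finset.sum_empty, add_zero] at h1
    rw [le_div_iff₀' (hlam i)]
    refine le_trans (le_trans ?_ (Finset.single_le_sum (f := fun i => lam i * ∫ x in Ioo a b,
      (trunc n (sbvDeriv a b (u i) x) ^ 2 + β * (L i x - g x) ^ 2)) (fun j _ => ?_)
        (Finset.mem_univ i))) h1
    · refine mul_le_mul_of_nonneg_left ?_ (hlam i).le
      refine integral_mono (hti i n) ((hti i n).add ((hi1 i).const_mul β)) fun x => ?_
      have : 0 ≤ β * (L i x - g x) ^ 2 := by positivity
      simpa using this
    · refine mul_nonneg (hlam j).le (integral_nonneg fun x => ?_)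
      positivity
  have hi2 : ∀ i, IntegrableOn (fun x => sbvDeriv a b (u i) x ^ 2) (Ioo a b) := by
    intro i
    refine integrable_of_tendsto (G := fun n x => trunc n (sbvDeriv a b (u i) x) ^ 2)
      (f := fun x => sbvDeriv a b (u i) x ^ 2) ?_ ?_ ?_
    · exact Eventually.of_forall fun x => (tendsto_trunc _).pow 2
    · exact fun n => htm i n
    · refine ne_top_of_le_ne_top (ENNReal.ofReal_ne_top (r := C / lam i)) ?_
      refine (liminf_le_liminf (v := fun _ => ENNReal.ofReal (C / lam i))
        (Eventually.of_forall fun n => ?_)).trans (by simp)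
      refine le_trans (le_of_eq ?_) (ENNReal.ofReal_le_ofReal (hbd i n))
      rw [ofReal_integral_eq_lintegral_ofReal (hti i n) (Eventually.of_forall fun x => sq_nonneg _)]
      refine lintegral_congr fun x => ?_
      rw [Real.enorm_eq_ofReal (sq_nonneg _)]
  refine ⟨hi2, fun E hE f hf => ?_⟩
  refine le_of_tendsto' (x := atTop) (f := fun n : ℕ => (∑ i, lam i * ∫ x in Ioo a b,
      (trunc n (sbvDeriv a b (u i) x) ^ 2 + β * (L i x - g x) ^ 2)) +
        ∑ x ∈ E, ∑ i, lam i * (f x (R i x) - f x (L i x)))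
    (Tendsto.add_const _ (tendsto_finsetSum _ fun i _ =>
      Tendsto.const_mul _ ?_)) (hkey E hE f hf)
  refine tendsto_integral_of_dominated_convergence
    (fun x => sbvDeriv a b (u i) x ^ 2 + β * (L i x - g x) ^ 2) ?_ ?_ ?_ ?_
  · exact fun n => (htm i n).add ((hi1 i).const_mul β).1
  · exact (hi2 i).add ((hi1 i).const_mul β)
  · refine fun n => Eventually.of_forall fun x => ?_
    rw [Real.norm_eq_abs, abs_of_nonneg (by positivity)]
    exact add_le_add (trunc_sq_le _ _) le_rfl
  · exact Eventually.of_forall fun x => ((tendsto_trunc _).pow 2).add_const _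

end

/-! ### Quantiles of finite weighted families -/

/-- The mass at t is the increment of the distribution function from r to t, for r < t so close that
no point of either family lies in (r,t). -/
lemma sum_filter_eq_of_sum_filter_le {ι κ : Type*} (S : Finset ι) (U : Finset κ) (w : ι → ℝ)
    (p : ι → ℝ) (lam : κ → ℝ) (y : κ → ℝ)
    (h : ∀ t, ∑ s ∈ S with p s ≤ t, w s = ∑ i ∈ U with y i ≤ t, lam i) (t : ℝ) :
    ∑ s ∈ S with p s = t, w s = ∑ i ∈ U with y i = t, lam i := by
  have hev : ∀ z : ℝ, ∀ᶠ r in 𝓝[<] t, (z ≤ r ↔ z < t) := by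
    intro z
    by_cases hz : z < t
    · filter_upwards [Ioo_mem_nhdsLT hz] with r hr
      exact ⟨fun _ => hz, fun _ => hr.1.le⟩
    · filter_upwards [self_mem_nhdsWithin] with r hr
      exact ⟨fun h => h.trans_lt hr, fun h => absurd h hz⟩
  obtain ⟨r, hr1, hr2⟩ := (((Finset.eventually_all S).2 fun s _ => hev (p s)).and
    ((Finset.eventually_all U).2 fun i _ => hev (y i))).exists
  have e1 : ∑ s ∈ S with p s ≤ t, w s = ∑ s ∈ S with p s ≤ r, w s + ∑ s ∈ S with p s = t, w s := by
    simp only [Finset.sum_filter]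
    rw [← Finset.sum_add_distrib]
    refine Finset.sum_congr rfl fun s hs => ?_
    rw [if_congr (hr1 s hs) rfl rfl]
    rcases lt_trichotomy (p s) t with h | h | h
    · simp [h, h.le, h.ne]
    · simp [h]
    · simp [h.not_ge, h.not_gt, h.ne']
  have e2 : ∑ i ∈ U with y i ≤ t, lam i =
      ∑ i ∈ U with y i ≤ r, lam i + ∑ i ∈ U with y i = t, lam i := by
    simp only [Finset.sum_filter]
    rw [← Finset.sum_add_distrib]
    refine Finset.sum_congr rfl fun s hs => ?_
    rw [if_congr (hr2 s hs) rfl rfl]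
    rcases lt_trichotomy (y s) t with h | h | h
    · simp [h, h.le, h.ne]
    · simp [h]
    · simp [h.not_ge, h.not_gt, h.ne']
  have := h t
  rw [e1, e2, h r] at this
  linarith

/-- Finite weighted families with the same distribution function have the same integrals. -/
lemma sum_mul_eq_of_sum_filter_le {ι κ : Type*} (S : Finset ι) (U : Finset κ) (w : ι → ℝ)
    (p : ι → ℝ) (lam : κ → ℝ) (y : κ → ℝ)
    (h : ∀ t, ∑ s ∈ S with p s ≤ t, w s = ∑ i ∈ U with y i ≤ t, lam i) (φ : ℝ → ℝ) :
    ∑ s ∈ S, w s * φ (p s) = ∑ i ∈ U, lam i * φ (y i) := by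
  classical
  set D := S.image p ∪ U.image y
  rw [← Finset.sum_fiberwise_of_maps_to (t := D) (g := p)
      (fun s hs => Finset.mem_union_left _ (Finset.mem_image_of_mem _ hs)),
    ← Finset.sum_fiberwise_of_maps_to (s := U) (t := D) (g := y)
      (fun s hs => Finset.mem_union_right _ (Finset.mem_image_of_mem _ hs))]
  refine Finset.sum_congr rfl fun t _ => ?_
  have h1 : ∑ s ∈ S with p s = t, w s * φ (p s) = (∑ s ∈ S with p s = t, w s) * φ t := by
    rw [Finset.sum_mul]
    exact Finset.sum_congr rfl fun s hs => by rw [(Finset.mem_filter.1 hs).2]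
  have h2 : ∑ i ∈ U with y i = t, lam i * φ (y i) = (∑ i ∈ U with y i = t, lam i) * φ t := by
    rw [Finset.sum_mul]
    exact Finset.sum_congr rfl fun s hs => by rw [(Finset.mem_filter.1 hs).2]
  rw [h1, h2, sum_filter_eq_of_sum_filter_le S U w p lam y h t]

/-- The increments of a finite set of positive numbers. -/
lemma exists_increments (D : Finset ℝ) : (∀ s ∈ D, 0 < s) →
    ∃ w : ℝ → ℝ, (∀ s ∈ D, 0 < w s) ∧ ∀ r ∈ D, ∑ s ∈ D with s ≤ r, w s = r := by
  induction D using Finset.induction_on_max with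
  | empty => exact fun _ => ⟨0, by simp, by simp⟩
  | insert x D hx ih =>
    intro hpos
    obtain ⟨w, hw, hws⟩ := ih fun s hs => hpos s (Finset.mem_insert_of_mem hs)
    have hxD : x ∉ D := fun h => lt_irrefl _ (hx x h)
    have hlt : ∑ s ∈ D, w s < x := by
      rcases D.eq_empty_or_nonempty with rfl | hne
      · simpa using hpos x (by simp)
      · have h1 := hws _ (D.max'_mem hne)
        rw [Finset.filter_true_of_mem fun s hs => D.le_max' s hs] at h1
        rw [h1]
        exact hx _ (D.max'_mem hne)
    have hne : ∀ s ∈ D, s ≠ x := fun s hs h => hxD (h ▸ hs)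
    -- The new largest element receives the missing mass, positive because the previous total is the
    -- previous maximum, or 0 for empty D.
    refine ⟨Function.update w x (x - ∑ s ∈ D, w s), fun s hs => ?_, fun r hr => ?_⟩
    · rcases Finset.mem_insert.1 hs with rfl | hs
      · simpa using hlt
      · rw [Function.update_of_ne (hne s hs)]
        exact hw s hs
    · rcases Finset.mem_insert.1 hr with rfl | hr
      · rw [Finset.filter_true_of_mem fun s hs => ?_, Finset.sum_insert hxD, Function.update_self,
          Finset.sum_congr rfl fun s hs => Function.update_of_ne (hne s hs) _ _]
        · ring
        · rcases Finset.mem_insert.1 hs with rfl | hs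
          · exact le_rfl
          · exact (hx s hs).le
      · rw [Finset.filter_insert, if_neg (hx r hr).not_ge]
        refine (Finset.sum_congr rfl fun s hs => ?_).trans (hws r hr)
        exact Function.update_of_ne (hne s (Finset.mem_filter.1 hs).1) _ _

section

variable {k : ℕ} {lam : Fin k → ℝ}

/-- The distribution function is a step function that grows only at the points y i; the index
belongs to the lowest such point at which it has reached the level s. -/
lemma exists_quantile (hlam : ∀ i, 0 < lam i) {s : ℝ} (hs : 0 < s) (hs' : s ≤ ∑ i, lam i)
    (y : Fin k → ℝ) :
    ∃ i, ∀ t, y i ≤ t ↔ s ≤ ∑ j with y j ≤ t, lam j := by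
  classical
  have hmono : ∀ t t', t ≤ t' → ∑ j with y j ≤ t, lam j ≤ ∑ j with y j ≤ t', lam j := by
    intro t t' htt
    refine Finset.sum_le_sum_of_subset_of_nonneg ?_ fun i _ _ => (hlam i).le
    exact Finset.monotone_filter_right _ fun i _ h => h.trans htt
  have hkey : ∀ t, s ≤ ∑ j with y j ≤ t, lam j → ∃ i, y i ≤ t ∧ s ≤ ∑ j with y j ≤ y i, lam j := by
    intro t ht
    have hne : (Finset.univ.filter fun j => y j ≤ t).Nonempty := by
      by_contra hcon
      rw [Finset.not_nonempty_iff_eq_empty] at hcon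
      rw [hcon, Finset.sum_empty] at ht
      linarith
    obtain ⟨i, hi, hmax⟩ := Finset.exists_max_image _ y hne
    refine ⟨i, (Finset.mem_filter.1 hi).2, ht.trans ?_⟩
    refine Finset.sum_le_sum_of_subset_of_nonneg (fun j hj => ?_) fun i _ _ => (hlam i).le
    exact Finset.mem_filter.2 ⟨Finset.mem_univ j, hmax j hj⟩
  obtain ⟨t₀, ht₀⟩ : ∃ t₀, ∀ j, y j ≤ t₀ := by
    obtain ⟨M, hM⟩ := (Set.finite_range y).bddAbove
    exact ⟨M, fun j => hM (mem_range_self j)⟩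
  have hne : (Finset.univ.filter fun i => s ≤ ∑ j with y j ≤ y i, lam j).Nonempty := by
    obtain ⟨i, _, hi⟩ := hkey t₀ (by rwa [Finset.filter_true_of_mem fun j _ => ht₀ j])
    exact ⟨i, by simpa using hi⟩
  obtain ⟨i, hi, hmin⟩ := Finset.exists_min_image _ y hne
  refine ⟨i, fun t => ⟨fun h => (Finset.mem_filter.1 hi).2.trans (hmono _ _ h), fun h => ?_⟩⟩
  obtain ⟨j, hj, hj'⟩ := hkey t h
  exact (hmin j (by simpa using hj')).trans hj

/-- Quantiles of a finite family of points with weights `lam`. -/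
theorem exists_quantiles (hlam : ∀ i, 0 < lam i) :
    ∃ (S : Finset ℝ) (w : ℝ → ℝ) (Q : ℝ → (Fin k → ℝ) → ℝ), (∀ s ∈ S, 0 < w s) ∧
      (∀ s ∈ S, ∀ s' ∈ S, s ≤ s' → ∀ y, Q s y ≤ Q s' y) ∧
      (∀ s ∈ S, ∀ y, ∃ i, Q s y = y i) ∧
      (∀ s ∈ S, ∀ y y' ε, (∀ i, |y i - y' i| ≤ ε) → |Q s y - Q s y'| ≤ ε) ∧
      ∀ y (φ : ℝ → ℝ), ∑ s ∈ S, w s * φ (Q s y) = ∑ i, lam i * φ (y i) := by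
  classical
  -- The levels are all positive partial sums of the weights, hence all positive values that the
  -- distribution function can take. They and their increments do not depend on y, so one finite
  -- family of quantiles serves every fibre.
  set S : Finset ℝ := (Finset.univ.powerset.image fun I : Finset (Fin k) => ∑ i ∈ I, lam i).filter
    fun s => 0 < s with hS
  have hSpos : ∀ s ∈ S, 0 < s := fun s hs => (Finset.mem_filter.1 hs).2
  have hSle : ∀ s ∈ S, s ≤ ∑ i, lam i := by
    intro s hs
    obtain ⟨I, _, rfl⟩ := Finset.mem_image.1 (Finset.mem_filter.1 hs).1
    exact Finset.sum_le_sum_of_subset_of_nonneg (Finset.subset_univ _) fun i _ _ => (hlam i).le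
  obtain ⟨w, hw, hws⟩ := exists_increments S hSpos
  have hq : ∀ (s : ℝ) (y : Fin k → ℝ), ∃ q, s ∈ S →
      (∃ i, q = y i) ∧ ∀ t, q ≤ t ↔ s ≤ ∑ j with y j ≤ t, lam j := by
    intro s y
    by_cases hs : s ∈ S
    · obtain ⟨i, hi⟩ := exists_quantile hlam (hSpos s hs) (hSle s hs) y
      exact ⟨y i, fun _ => ⟨⟨i, rfl⟩, hi⟩⟩
    · exact ⟨0, fun h => absurd h hs⟩
  choose Q hQ using hq
  have hlip : ∀ s ∈ S, ∀ y y' ε, (∀ i, |y i - y' i| ≤ ε) → Q s y ≤ Q s y' + ε := by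
    intro s hs y y' ε hε
    rw [(hQ s y hs).2]
    refine (((hQ s y' hs).2 _).1 le_rfl).trans ?_
    refine Finset.sum_le_sum_of_subset_of_nonneg ?_ fun i _ _ => (hlam i).le
    refine Finset.monotone_filter_right _ fun i _ h => ?_
    have h1 : y' i ≤ Q s y' := h
    have h2 := abs_le.1 (hε i)
    change y i ≤ Q s y' + ε
    linarith
  refine ⟨S, w, Q, hw, ?_, fun s hs y => (hQ s y hs).1, ?_, ?_⟩
  · intro s hs s' hs' hss y
    rw [(hQ s y hs).2]
    exact hss.trans (((hQ s' y hs').2 _).1 le_rfl)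
  · intro s hs y y' ε hε
    have h1 := hlip s hs y y' ε hε
    have h2 := hlip s hs y' y ε fun i => by rw [abs_sub_comm]; exact hε i
    rw [abs_le]
    constructor <;> linarith
  · intro y φ
    refine sum_mul_eq_of_sum_filter_le S Finset.univ w (fun s => Q s y) lam y (fun t => ?_) φ
    rw [Finset.filter_congr fun s hs => (hQ s y hs).2 t]
    set r := ∑ j with y j ≤ t, lam j with hr
    by_cases h0 : 0 < r
    · refine hws r (Finset.mem_filter.2 ⟨Finset.mem_image.2 ⟨_, ?_, rfl⟩, h0⟩)
      simp
    · have hr0 : r = 0 := le_antisymm (not_lt.1 h0) (Finset.sum_nonneg fun i _ => (hlam i).le)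
      rw [Finset.filter_false_of_mem fun s hs => ?_, Finset.sum_empty, hr0]
      rw [hr0]
      exact (hSpos s hs).not_ge

end

/-! ### Selections without jumps -/

/-- At a point z where q is right-continuous, the increment from z is the limit of increments from r
↓ z, which no longer see the atom at z. Atoms are removed one at a time in this way. -/
lemma abs_sub_le_diff_finset {q ρ : ℝ → ℝ} (hρ : Integrable ρ) (hρ0 : ∀ t, 0 ≤ ρ t)
    (μ : Measure ℝ) [IsFiniteMeasure μ]
    (h : ∀ x y, x ≤ y → |q y - q x| ≤ (∫ t in x..y, ρ t) + μ.real (Ico x y)) (F : Finset ℝ) :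
    ∀ x y, x ≤ y → (∀ z ∈ Ico x y, Tendsto q (𝓝[>] z) (𝓝 (q z))) →
      |q y - q x| ≤ (∫ t in x..y, ρ t) + μ.real (Ico x y \ F) := by
  classical
  induction F using Finset.induction_on with
  | empty => intro x y hxy _; simpa using h x y hxy
  | insert z F hz ih =>
    intro x y hxy hc
    by_cases hzm : z ∈ Ico x y
    · have h1 := ih x z hzm.1 fun r hr => hc r ⟨hr.1, hr.2.trans hzm.2⟩
      have h2 : |q y - q z| ≤ (∫ t in z..y, ρ t) + μ.real (Ioo z y \ F) := by
        refine le_of_tendsto ((tendsto_const_nhds.sub (hc z hzm)).abs) ?_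
        filter_upwards [Ioo_mem_nhdsGT hzm.2] with r hr
        refine (ih r y hr.2.le fun t ht => hc t ⟨hzm.1.trans (hr.1.le.trans ht.1), ht.2⟩).trans ?_
        refine add_le_add ?_ (measureReal_mono ?_)
        · refine intervalIntegral.integral_mono_interval hr.1.le hr.2.le le_rfl
            (Eventually.of_forall hρ0) hρ.intervalIntegrable
        · exact sdiff_subset_sdiff_left fun t ht => ⟨hr.1.trans_le ht.1, ht.2⟩
      have h3 : (∫ t in x..z, ρ t) + ∫ t in z..y, ρ t = ∫ t in x..y, ρ t :=
        intervalIntegral.integral_add_adjacent_intervals hρ.intervalIntegrable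
          hρ.intervalIntegrable
      have h4 : μ.real (Ico x z \ F) + μ.real (Ioo z y \ F) ≤
          μ.real (Ico x y \ (insert z F : Finset ℝ)) := by
        rw [← measureReal_union]
        · refine measureReal_mono ?_
          rintro t (ht | ht)
          · refine ⟨⟨ht.1.1, ht.1.2.trans hzm.2⟩, ?_⟩
            simpa using ⟨ht.1.2.ne, ht.2⟩
          · refine ⟨⟨hzm.1.trans ht.1.1.le, ht.1.2⟩, ?_⟩
            simpa using ⟨ht.1.1.ne', ht.2⟩
        · exact disjoint_left.2 fun t ht ht' => lt_asymm ht.1.2 ht'.1.1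
        · exact measurableSet_Ioo.diff F.measurableSet
      have h5 := abs_sub_le (q y) (q z) (q x)
      linarith
    · have e : Ico x y \ (insert z F : Finset ℝ) = Ico x y \ F := by
        ext t
        simp only [Finset.coe_insert, Set.mem_sdiff, mem_insert_iff, not_or]
        exact ⟨fun h => ⟨h.1, h.2.2⟩, fun h => ⟨h.1, fun h' => hzm (h' ▸ h.1), h.2⟩⟩
      rw [e]
      exact ih x y hxy hc

lemma exists_finset_jumpMeasure_diff_le {J : ℝ → ℝ} (hJ : Summable J) {ε : ℝ} (hε : 0 < ε) :
    ∃ F : Finset ℝ, ∀ s, MeasurableSet s → (jumpMeasure J).real (s \ F) ≤ ε := by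
  obtain ⟨F, hF⟩ := ((tendsto_tsum_compl_atTop_zero fun z => |J z|).eventually
    (ge_mem_nhds hε)).exists
  refine ⟨F, fun s hs => le_trans ?_ hF⟩
  have := isFiniteMeasure_jumpMeasure hJ
  have e : (∑' z : {z // z ∉ F}, |J z|) = (jumpMeasure J).real (F : Set ℝ)ᶜ := by
    rw [jumpMeasure_real hJ F.measurableSet.compl]
    exact tsum_subtype ((F : Set ℝ)ᶜ) fun z => |J z|
  rw [e]
  exact measureReal_mono fun t ht => ht.2

/-- Without jumps the singular part of the variation does not contribute. -/
lemma abs_sub_le_of_tendsto {q ρ J : ℝ → ℝ} (hρ : Integrable ρ) (hρ0 : ∀ t, 0 ≤ ρ t)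
    (hJ : Summable J)
    (h : ∀ x y, x ≤ y → |q y - q x| ≤ (∫ t in x..y, ρ t) + (jumpMeasure J).real (Ico x y))
    {x y : ℝ} (hxy : x ≤ y) (hc : ∀ z ∈ Ico x y, Tendsto q (𝓝[>] z) (𝓝 (q z))) :
    |q y - q x| ≤ ∫ t in x..y, ρ t := by
  have := isFiniteMeasure_jumpMeasure hJ
  refine le_of_forall_pos_le_add fun ε hε => ?_
  obtain ⟨F, hF⟩ := exists_finset_jumpMeasure_diff_le hJ hε
  exact (abs_sub_le_diff_finset hρ hρ0 _ h F x y hxy hc).trans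
    (add_le_add le_rfl (hF _ measurableSet_Ico))

/-- The increments of q are dominated by those of a primitive of ρ, so q inherits absolute
continuity. -/
lemma integral_deriv_eq_sub_of_abs_sub_le {q ρ : ℝ → ℝ} {x y : ℝ} (hρ : Integrable ρ)
    (hxy : x ≤ y)
    (h : ∀ s t, x ≤ s → s ≤ t → t ≤ y → |q t - q s| ≤ ∫ r in s..t, ρ r) :
    ∫ t in x..y, deriv q t = q y - q x := by
  refine AbsolutelyContinuousOnInterval.integral_deriv_eq_sub ?_
  have hΦ : AbsolutelyContinuousOnInterval (fun t => ∫ r in x..t, ρ r) x y :=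
    (hρ.intervalIntegrable (a := x) (b := y)).absolutelyContinuousOnInterval_intervalIntegral
      left_mem_uIcc
  refine squeeze_zero' (Eventually.of_forall fun E => Finset.sum_nonneg fun i _ => dist_nonneg)
    ?_ hΦ
  have hdist : ∀ s t, x ≤ s → s ≤ t → t ≤ y →
      dist (q s) (q t) ≤ dist (∫ r in x..s, ρ r) (∫ r in x..t, ρ r) := by
    intro s t hs hst ht
    rw [dist_comm (q s), dist_comm (∫ r in x..s, ρ r), Real.dist_eq, Real.dist_eq,
      intervalIntegral.integral_interval_sub_left hρ.intervalIntegrable hρ.intervalIntegrable]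
    exact (h s t hs hst ht).trans (le_abs_self _)
  filter_upwards [mem_inf_of_right (mem_principal_self _)] with E hE
  refine Finset.sum_le_sum fun i hi => ?_
  obtain ⟨h1, h2⟩ := hE.1 i hi
  rw [uIcc_of_le hxy] at h1 h2
  rcases le_total (E.2 i).1 (E.2 i).2 with hle | hle
  · exact hdist _ _ h1.1 hle h2.2
  · rw [dist_comm, dist_comm (∫ r in x..(E.2 i).1, ρ r)]
    exact hdist _ _ h2.1 hle h1.2

/-- A continuous selection of finitely many functions is differentiable at the points where all the
functions in contact with it have the same derivative. -/
lemma hasDerivAt_of_selection {ι : Type*} [Finite ι] {L : ι → ℝ → ℝ} {v : ι → ℝ} {q : ℝ → ℝ}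
    {x p : ℝ} (hL : ∀ i, HasDerivAt (L i) (v i) x) (hq : ∀ y, ∃ i, q y = L i y)
    (hcont : ContinuousAt q x) (hv : ∀ i, L i x = q x → v i = p) : HasDerivAt q p x := by
  rw [hasDerivAt_iff_isLittleO]
  refine Asymptotics.IsLittleO.of_bound fun c hc => ?_
  have h1 : ∀ᶠ y in 𝓝 x, ∀ i, ‖L i y - L i x - (y - x) • v i‖ ≤ c * ‖y - x‖ :=
    eventually_all.2 fun i => ((hasDerivAt_iff_isLittleO.1 (hL i)).bound hc)
  -- By continuity, functions not touching q at x are not selected near x; only those with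
  -- derivative p remain.
  have h2 : ∀ᶠ y in 𝓝 x, ∀ i, L i x ≠ q x → L i y ≠ q y := by
    refine eventually_all.2 fun i => ?_
    by_cases hi : L i x = q x
    · exact Eventually.of_forall fun y h => absurd hi h
    · filter_upwards [((hL i).continuousAt.ne_iff_eventually_ne hcont).1 hi] with y hy _ using hy
  filter_upwards [h1, h2] with y h1 h2
  obtain ⟨i, hi⟩ := hq y
  have hix : L i x = q x := by
    by_contra hcon
    exact h2 i hcon hi.symm
  have := h1 i
  rwa [hv i hix, ← hi, hix] at this

/-! ### The family of quantile paths -/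

/-- A finite weighted family of left-continuous functions `q s` with right limits `qr s`, absolutely
continuous with derivative `p s` outside a common finite set `E`, whose total energy, corrected by
any jump potential with values in `[0,α]`, is at most `C`. -/
structure PathFamily (a b α β : ℝ) (g : ℝ → ℝ) (C : ℝ) (S : Finset ℝ) (w : ℝ → ℝ)
    (q qr p : ℝ → ℝ → ℝ) (E : Finset ℝ) : Prop where
  weight_pos : ∀ s ∈ S, 0 < w s
  mem_Ioo : ∀ e ∈ E, e ∈ Ioo a b
  sub_eq : ∀ s ∈ S, ∀ x ∈ Ioo a b, ∀ y ∈ Ioo a b, x ≤ y → (∀ e ∈ E, e ∉ Ico x y) →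
    q s y - q s x = ∫ t in x..y, p s t
  sub_right_eq : ∀ s ∈ S, ∀ x ∈ E, ∀ y ∈ Ioo a b, x < y → (∀ e ∈ E, e ∉ Ioo x y) →
    q s y - qr s x = ∫ t in x..y, p s t
  integrableOn : ∀ s ∈ S, IntegrableOn (p s) (Ioo a b)
  integrableOn_sq : ∀ s ∈ S, IntegrableOn (fun x => p s x ^ 2) (Ioo a b)
  integrableOn_sub_sq : ∀ s ∈ S, IntegrableOn (fun x => (q s x - g x) ^ 2) (Ioo a b)
  potential_le : ∀ f : ℝ → ℝ → ℝ, (∀ x t, f x t ∈ Icc 0 α) →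
    (∑ s ∈ S, w s * ∫ x in Ioo a b, (p s x ^ 2 + β * (q s x - g x) ^ 2)) +
      ∑ x ∈ E, ∑ s ∈ S, w s * (f x (qr s x) - f x (q s x)) ≤ C

/-- Monotone weighted families that differ at some index are separated by a potential. -/
lemma exists_potential {S : Finset ℝ} {w y z : ℝ → ℝ} {α : ℝ} (hα : 0 ≤ α)
    (hw : ∀ s ∈ S, 0 < w s) (hy : ∀ s ∈ S, ∀ s' ∈ S, s ≤ s' → y s ≤ y s')
    (hz : ∀ s ∈ S, ∀ s' ∈ S, s ≤ s' → z s ≤ z s') {s : ℝ} (hs : s ∈ S) (hne : y s ≠ z s) :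
    ∃ f : ℝ → ℝ, (∀ t, f t ∈ Icc 0 α) ∧ α * w s ≤ ∑ s ∈ S, w s * (f (z s) - f (y s)) := by
  have key : ∀ f : ℝ → ℝ, (∀ s ∈ S, f (y s) ≤ f (z s)) → f (z s) - f (y s) = α →
      α * w s ≤ ∑ s ∈ S, w s * (f (z s) - f (y s)) := by
    intro f h1 h2
    refine le_trans (le_of_eq ?_) (Finset.single_le_sum
      (f := fun s => w s * (f (z s) - f (y s)))
      (fun s' hs' => mul_nonneg (hw s' hs').le (sub_nonneg.2 (h1 s' hs'))) hs)
    rw [h2, mul_comm]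
  rcases lt_or_gt_of_ne hne with hlt | hlt
  -- The step is placed between y s and z s. By monotonicity, indices above s end on the high side
  -- and indices below s start on the low side, so no term is negative and the term of s gains α.
  · have hf : ∀ t, (if z s ≤ t then α else 0) ∈ Icc 0 α := by
      intro t
      split_ifs
      · exact ⟨hα, le_rfl⟩
      · exact ⟨le_rfl, hα⟩
    refine ⟨fun t => if z s ≤ t then α else 0, hf, key (fun t => if z s ≤ t then α else 0) (fun s' hs' => ?_) ?_⟩
    · rcases le_total s s' with h | h
      · rw [if_pos (hz s hs s' hs' h)]
        exact (hf _).2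
      · rw [if_neg ((hy s' hs' s hs h).trans_lt hlt).not_ge]
        exact (hf _).1
    · simp [hlt.not_ge]
  · have hf : ∀ t, (if t < y s then α else 0) ∈ Icc 0 α := by
      intro t
      split_ifs
      · exact ⟨hα, le_rfl⟩
      · exact ⟨le_rfl, hα⟩
    refine ⟨fun t => if t < y s then α else 0, hf, key (fun t => if t < y s then α else 0) (fun s' hs' => ?_) ?_⟩
    · rcases le_total s s' with h | h
      · rw [if_neg (hy s hs s' hs' h).not_gt]
        exact (hf _).1
      · rw [if_pos ((hz s' hs' s hs h).trans_lt hlt)]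
        exact (hf _).2
    · simp [hlt]

/-- Monotone weighted families can differ at finitely many points only, if the potentials are
bounded. -/
lemma finite_setOf_ne {S : Finset ℝ} {w : ℝ → ℝ} {y z : ℝ → ℝ → ℝ} {α K : ℝ} (hα : 0 < α)
    (hw : ∀ s ∈ S, 0 < w s) (hy : ∀ x, ∀ s ∈ S, ∀ s' ∈ S, s ≤ s' → y s x ≤ y s' x)
    (hz : ∀ x, ∀ s ∈ S, ∀ s' ∈ S, s ≤ s' → z s x ≤ z s' x) {I : Set ℝ}
    (hK : ∀ (E : Finset ℝ) (_ : ∀ x ∈ E, x ∈ I) (f : ℝ → ℝ → ℝ) (_ : ∀ x t, f x t ∈ Icc 0 α),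
      ∑ x ∈ E, ∑ s ∈ S, w s * (f x (z s x) - f x (y s x)) ≤ K) :
    {x | x ∈ I ∧ ∃ s ∈ S, y s x ≠ z s x}.Finite := by
  by_contra hinf
  have hinf : {x | x ∈ I ∧ ∃ s ∈ S, y s x ≠ z s x}.Infinite := hinf
  obtain ⟨x₀, hx₀, s₀, hs₀, _⟩ := hinf.nonempty
  -- With the smallest weight, every point of the set gains at least `α * w s₁`, so there are at
  -- most `K / (α * w s₁)` of them.
  obtain ⟨s₁, hs₁, hmin⟩ := Finset.exists_min_image S w ⟨s₀, hs₀⟩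
  have hf : ∀ x, ∃ f : ℝ → ℝ, (∀ t, f t ∈ Icc 0 α) ∧ ((∃ s ∈ S, y s x ≠ z s x) →
      α * w s₁ ≤ ∑ s ∈ S, w s * (f (z s x) - f (y s x))) := by
    intro x
    by_cases hx : ∃ s ∈ S, y s x ≠ z s x
    · obtain ⟨s, hs, hne⟩ := hx
      obtain ⟨f, hf, h⟩ := exists_potential (y := fun s => y s x) (z := fun s => z s x) hα.le hw
        (hy x) (hz x) hs hne
      exact ⟨f, hf, fun _ => (mul_le_mul_of_nonneg_left (hmin s hs) hα.le).trans h⟩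
    · exact ⟨fun _ => 0, fun _ => ⟨le_rfl, hα.le⟩, fun h => absurd h hx⟩
  choose f hf hfle using hf
  have hpos : 0 < α * w s₁ := mul_pos hα (hw s₁ hs₁)
  obtain ⟨n, hn⟩ := exists_nat_gt (K / (α * w s₁))
  obtain ⟨E, hE, hcard⟩ := hinf.exists_subset_card_eq n
  have h1 := hK E (fun x hx => (hE hx).1) f hf
  have h2 := Finset.card_nsmul_le_sum E _ _ fun x hx => hfle x (hE hx).2
  rw [hcard, nsmul_eq_mul] at h2
  rw [div_lt_iff₀ hpos] at hn
  linarith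

section

variable {a b α β : ℝ} {g : ℝ → ℝ} {k : ℕ} {u L R J : Fin k → ℝ → ℝ} {A : Fin k → Set ℝ}
  {lam : Fin k → ℝ} {C : ℝ}

/-- A modulus common to all the functions passes to their quantiles, which are 1-Lipschitz in the
vector of values for the sup norm. -/
lemma exists_abs_sub_le (hgd : ∀ i, GraphData a b (u i) (L i) (R i) (J i) (A i)) :
    ∃ ρ J' : ℝ → ℝ, Integrable ρ ∧ (∀ t, 0 ≤ ρ t) ∧ Summable J' ∧
      ∀ i x y, x ≤ y → |L i y - L i x| ≤ (∫ t in x..y, ρ t) + (jumpMeasure J').real (Ico x y) := by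
  have hI : ∀ i, Integrable fun t => |(Ioo a b).indicator (sbvDeriv a b (u i)) t| := fun i =>
    ((integrable_indicator_iff measurableSet_Ioo).2 (hgd i).integrableOn).abs
  have hρ : Integrable fun t => ∑ i, |(Ioo a b).indicator (sbvDeriv a b (u i)) t| :=
    integrable_finsetSum _ fun i _ => hI i
  have hJ : Summable fun z => ∑ i, |J i z| := summable_sum fun i _ => (hgd i).summable.abs
  refine ⟨_, _, hρ, fun t => Finset.sum_nonneg fun i _ => abs_nonneg _, hJ, fun i x y hxy => ?_⟩
  refine ((hgd i).abs_sub_le x y hxy).trans (add_le_add ?_ ?_)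
  · refine intervalIntegral.integral_mono_on hxy (hI i).intervalIntegrable
      hρ.intervalIntegrable fun t _ => ?_
    exact Finset.single_le_sum (f := fun i => |(Ioo a b).indicator (sbvDeriv a b (u i)) t|)
      (fun j _ => abs_nonneg _) (Finset.mem_univ i)
  · rw [jumpMeasure_real (hgd i).summable measurableSet_Ico, jumpMeasure_real hJ measurableSet_Ico]
    refine Summable.tsum_le_tsum (fun z => ?_) ((hgd i).summable.abs.indicator _)
      (hJ.abs.indicator _)
    refine indicator_le_indicator (le_trans ?_ (le_abs_self _))
    exact Finset.single_le_sum (f := fun i => |J i z|) (fun j _ => abs_nonneg _)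
      (Finset.mem_univ i)

/-- The quantiles of a weighted family of graphs form a path family. -/
theorem exists_pathFamily (hgd : ∀ i, GraphData a b (u i) (L i) (R i) (J i) (A i))
    (hα : 0 < α) (hg : MemLp g ⊤ (volume.restrict (Ioo a b)))
    (hlam : ∀ i, 0 < lam i)
    (hsq : ∀ i, IntegrableOn (fun x => sbvDeriv a b (u i) x ^ 2) (Ioo a b))
    (hpot : ∀ (E : Finset ℝ) (_ : ∀ x ∈ E, x ∈ Ioo a b) (f : ℝ → ℝ → ℝ)
      (_ : ∀ x t, f x t ∈ Icc 0 α),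
      (∑ i, lam i * ∫ x in Ioo a b, (sbvDeriv a b (u i) x ^ 2 + β * (L i x - g x) ^ 2)) +
        ∑ x ∈ E, ∑ i, lam i * (f x (R i x) - f x (L i x)) ≤ C) :
    ∃ S w q qr p E, PathFamily a b α β g C S w q qr p E ∧ ∑ s ∈ S, w s = ∑ i, lam i ∧
      ∀ s ∈ S, ∀ x, ∃ i, q s x = L i x := by
  obtain ⟨S, w, Q, hw, hQmono, hQmem, hQlip, hQsum⟩ := exists_quantiles hlam
  obtain ⟨ρ, J', hρ, hρ0, hJ', hL⟩ := exists_abs_sub_le hgd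
  have hQc : ∀ s ∈ S, Continuous (Q s) := by
    intro s hs
    refine (LipschitzWith.of_dist_le_mul (K := 1) fun y y' => ?_).continuous
    rw [NNReal.coe_one, one_mul]
    exact hQlip s hs y y' _ fun i => dist_le_pi_dist y y' i
  set q : ℝ → ℝ → ℝ := fun s x => Q s fun i => L i x with hq
  set qr : ℝ → ℝ → ℝ := fun s x => Q s fun i => R i x with hqr
  have hqm : ∀ s ∈ S, Measurable (q s) := fun s hs =>
    (hQc s hs).measurable.comp (measurable_pi_lambda _ fun i => (hgd i).measurable_left)
  have hqR : ∀ s ∈ S, ∀ x, Tendsto (q s) (𝓝[>] x) (𝓝 (qr s x)) := fun s hs x =>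
    ((hQc s hs).tendsto _).comp (tendsto_pi_nhds.2 fun i => (hgd i).tendsto_right x)
  have hqle : ∀ s ∈ S, ∀ x y, x ≤ y →
      |q s y - q s x| ≤ (∫ t in x..y, ρ t) + (jumpMeasure J').real (Ico x y) :=
    fun s hs x y hxy => hQlip s hs _ _ _ fun i => hL i x y hxy
  have hpot' : ∀ (x : ℝ) (f : ℝ → ℝ), ∑ i, lam i * (f (R i x) - f (L i x)) =
      ∑ s ∈ S, w s * (f (qr s x) - f (q s x)) := by
    intro x f
    simp only [mul_sub, Finset.sum_sub_distrib]
    rw [← hQsum (fun i => R i x) f, ← hQsum (fun i => L i x) f]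
  have hfin : {x | x ∈ Ioo a b ∧ ∃ s ∈ S, q s x ≠ qr s x}.Finite := by
    refine finite_setOf_ne (y := q) (z := qr) (K := C - ∑ i, lam i * ∫ x in Ioo a b,
      (sbvDeriv a b (u i) x ^ 2 + β * (L i x - g x) ^ 2)) hα hw
      (fun x s hs s' hs' h => hQmono s hs s' hs' h fun i => L i x)
      (fun x s hs s' hs' h => hQmono s hs s' hs' h fun i => R i x) fun E hE f hf => ?_
    have := hpot E hE f hf
    simp_rw [hpot'] at this
    linarith
  set E := hfin.toFinset with hE
  obtain ⟨X, g₀, M, -, -, hXae, hX⟩ := exists_good_set hgd hg ∅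
  have hderiv : ∀ s ∈ S, ∀ x ∈ X, ∀ i, q s x = L i x →
      deriv (q s) x = sbvDeriv a b (u i) x := by
    intro s hs x hx i hi
    have hd : ∀ j, HasDerivAt (L j) (sbvDeriv a b (u j) x) x := fun j =>
      (hgd j).hasDerivAt x ((hX x hx).2.2.2.1 j)
    refine (hasDerivAt_of_selection hd (fun y => hQmem s hs _) ?_ fun j hj =>
      (hX x hx).2.2.2.2 j i (hj.trans hi)).deriv
    exact ((hQc s hs).tendsto _).comp (tendsto_pi_nhds.2 fun j => (hd j).continuousAt)
  have hpint : ∀ s ∈ S, IntegrableOn (deriv (q s)) (Ioo a b) := by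
    intro s hs
    refine Integrable.mono' (g := fun x => ∑ i, |sbvDeriv a b (u i) x|)
      (integrable_finsetSum _ fun i _ => (hgd i).integrableOn.abs)
      (measurable_deriv _).aestronglyMeasurable ?_
    filter_upwards [hXae] with x hx
    obtain ⟨i, hi⟩ := hQmem s hs fun i => L i x
    rw [hderiv s hs x hx i hi]
    exact Finset.single_le_sum (f := fun i => |sbvDeriv a b (u i) x|) (fun j _ => abs_nonneg _)
      (Finset.mem_univ i)
  have hpsq : ∀ s ∈ S, IntegrableOn (fun x => deriv (q s) x ^ 2) (Ioo a b) := by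
    intro s hs
    refine Integrable.mono' (g := fun x => ∑ i, sbvDeriv a b (u i) x ^ 2)
      (integrable_finsetSum _ fun i _ => hsq i)
      ((measurable_deriv _).pow_const 2).aestronglyMeasurable ?_
    filter_upwards [hXae] with x hx
    obtain ⟨i, hi⟩ := hQmem s hs fun i => L i x
    rw [hderiv s hs x hx i hi, Real.norm_eq_abs, abs_of_nonneg (sq_nonneg _)]
    exact Finset.single_le_sum (f := fun i => sbvDeriv a b (u i) x ^ 2) (fun j _ => sq_nonneg _)
      (Finset.mem_univ i)
  have hLg := integrableOn_sq_sub hgd hg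
  have hqsq : ∀ s ∈ S, IntegrableOn (fun x => (q s x - g x) ^ 2) (Ioo a b) := by
    intro s hs
    refine Integrable.mono' (g := fun x => ∑ i, (L i x - g x) ^ 2)
      (integrable_finsetSum _ fun i _ => hLg i)
      ((((hqm s hs).aestronglyMeasurable).sub hg.1).pow 2) ?_
    refine Eventually.of_forall fun x => ?_
    obtain ⟨i, hi⟩ := hQmem s hs fun i => L i x
    change ‖(Q s (fun i => L i x) - g x) ^ 2‖ ≤ _
    rw [hi, Real.norm_eq_abs, abs_of_nonneg (sq_nonneg _)]
    exact Finset.single_le_sum (f := fun i => (L i x - g x) ^ 2) (fun j _ => sq_nonneg _)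
      (Finset.mem_univ i)
  have hsub : ∀ s ∈ S, ∀ x ∈ Ioo a b, ∀ y ∈ Ioo a b, x ≤ y → (∀ e ∈ E, e ∉ Ico x y) →
      q s y - q s x = ∫ t in x..y, deriv (q s) t := by
    intro s hs x hx y hy hxy hEe
    refine (integral_deriv_eq_sub_of_abs_sub_le hρ hxy fun s' t' hs' hst ht' => ?_).symm
    refine abs_sub_le_of_tendsto hρ hρ0 hJ' (hqle s hs) hst fun z hz => ?_
    have hzI : z ∈ Ico x y := ⟨hs'.trans hz.1, hz.2.trans_le ht'⟩
    have : q s z = qr s z := by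
      by_contra hcon
      exact hEe z (hfin.mem_toFinset.2 ⟨⟨hx.1.trans_le hzI.1, hzI.2.trans hy.2⟩, s, hs, hcon⟩) hzI
    rw [this]
    exact hqR s hs z
  have henergy : ∑ i, lam i * ∫ x in Ioo a b, (sbvDeriv a b (u i) x ^ 2 + β * (L i x - g x) ^ 2) =
      ∑ s ∈ S, w s * ∫ x in Ioo a b, (deriv (q s) x ^ 2 + β * (q s x - g x) ^ 2) := by
    simp_rw [← integral_const_mul]
    rw [← integral_finsetSum Finset.univ
        (f := fun i x => lam i * (sbvDeriv a b (u i) x ^ 2 + β * (L i x - g x) ^ 2))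
        fun i _ => ((hsq i).add ((hLg i).const_mul β)).const_mul _,
      ← integral_finsetSum S
        (f := fun s x => w s * (deriv (q s) x ^ 2 + β * (q s x - g x) ^ 2))
        fun s hs => ((hpsq s hs).add ((hqsq s hs).const_mul β)).const_mul _]
    refine integral_congr_ae ?_
    filter_upwards [hXae] with x hx
    -- Over X the squared slope is a function of the height alone, since functions of equal value
    -- have equal slope. The energy density thus depends only on the distribution in the fibre, and
    -- quantiles preserve it.
    obtain ⟨φ, hφ⟩ : ∃ φ : ℝ → ℝ, ∀ i, φ (L i x) = sbvDeriv a b (u i) x ^ 2 := by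
      classical
      refine ⟨fun t => if h : ∃ i, L i x = t then sbvDeriv a b (u h.choose) x ^ 2 else 0,
        fun i => ?_⟩
      have h : ∃ j, L j x = L i x := ⟨i, rfl⟩
      refine (dif_pos h).trans ?_
      rw [(hX x hx).2.2.2.2 _ _ h.choose_spec]
    have h1 := hQsum (fun i => L i x) fun t => φ t + β * (t - g x) ^ 2
    simp only [hφ] at h1
    rw [← h1]
    refine Finset.sum_congr rfl fun s hs => ?_
    obtain ⟨i, hi⟩ := hQmem s hs fun i => L i x
    rw [hderiv s hs x hx i hi, hi, hφ, hq]
    simp only [hi]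
  refine ⟨S, w, q, qr, fun s => deriv (q s), E, ⟨hw, fun e he => (hfin.mem_toFinset.1 he).1, hsub,
    ?_, hpint, hpsq, hqsq, ?_⟩, ?_, fun s hs x => hQmem s hs _⟩
  · intro s hs x hx y hy hxy hEe
    have hxI := (hfin.mem_toFinset.1 hx).1
    have hii : IntervalIntegrable (deriv (q s)) volume x y :=
      (intervalIntegrable_iff_integrableOn_Ioc_of_le hxy.le).2
        ((hpint s hs).mono_set fun t ht => ⟨hxI.1.trans ht.1, ht.2.trans_lt hy.2⟩)
    have h1 : Tendsto (fun z => q s y - q s z) (𝓝[>] x) (𝓝 (q s y - qr s x)) :=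
      tendsto_const_nhds.sub (hqR s hs x)
    have h2 : Tendsto (fun z => ∫ t in z..y, deriv (q s) t) (𝓝[>] x)
        (𝓝 (∫ t in x..y, deriv (q s) t)) := by
      have hc := intervalIntegral.continuousOn_primitive_interval_left (μ := volume)
        (f := deriv (q s)) (a := x) (b := y)
        (by rw [uIcc_of_le hxy.le, integrableOn_Icc_iff_integrableOn_Ioc]
            exact (intervalIntegrable_iff_integrableOn_Ioc_of_le hxy.le).1 hii)
      have := (hc x left_mem_uIcc).tendsto
      rw [uIcc_of_le hxy.le] at this
      exact this.mono_left ((nhdsWithin_Ioc_eq_nhdsGT hxy).symm.le.trans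
        (nhdsWithin_mono _ Ioc_subset_Icc_self))
    refine tendsto_nhds_unique (h1.congr' ?_) h2
    filter_upwards [Ioo_mem_nhdsGT hxy] with z hz
    exact hsub s hs z ⟨hxI.1.trans hz.1, hz.2.trans hy.2⟩ y hy hz.2.le
      fun e he he' => hEe e he ⟨hz.1.trans_le he'.1, he'.2⟩
  · intro f hf
    have := hpot E (fun e he => (hfin.mem_toFinset.1 he).1) f hf
    rw [henergy] at this
    simp_rw [hpot'] at this
    exact this
  · simpa using hQsum (fun _ => 0) fun _ => 1

end

/-! ### Optimal selections -/

lemma integrableOn_selection {S : Finset ℝ} {F : ℝ → ℝ → ℝ} {I : Set ℝ}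
    (hF : ∀ s ∈ S, IntegrableOn (F s) I) {σ : ℝ → ℝ} (hσ : Measurable σ) (hS : ∀ x, σ x ∈ S) :
    IntegrableOn (fun x => F (σ x) x) I := by
  have e : (fun x => F (σ x) x) = fun x => ∑ s ∈ S, (σ ⁻¹' {s}).indicator (F s) x := by
    funext x
    rw [Finset.sum_eq_single (σ x)]
    · simp
    · intro s _ hs
      exact indicator_of_notMem (show x ∉ σ ⁻¹' {s} from fun h => hs (Eq.symm h)) (F s)
    · exact fun h => absurd (hS x) h
  rw [e]
  exact integrable_finsetSum _ fun s hs => (hF s hs).indicator (hσ (measurableSet_singleton s))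

/-- Dynamic programming: given paths `q s` with right limits `qr s` and running costs `ℓ s`, a path
may be changed at the points of `E`, at the price `α` if there is a jump. There are potentials `f`
bounding the optimal costs. -/
theorem exists_optimal_selections {S : Finset ℝ} (hne : S.Nonempty) (q qr ℓ : ℝ → ℝ → ℝ) {α : ℝ}
    (hα : 0 ≤ α) {I : Set ℝ} (hI : MeasurableSet I) (hℓ : ∀ s ∈ S, IntegrableOn (ℓ s) I)
    (E : Finset ℝ) :
    ∃ (f σ : ℝ → ℝ → ℝ) (D : ℝ → Finset ℝ), (∀ x t, f x t ∈ Icc 0 α) ∧ ∀ s ∈ S,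
      (∀ x, σ s x ∈ S) ∧ Measurable (σ s) ∧ D s ⊆ E ∧
      (∀ x, (∀ e ∈ E, e < x) → σ s x = s) ∧
      (∀ x y, x ≤ y → (∀ e ∈ E, e ∉ Ico x y) → σ s x = σ s y) ∧
      (∀ x ∈ E, x ∉ D s → ∀ y, x < y → (∀ e ∈ E, e ∉ Ioo x y) →
        q (σ s x) x = qr (σ s y) x) ∧
      (∫ x in I, ℓ (σ s x) x) + α * (D s).card ≤
        (∫ x in I, ℓ s x) + ∑ x ∈ E, (f x (qr s x) - f x (q s x)) := by
  classical
  induction E using Finset.induction_on_max with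
  | empty =>
    exact ⟨fun _ _ => 0, fun s _ => s, fun _ => ∅, fun _ _ => ⟨le_rfl, hα⟩, fun s hs =>
      ⟨fun _ => hs, measurable_const, by simp, fun _ _ => rfl, fun _ _ _ _ => rfl, by simp,
        by simp⟩⟩
  | insert z E hz ih =>
    obtain ⟨f, σ, D, hf, hσ⟩ := ih
    have hzE : z ∉ E := fun h => lt_irrefl _ (hz z h)
    have hint : ∀ s ∈ S, IntegrableOn (fun x => ℓ (σ s x) x) I := fun s hs =>
      integrableOn_selection hℓ (hσ s hs).2.1 (hσ s hs).1
    -- V s is the cost up to z of the path built so far that arrives at z on branch s, and c s t the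
    -- price of leaving z at height t from there.
    set V : ℝ → ℝ := fun s => (∫ x in I ∩ Iic z, ℓ (σ s x) x) + α * (D s).card with hV
    set c : ℝ → ℝ → ℝ := fun s t => if q s z = t then 0 else α with hc
    have hc0 : ∀ s t, 0 ≤ c s t := by
      intro s t
      simp only [hc]
      split_ifs
      exacts [le_rfl, hα]
    have hcα : ∀ s t, c s t ≤ α := by
      intro s t
      simp only [hc]
      split_ifs
      exacts [hα, le_rfl]
    choose T hTS hTmin using fun t => Finset.exists_min_image S (fun s => V s + c s t) hne
    obtain ⟨s₀, hs₀, hVmin⟩ := Finset.exists_min_image S V hne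
    -- The cheapest cost of leaving z at height t, relative to the cheapest arrival. It is
    -- nonnegative because c ≥ 0, and at most α because arriving on s₀ and jumping is a candidate.
    set fz : ℝ → ℝ := fun t => V (T t) + c (T t) t - V s₀ with hfz
    refine ⟨Function.update f z fz, fun s x => if x ≤ z then σ (T (qr s z)) x else s,
      fun s => if q (T (qr s z)) z = qr s z then D (T (qr s z)) else insert z (D (T (qr s z))),
      ?_, ?_⟩
    · intro x t
      rcases eq_or_ne x z with rfl | hx
      · rw [Function.update_self]
        constructor
        · have := hVmin _ (hTS t)
          linarith [hc0 (T t) t]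
        · have := hTmin t s₀ hs₀
          linarith [hcα s₀ t]
      · rw [Function.update_of_ne hx]
        exact hf x t
    intro s hs
    beta_reduce
    have hr : T (qr s z) ∈ S := hTS _
    have hrmin := hTmin (qr s z)
    have hfzr : fz (qr s z) = V (T (qr s z)) + c (T (qr s z)) (qr s z) - V s₀ := rfl
    generalize T (qr s z) = r at hr hrmin hfzr ⊢
    obtain ⟨h1, h2, h3, h4, h5, h6, h7⟩ := hσ s hs
    obtain ⟨k1, k2, k3, k4, k5, k6, -⟩ := hσ r hr
    have hσm : Measurable fun x => if x ≤ z then σ r x else s :=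
      Measurable.ite measurableSet_Iic k2 measurable_const
    have hσS : ∀ x, (if x ≤ z then σ r x else s) ∈ S := by
      intro x
      split_ifs
      exacts [k1 x, hs]
    refine ⟨hσS, hσm, ?_, ?_, ?_, ?_, ?_⟩
    · split_ifs
      · exact k3.trans (Finset.subset_insert _ _)
      · exact Finset.insert_subset_insert _ k3
    · intro x hx
      rw [if_neg (hx z (Finset.mem_insert_self _ _)).not_ge]
    · intro x y hxy hE
      rcases le_or_gt y z with hyz | hyz
      · rw [if_pos hyz, if_pos (hxy.trans hyz)]
        exact k5 x y hxy fun e he => hE e (Finset.mem_insert_of_mem he)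
      · rcases le_or_gt x z with hxz | hxz
        · exact absurd ⟨hxz, hyz⟩ (hE z (Finset.mem_insert_self _ _))
        · rw [if_neg hxz.not_ge, if_neg hyz.not_ge]
    · intro x hx hxD y hxy hE
      rcases Finset.mem_insert.1 hx with rfl | hxE
      · rw [if_pos le_rfl, if_neg hxy.not_ge, k4 x hz]
        by_contra hcon
        rw [if_neg hcon] at hxD
        exact hxD (Finset.mem_insert_self _ _)
      · have hyz : y ≤ z := by
          by_contra hcon
          exact hE z (Finset.mem_insert_self _ _) ⟨hz x hxE, not_le.1 hcon⟩
        rw [if_pos (hz x hxE).le, if_pos hyz]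
        refine k6 x hxE (fun h => hxD ?_) y hxy fun e he => hE e (Finset.mem_insert_of_mem he)
        split_ifs
        exacts [h, Finset.mem_insert_of_mem h]
    · have hnew := integrableOn_selection hℓ hσm hσS
      rw [← integral_inter_add_sdiff (measurableSet_Iic (a := z)) hnew,
        setIntegral_congr_fun (g := fun x => ℓ (σ r x) x) (hI.inter measurableSet_Iic)
          (fun x hx => by beta_reduce; rw [if_pos (mem_Iic.1 hx.2)]),
        setIntegral_congr_fun (g := ℓ s) (hI.diff measurableSet_Iic)
          (fun x hx => by rw [if_neg fun h => hx.2 (mem_Iic.2 h)])]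
      rw [← integral_inter_add_sdiff (measurableSet_Iic (a := z)) (hint s hs),
        setIntegral_congr_fun (s := I \ Iic z) (g := ℓ s) (hI.diff measurableSet_Iic)
          (fun x hx => by
            rw [h4 x fun e he => (hz e he).trans (not_le.1 hx.2)])] at h7
      have hcard : α * ((if q r z = qr s z then D r else insert z (D r)).card : ℝ) ≤
          α * (D r).card + c r (qr s z) := by
        simp only [hc]
        split_ifs
        · simp
        · have : ((insert z (D r)).card : ℝ) ≤ (D r).card + 1 := by
            exact_mod_cast Finset.card_insert_le _ _
          nlinarith
      -- Arriving on s and not jumping is a candidate of price 0, whereas `fz (qr s z)` is attained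
      -- by the branch r. Their difference therefore covers the change of cost from s to the new
      -- path.
      have hfzq : fz (q s z) ≤ V s - V s₀ := by
        have := hTmin (q s z) s hs
        have e : c s (q s z) = 0 := if_pos rfl
        simp only [hfz]
        linarith
      have hfE : ∑ x ∈ E, (Function.update f z fz x (qr s x) - Function.update f z fz x (q s x)) =
          ∑ x ∈ E, (f x (qr s x) - f x (q s x)) :=
        Finset.sum_congr rfl fun x hx => by rw [Function.update_of_ne (hz x hx).ne]
      rw [Finset.sum_insert hzE, Function.update_self, hfE]
      have hVr : V r = (∫ x in I ∩ Iic z, ℓ (σ r x) x) + α * (D r).card := rfl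
      have hVs : V s = (∫ x in I ∩ Iic z, ℓ (σ s x) x) + α * (D s).card := rfl
      linarith

/-! ### Piecewise absolutely continuous functions -/

lemma exists_gt_forall_notMem_Ioo (E : Finset ℝ) {x b : ℝ} (hx : x < b) :
    ∃ y ∈ Ioo x b, ∀ e ∈ E, e ∉ Ioo x y := by
  have h : ∀ᶠ y in 𝓝[>] x, y ∈ Ioo x b ∧ ∀ e ∈ E, e ∉ Ioo x y := by
    refine Filter.Eventually.and (Ioo_mem_nhdsGT hx)
      ((Finset.eventually_all E).2 fun e _ => ?_)
    rcases le_or_gt e x with hex | hex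
    · exact Eventually.of_forall fun y hy => hex.not_gt hy.1
    · filter_upwards [Ioo_mem_nhdsGT hex] with y hy hy' using lt_asymm hy.2 hy'.2
  exact h.exists

/-- A function which is absolutely continuous outside a finite set is in `SBV`, with jumps only at
the points of this set where it is not continuous from the right. -/
theorem exists_hasSBVDerivative_of_sub_eq {a b : ℝ} (hab : a < b) {W P : ℝ → ℝ}
    (hP : IntegrableOn P (Ioo a b)) (E : Finset ℝ) (hE : ∀ e ∈ E, e ∈ Ioo a b)
    (h : ∀ x ∈ Ioo a b, ∀ y ∈ Ioo a b, x ≤ y → (∀ e ∈ E, e ∉ Ico x y) →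
      W y - W x = ∫ t in x..y, P t) :
    ∃ J, HasSBVDerivative a b W P J ∧ ∀ x, J x ≠ 0 → x ∈ E ∧
      ¬ ∀ y ∈ Ioo a b, x < y → (∀ e ∈ E, e ∉ Ioo x y) → W y - W x = ∫ t in x..y, P t := by
  classical
  have hii : ∀ x ∈ Ioo a b, ∀ y ∈ Ioo a b, IntervalIntegrable P volume x y := fun x hx y hy =>
    (hP.mono_set (ordConnected_Ioo.uIcc_subset hx hy)).intervalIntegrable
  have hadd : ∀ x ∈ Ioo a b, ∀ y ∈ Ioo a b, ∀ z ∈ Ioo a b,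
      (∫ t in x..y, P t) + ∫ t in y..z, P t = ∫ t in x..z, P t := fun x hx y hy z hz =>
    intervalIntegral.integral_add_adjacent_intervals (hii x hx y hy) (hii y hy z hz)
  have hY : ∀ x, ∃ y, x ∈ E → y ∈ Ioo x b ∧ ∀ e ∈ E, e ∉ Ioo x y := by
    intro x
    by_cases hx : x ∈ E
    · obtain ⟨y, hy, hy'⟩ := exists_gt_forall_notMem_Ioo E (hE x hx).2
      exact ⟨y, fun _ => ⟨hy, hy'⟩⟩
    · exact ⟨0, fun h => absurd h hx⟩
  choose Y hY using hY
  have hYI : ∀ x ∈ E, Y x ∈ Ioo a b := fun x hx =>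
    ⟨(hE x hx).1.trans (hY x hx).1.1, (hY x hx).1.2⟩
  -- The jump is read off at any point Y x to the right of x and before the next point of E;
  -- `hright` shows that the choice does not matter.
  set J : ℝ → ℝ := fun x => if x ∈ E then W (Y x) - (∫ t in x..Y x, P t) - W x else 0 with hJ
  have hJE : ∀ x ∉ E, J x = 0 := fun x hx => if_neg hx
  have hright : ∀ x ∈ E, ∀ y ∈ Ioo a b, x < y → (∀ e ∈ E, e ∉ Ioo x y) →
      W y - W x = (∫ t in x..y, P t) + J x := by
    intro x hx y hy hxy hEe
    have hJx : J x = W (Y x) - (∫ t in x..Y x, P t) - W x := if_pos hx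
    rcases le_total y (Y x) with hle | hle
    · have h1 := h y hy (Y x) (hYI x hx) hle fun e he he' =>
        (hY x hx).2 e he ⟨hxy.trans_le he'.1, he'.2⟩
      have h2 := hadd x (hE x hx) y hy (Y x) (hYI x hx)
      linarith
    · have h1 := h (Y x) (hYI x hx) y hy hle fun e he he' =>
        hEe e he ⟨(hY x hx).1.1.trans_le he'.1, he'.2⟩
      have h2 := hadd x (hE x hx) (Y x) (hYI x hx) y hy
      linarith
  -- Induction on the number of exceptional points in the interval, splitting it at the last one.
  have hsum : ∀ n : ℕ, ∀ x ∈ Ioo a b, ∀ y ∈ Ioo a b, x ≤ y →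
      (E.filter fun e => e ∈ Ico x y).card = n →
      W y - W x = (∫ t in x..y, P t) + ∑ e ∈ E with e ∈ Ico x y, J e := by
    intro n
    induction n with
    | zero =>
      intro x hx y hy hxy hn
      rw [Finset.card_eq_zero] at hn
      rw [hn, Finset.sum_empty, add_zero]
      exact h x hx y hy hxy fun e he he' => Finset.notMem_empty e (hn ▸ Finset.mem_filter.2 ⟨he, he'⟩)
    | succ n ih =>
      intro x hx y hy hxy hn
      have hne : (E.filter fun e => e ∈ Ico x y).Nonempty := Finset.card_pos.1 (by omega)
      obtain ⟨z, hz, hmax⟩ := Finset.exists_max_image _ id hne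
      obtain ⟨hzE, hzI⟩ := Finset.mem_filter.1 hz
      have e1 : (E.filter fun e => e ∈ Ico x y) = insert z (E.filter fun e => e ∈ Ico x z) := by
        ext e
        simp only [Finset.mem_filter, Finset.mem_insert]
        constructor
        · rintro ⟨he, he'⟩
          rcases (show e ≤ z from hmax e (Finset.mem_filter.2 ⟨he, he'⟩)).eq_or_lt with h' | h'
          · exact Or.inl h'
          · exact Or.inr ⟨he, he'.1, h'⟩
        · rintro (rfl | ⟨he, he'⟩)
          · exact ⟨hzE, hzI⟩
          · exact ⟨he, he'.1, he'.2.trans hzI.2⟩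
      have hnot : z ∉ E.filter fun e => e ∈ Ico x z := fun h' =>
        lt_irrefl z (Finset.mem_filter.1 h').2.2
      have hzab : z ∈ Ioo a b := hE z hzE
      have h1 := ih x hx z hzab hzI.1 (by rw [e1, Finset.card_insert_of_notMem hnot] at hn; omega)
      have h2 := hright z hzE y hy hzI.2 fun e he he' => absurd
        (show e ≤ z from hmax e (Finset.mem_filter.2 ⟨he, hzI.1.trans he'.1.le, he'.2⟩))
        he'.1.not_ge
      rw [e1, Finset.sum_insert hnot, ← hadd x hx z hzab y hy]
      linarith
  have hJs : Summable J := summable_of_ne_finset_zero (s := E) hJE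
  have hrep : ∀ x ∈ Ioo a b, ∀ y ∈ Ioo a b, x ≤ y →
      W y - W x = (acPart a b P y - acPart a b P x) + (jumpLeft J y - jumpLeft J x) := by
    intro x hx y hy hxy
    rw [hsum _ x hx y hy hxy rfl, acPart_sub hP, jumpLeft_sub_jumpLeft hJs hxy]
    congr 1
    · refine intervalIntegral.integral_congr fun t ht => ?_
      rw [indicator_of_mem (ordConnected_Ioo.uIcc_subset hx hy ht)]
    · rw [tsum_eq_sum (s := E) fun e he => by rw [indicator_apply, hJE e he, ite_self],
        Finset.sum_filter]
      exact Finset.sum_congr rfl fun e _ => by rw [indicator_apply]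
  obtain ⟨x₀, hx₀⟩ := nonempty_Ioo.2 hab
  refine ⟨J, hasSBVDerivative_of_ae_eq_leftRep hab
    (C := W x₀ - acPart a b P x₀ - jumpLeft J x₀) hP hJs
      (fun x hx => hJE x fun h' => hx (hE x h')) ?_, ?_⟩
  · rw [ae_restrict_iff' measurableSet_Ioo]
    refine Eventually.of_forall fun x hx => ?_
    rw [leftRep]
    rcases le_total x x₀ with hle | hle
    · linarith [hrep x hx x₀ hx₀ hle]
    · linarith [hrep x₀ hx₀ x hx hle]
  · intro x hx
    have hxE : x ∈ E := by
      by_contra hcon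
      exact hx (hJE x hcon)
    refine ⟨hxE, fun hall => hx ?_⟩
    have h1 := hall (Y x) (hYI x hxE) (hY x hxE).1.1 (hY x hxE).2
    have h2 := hright x hxE (Y x) (hYI x hxE) (hY x hxE).1.1 (hY x hxE).2
    linarith

/-! ### The minimality of the graph of a minimizer -/

/-- A path family of total weight one contains a path, up to switches, with energy at most `C`. -/
theorem PathFamily.exists_energy_le {a b α β C : ℝ} {g : ℝ → ℝ} {S : Finset ℝ} {w : ℝ → ℝ}
    {q qr p : ℝ → ℝ → ℝ} {E : Finset ℝ} (h : PathFamily a b α β g C S w q qr p E) (hab : a < b)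
    (hα : 0 ≤ α) (hβ : 0 ≤ β) (hw : ∑ s ∈ S, w s = 1) :
    ∃ W, MemSBV a b W ∧ 0 ≤ C ∧ energy a b α β g W ≤ ENNReal.ofReal C ∧
      ∀ x, ∃ s ∈ S, W x = q s x := by
  have hne : S.Nonempty := by
    rw [Finset.nonempty_iff_ne_empty]
    rintro rfl
    simp at hw
  obtain ⟨f, σ, D, hf, hσ⟩ := exists_optimal_selections hne q qr
    (fun s x => p s x ^ 2 + β * (q s x - g x) ^ 2) hα measurableSet_Ioo
    (fun s hs => (h.integrableOn_sq s hs).add ((h.integrableOn_sub_sq s hs).const_mul β)) E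
  have hpot := h.potential_le f hf
  -- The weighted mean of the costs of the spliced paths is at most C and the weights sum to one, so
  -- some path costs at most C.
  obtain ⟨s, hs, hcost⟩ : ∃ s ∈ S, w s * ((∫ x in Ioo a b,
      (p (σ s x) x ^ 2 + β * (q (σ s x) x - g x) ^ 2)) + α * (D s).card) ≤ w s * C := by
    refine Finset.exists_le_of_sum_le hne ?_
    rw [← Finset.sum_mul, hw, one_mul]
    refine le_trans (Finset.sum_le_sum fun s hs =>
      mul_le_mul_of_nonneg_left (hσ s hs).2.2.2.2.2.2 (h.weight_pos s hs).le) (le_trans ?_ hpot)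
    rw [Finset.sum_comm, ← Finset.sum_add_distrib]
    refine le_of_eq (Finset.sum_congr rfl fun s _ => ?_)
    rw [mul_add, Finset.mul_sum]
  have hcost := le_of_mul_le_mul_left hcost (h.weight_pos s hs)
  obtain ⟨hS, hm, hDE, -, hconst, hjump, -⟩ := hσ s hs
  have hP : IntegrableOn (fun x => p (σ s x) x) (Ioo a b) :=
    integrableOn_selection h.integrableOn hm hS
  have hP2 : IntegrableOn (fun x => p (σ s x) x ^ 2) (Ioo a b) :=
    integrableOn_selection (F := fun s x => p s x ^ 2) h.integrableOn_sq hm hS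
  have hW2 : IntegrableOn (fun x => (q (σ s x) x - g x) ^ 2) (Ioo a b) :=
    integrableOn_selection (F := fun s x => (q s x - g x) ^ 2) h.integrableOn_sub_sq hm hS
  obtain ⟨J, hJ, hJ0⟩ := exists_hasSBVDerivative_of_sub_eq hab (W := fun x => q (σ s x) x) hP E
    h.mem_Ioo fun x hx y hy hxy hE => by
      have hxy' := hconst x y hxy hE
      rw [hxy', h.sub_eq _ (hS y) x hx y hy hxy hE]
      refine intervalIntegral.integral_congr fun t ht => ?_
      rw [uIcc_of_le hxy] at ht
      rw [hconst t y ht.2 fun e he he' => hE e he ⟨ht.1.trans he'.1, he'.2⟩]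
  -- At an unpaid point of E the value before the switch equals the right limit of the branch taken
  -- after it, so the spliced path does not jump there.
  have hJD : ∀ x, J x ≠ 0 → x ∈ D s := by
    intro x hx
    obtain ⟨hxE, hnot⟩ := hJ0 x hx
    by_contra hxD
    refine hnot fun y hy hxy hE => ?_
    rw [hjump x hxE hxD y hxy hE, h.sub_right_eq _ (hS y) x hxE y hy hxy hE]
    refine intervalIntegral.integral_congr_ae (Eventually.of_forall fun t ht => ?_)
    rw [uIoc_of_le hxy.le] at ht
    rw [hconst t y ht.2 fun e he he' => hE e he ⟨ht.1.trans_le he'.1, he'.2⟩]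
  obtain ⟨c, hc⟩ := hJ.exists_ae_eq_leftRep hab
  have hsing : ((singularSet a b fun x => q (σ s x) x).encard : ℝ≥0∞) ≤ (D s).card := by
    rw [singularSet_eq hJ hc]
    have h1 : {x | J x ≠ 0}.encard ≤ ((D s).card : ℕ∞) := by
      rw [← Set.encard_coe_eq_coe_finsetCard]
      exact Set.encard_le_encard hJD
    exact_mod_cast ENat.toENNReal_le.2 h1
  have hsplit : ∫ x in Ioo a b, (p (σ s x) x ^ 2 + β * (q (σ s x) x - g x) ^ 2) =
      (∫ x in Ioo a b, p (σ s x) x ^ 2) + β * ∫ x in Ioo a b, (q (σ s x) x - g x) ^ 2 := by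
    rw [integral_add hP2 (hW2.const_mul β), integral_const_mul]
  rw [hsplit] at hcost
  have i1 : 0 ≤ ∫ x in Ioo a b, p (σ s x) x ^ 2 := integral_nonneg fun _ => sq_nonneg _
  have i2 : 0 ≤ ∫ x in Ioo a b, (q (σ s x) x - g x) ^ 2 := integral_nonneg fun _ => sq_nonneg _
  refine ⟨fun x => q (σ s x) x, ⟨_, J, hJ⟩, le_trans (by positivity) hcost, ?_,
    fun x => ⟨σ s x, hS x, rfl⟩⟩
  refine le_trans ?_ (ENNReal.ofReal_le_ofReal hcost)
  rw [ENNReal.ofReal_add (by positivity) (by positivity), ENNReal.ofReal_add i1 (by positivity),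
    ENNReal.ofReal_mul hβ, ENNReal.ofReal_mul hα, ENNReal.ofReal_natCast,
    ofReal_integral_eq_lintegral_ofReal hP2 (Eventually.of_forall fun _ => sq_nonneg _),
    ofReal_integral_eq_lintegral_ofReal hW2 (Eventually.of_forall fun _ => sq_nonneg _), energy]
  refine add_le_add (add_le_add (le_of_eq ?_) le_rfl) (mul_le_mul_right hsing _)
  refine lintegral_congr_ae ?_
  filter_upwards [hJ.sbvDeriv_ae_eq hab] with x hx
  rw [hx]

/-- The energy of a Dirichlet minimizer is a lower bound for the lift of its competitors. -/
theorem IsDirichletMinimizer.energy_le_lift {a b c d α β : ℝ} (hac : a < c) (hcd : c < d)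
    (hdb : d < b) (hα : 0 < α) (hβ : 0 ≤ β) {g u : ℝ → ℝ}
    (hg : MemLp g ⊤ (volume.restrict (Ioo a b))) (hu : IsDirichletMinimizer a b c d α β g u)
    {T : CurrentTriple} (hT : T ∈ graphCone a b)
    (hs : SameCurrent a b (T.restrict (cylinder (Ioo a b \ Ioo c d)))
      ((graphCurrent a b u).restrict (cylinder (Ioo a b \ Ioo c d)))) :
    (energy a b α β g u : EReal) ≤ lift a b α β g T := by
  have hab : a < b := hac.trans (hcd.trans hdb)
  obtain ⟨hrect, k, lam, v, hlam, hv, hact⟩ := hT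
  have hB0 : volume (Ioo a b \ Ioo c d) ≠ 0 := by
    -- The strip left of c has positive length, which is what pins down the total weight.
    have h1 : Ioo a c ⊆ Ioo a b \ Ioo c d := fun x hx =>
      ⟨⟨hx.1, hx.2.trans (hcd.trans hdb)⟩, fun h => lt_asymm h.1 hx.2⟩
    refine ne_of_gt (lt_of_lt_of_le ?_ (measure_mono h1))
    rw [Real.volume_Ioo]
    simpa using hac
  obtain ⟨hsum, heq⟩ := eq_of_sameCurrent hab hrect hlam hv hact hu.1
    (measurableSet_Ioo.diff measurableSet_Ioo) sdiff_subset hB0 hs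
  choose L R J A hgd using fun i => (hv i).exists_graphData hab
  -- Real bounds C above the lift suffice; for an infinite lift there are none and the claim is
  -- trivial.
  refine EReal.le_of_forall_lt_iff_le.1 fun C hC => ?_
  obtain ⟨hsq, hpot⟩ := energy_add_potential_le hab hgd hα.le hβ hg hrect hlam hv hact hC.le
  obtain ⟨S, w, q, qr, p, E, hfam, hw, hq⟩ := exists_pathFamily hgd hα hg hlam hsq hpot
  obtain ⟨W, hW, hC0, hWC, hWq⟩ := hfam.exists_energy_le hab hα.le hβ (hw.trans hsum)
  have huW : ∀ᵐ x ∂(volume.restrict (Ioo a b \ Ioo c d)), u x = W x := by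
    have hL : ∀ i, ∀ᵐ x ∂(volume.restrict (Ioo a b \ Ioo c d)), v i x = L i x := fun i =>
      ae_restrict_of_ae_restrict_of_subset sdiff_subset (hgd i).ae_eq
    filter_upwards [ae_all_iff.2 heq, ae_all_iff.2 hL] with x h1 h2
    obtain ⟨s, hs, hWs⟩ := hWq x
    obtain ⟨i, hi⟩ := hq s hs x
    rw [hWs, hi, ← h2 i, h1 i]
  have h1 := (hu.2 W hW huW).trans hWC
  have h2 : (energy a b α β g u : EReal) ≤ (ENNReal.ofReal C : EReal) := by exact_mod_cast h1
  rwa [EReal.coe_ennreal_ofReal, max_eq_left hC0] at h2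

end MumfordShah

end

/-! ### The two bounds combined -/

theorem mainTheorem2 (a b c d α β : ℝ) (hac : a < c) (hcd : c < d) (hdb : d < b)
    (hα : 0 < α) (hβ : 0 ≤ β) (g : ℝ → ℝ)
    (hg : MeasureTheory.MemLp g ⊤ (MeasureTheory.volume.restrict (Set.Ioo a b)))
    (u : ℝ → ℝ) (hu : MumfordShah.IsDirichletMinimizer a b c d α β g u) :
    MumfordShah.graphCurrent a b u ∈ MumfordShah.graphCone a b ∧
    MumfordShah.liftedMin a b c d α β g (MumfordShah.graphCurrent a b u) =
      MumfordShah.lift a b α β g (MumfordShah.graphCurrent a b u) ∧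
    MumfordShah.lift a b α β g (MumfordShah.graphCurrent a b u) =
      (MumfordShah.energy a b α β g u : EReal) := by
  have hab : a < b := hac.trans (hcd.trans hdb)
  have hmem := MumfordShah.graphCurrent_mem_graphCone hab hu.1
  have hlift : MumfordShah.lift a b α β g (MumfordShah.graphCurrent a b u) =
      (MumfordShah.energy a b α β g u : EReal) :=
    le_antisymm (MumfordShah.lift_graphCurrent_le hab hα hβ hu.1)
      -- Γ_u is a competitor for itself, so the general lower bound also gives the equality of its
      -- lift with the energy.
      (hu.energy_le_lift hac hcd hdb hα hβ hg hmem fun _ _ => rfl)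
  refine ⟨hmem, le_antisymm ?_ ?_, hlift⟩
  · exact iInf₂_le (f := fun T _ => MumfordShah.lift a b α β g T)
      (MumfordShah.graphCurrent a b u) ⟨hmem, fun _ _ => rfl⟩
  · rw [hlift]
    exact le_iInf₂ fun T hT => hu.energy_le_lift hac hcd hdb hα hβ hg hT.1 hT.2
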